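/- Let $d\ge 1$, $\mathbb{R}^+=[0,\infty)$, and let $F=F(t,x)\in C^0(\mathbb{R}^+,W^{1,\infty}(\mathbb{R}^d))$ be an $\mathbb{R}^d$-valued force field. Let $(f_\epsilon)$ be a family of real functions of $(t,x,v)\in\mathbb{R}^+\times\mathbb{R}^d\times\mathbb{R}^d$. Definitions. A family $(h_\epsilon)$ is bounded in $L^1_{loc}(dt\otimes dx\otimes dv)$ if $\sup_\epsilon\int_K|h_\epsilon|\,dt\,dx\,dv<\infty$ for every compact $K\subset\mathbb{R}^+\times\mathbb{R}^d\times\mathbb{R}^d$. Such a family is - locally equiintegrable in $v$ if for every $\eta>0$ and every compact $K\subset\mathbb{R}^+\times\mathbb{R}^d\times\mathbb{R}^d$ there is $\alpha>0$ such that, for every measurable family $(A_{t,x})$ of subsets of $\mathbb{R}^d$ with $\sup_{t,x}|A_{t,x}|<\alpha$ and every $\epsilon$, $\ \int\!\!\int\left(\int_{A_{t,x}}\mathbf{1}_K|h_\epsilon|\,dv\right)dx\,dt\le\eta$; - locally equiintegrable in $x$ and $v$ if for every $\eta>0$ and every compact $K\subset\mathbb{R}^+\times\mathbb{R}^d\times\mathbb{R}^d$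 there is $\alpha>0$ such that, for every measurable family $(A_t)$ of subsets of $\mathbb{R}^d\times\mathbb{R}^d$ with $\sup_{t}|A_t|<\alpha$ and every $\epsilon$, $\ \int\left(\int_{A_t}\mathbf{1}_K|h_\epsilon|\,dx\,dv\right)dt\le\eta$. Theorem. Suppose that $(f_\epsilon)$ is bounded in $L^1_{loc}(dt\otimes dx\otimes dv)$ and locally equiintegrable in $v$, and that the family $\partial_t f_\epsilon+v\cdot\nabla_x f_\epsilon+F\cdot\nabla_v f_\epsilon$ (derivatives in the sense of distributions on $(0,\infty)\times\mathbb{R}^d\times\mathbb{R}^d$) is bounded in $L^1_{loc}(dt\otimes dx\otimes dv)$. Then: 1. $(f_\epsilon)$ is locally equiintegrable in $x$ and $v$ (nothing is asserted about equiintegrability in $t$). 2. For every $\Psi\in C^1_c(\mathbb{R}^d)$, the family $\rho_\epsilon(t,x)=\int f_\epsilon(t,x,v)\Psi(v)\,dv$, whose members belong to $L^1_{loc}(\mathbb{R}^+\times\mathbb{R}^d)$, is relatively compact with respect to $x$ in $L^1_{loc}(dt\otimes dx)$, that is, for every compact $K\subset\mathbb{R}^+\times\mathbb{R}^d$, $$\lim_{\delta\to0^+}\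 \sup_\epsilon\ \sup_{|x'|\le\delta}\ \big\|(\mathbf{1}_K\rho_\epsilon)(t,x+x')-(\mathbf{1}_K\rho_\epsilon)(t,x)\big\|_{L^1(dt\otimes dx)}=0 .$$ -/

import Mathlib

open MeasureTheory Filter Topology Set TopologicalSpace
open scoped ENNReal NNReal ContDiff Distributions

namespace KineticAveraging

/-- The Euclidean space `ℝ^d`, of positions `x` and of velocities `v`. -/
abbrev E (d : ℕ) : Type := EuclideanSpace ℝ (Fin d)

/-- The extended phase space of points `(t, x, v)`, with Lebesgue measure `dt ⊗ dx ⊗ dv`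
(the `volume` of the product). -/
abbrev Phase (d : ℕ) : Type := ℝ × E d × E d

/-- Nonnegative times `ℝ⁺ × ℝ^d × ℝ^d`, with `ℝ⁺ = [0, ∞)`. -/
def nonnegTime (d : ℕ) : Set (Phase d) := {z | 0 ≤ z.1}

/-- The interior of `nonnegTime d`, the open set where the transport equation is tested. -/
def posTime (d : ℕ) : Opens (Phase d) := ⟨{z | 0 < z.1}, isOpen_lt continuous_const continuous_fst⟩

/-- `DG` is the weak (distributional) derivative of the vector field `G` on `ℝ^d`:
`∫ (∂_w φ) G = - ∫ φ (DG w)` for every test function `φ` and every direction `w`. -/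
def HasWeakDeriv {d : ℕ} (G : E d → E d) (DG : E d → E d →L[ℝ] E d) : Prop :=
  ∀ (φ : 𝓓((⊤ : Opens (E d)), ℝ)) (w : E d),
    ∫ x, (fderiv ℝ (φ : E d → ℝ) x w) • G x = - ∫ x, φ x • DG x w

/-- The (extended) `W^{1,∞}` norm of a field `G` with weak derivative `DG`. -/
noncomputable def eW1InftyNorm {d : ℕ} (G : E d → E d) (DG : E d → E d →L[ℝ] E d) : ℝ≥0∞ :=
  eLpNorm G ∞ volume + eLpNorm DG ∞ volume

/-- `F ∈ C⁰(ℝ⁺, W^{1,∞}(ℝ^d; ℝ^d))`: `F` is a measurable function of `(t, x)`, each `F t` with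
`t ≥ 0` belongs to `W^{1,∞}`, and `t ↦ F t` is continuous on `[0, ∞)` for the `W^{1,∞}` norm. -/
def ContinuousInW1Infty {d : ℕ} (F : ℝ → E d → E d) : Prop :=
  AEStronglyMeasurable (fun p : ℝ × E d => F p.1 p.2) (volume.restrict {p | 0 ≤ p.1}) ∧
  ∃ DF : ℝ → E d → E d →L[ℝ] E d,
    (∀ t, 0 ≤ t → MemLp (F t) ∞ volume ∧ MemLp (DF t) ∞ volume ∧ HasWeakDeriv (F t) (DF t)) ∧
    ∀ t, 0 ≤ t →
      Tendsto (fun s => eW1InftyNorm (F s - F t) (DF s - DF t)) (𝓝[Ici 0] t) (𝓝 0)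

/-- The family `(f i)` is bounded in `L¹_loc(dt ⊗ dx ⊗ dv)` on `ℝ⁺ × ℝ^d × ℝ^d`: on every compact
`K ⊆ ℝ⁺ × ℝ^d × ℝ^d`, the `L¹(K)` norms of the `f i` are bounded uniformly in `i`. -/
def BoundedL1loc {d : ℕ} {ι : Type*} (f : ι → Phase d → ℝ) : Prop :=
  ∀ K : Set (Phase d), IsCompact K → K ⊆ nonnegTime d →
    (∀ i, AEStronglyMeasurable (f i) (volume.restrict K)) ∧
    ∃ C : ℝ≥0, ∀ i, ∫⁻ z in K, ‖f i z‖ₑ ≤ C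

/-- `∂_t f + v·∇_x f + F·∇_v f = g` in the sense of distributions on `(0, ∞) × ℝ^d × ℝ^d`.
As `F = F(t, x)` does not depend on `v`, the field `(1, v, F)` is divergence free, so that the
equation reads `∫ f (∂_t φ + v·∇_x φ + F·∇_v φ) = - ∫ g φ` for all test functions `φ`. -/
def IsTransport {d : ℕ} (F : ℝ → E d → E d) (f g : Phase d → ℝ) : Prop :=
  ∀ φ : 𝓓(posTime d, ℝ),
    ∫ z : Phase d, f z * fderiv ℝ (φ : Phase d → ℝ) z (1, z.2.2, F z.1 z.2.1)
      = - ∫ z : Phase d, g z * φ z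

/-- Local equiintegrability in `v`, for families depending on `(t, x, v)`: the small sets are the
(jointly measurable) families `(A_{t,x})` of subsets of `ℝ^d` with `sup_{t,x} |A_{t,x}| < α`,
encoded as `A = {(t, x, v) | v ∈ A_{t,x}}`. -/
def LocEquiintegrableV {d : ℕ} {ι : Type*} (f : ι → Phase d → ℝ) : Prop :=
  BoundedL1loc f ∧
  ∀ η : ℝ, 0 < η → ∀ K : Set (Phase d), IsCompact K → K ⊆ nonnegTime d →
    ∃ α : ℝ, 0 < α ∧ ∀ A : Set (Phase d), MeasurableSet A →
      (⨆ (t : ℝ) (x : E d), volume {v : E d | (t, x, v) ∈ A}) < ENNReal.ofReal α →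
      ∀ i, ∫⁻ z in A ∩ K, ‖f i z‖ₑ ≤ ENNReal.ofReal η

/-- Local equiintegrability in `x` and `v` (not in `t`), for families depending on `(t, x, v)`: the
small sets are the (jointly measurable) families `(A_t)` of subsets of `ℝ^d × ℝ^d` with
`sup_t |A_t| < α`, encoded as `A = {(t, x, v) | (x, v) ∈ A_t}`. -/
def LocEquiintegrableXV {d : ℕ} {ι : Type*} (f : ι → Phase d → ℝ) : Prop :=
  BoundedL1loc f ∧
  ∀ η : ℝ, 0 < η → ∀ K : Set (Phase d), IsCompact K → K ⊆ nonnegTime d →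
    ∃ α : ℝ, 0 < α ∧ ∀ A : Set (Phase d), MeasurableSet A →
      (⨆ t : ℝ, volume {p : E d × E d | (t, p) ∈ A}) < ENNReal.ofReal α →
      ∀ i, ∫⁻ z in A ∩ K, ‖f i z‖ₑ ≤ ENNReal.ofReal η

/-- The velocity average `ρ(t, x) = ∫ f(t, x, v) Ψ(v) dv`. -/
noncomputable def moment {d : ℕ} (Ψ : E d → ℝ) (f : Phase d → ℝ) : ℝ × E d → ℝ :=
  fun p => ∫ v, f (p.1, p.2, v) * Ψ v

end KineticAveraging

/-! The proof rests on duality with the characteristics and on dispersion; no Fourier analysis is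
used. On a compact set the force agrees almost everywhere with a Lipschitz field `G`, and large
velocities can be truncated, so the field (1, v, G(t, x)) has a global, Lipschitz,
measure-preserving flow `S`. Test the equation with Φ(z) = ∫_{-s}^0 φ(S_u z) du, whose derivative
along the field is φ - φ∘S_{-s}. This gives |∫ f (φ - φ∘S_{-s})| ≤ s ‖φ‖_∞ ∫ |g|
(`exists_flow_duality`): for short times an observable may be replaced by its average along the
flow, with an error uniform over the family.

Dispersion: for |s| small, the positions reached from (t, x) with velocities v and w are at distance
at least |s| |v - w| / 2 (`exists_isKineticFlow`). Hence the map from velocities to positions cannot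
send a large set of velocities into a small set of positions.

Equiintegrability. Take φ = sgn(f) 1_A and average over s. The mass of f on A is then controlled by
its mass on the points whose past trajectory spends a sizable time in A
(`lintegral_enorm_le_occupation`). If A lies over a small set of (t, x), dispersion gives these
points small velocity slices, and equiintegrability in v applies. A general small A splits into a
part with small velocity slices and a part over a small set of (t, x). The outcome,
`equiintegrable_of_transport`, is equiintegrability in (t, x, v) jointly; it implies the first
conclusion and is needed for the second.

Compactness. By duality between L¹ and L^∞, it suffices to bound ∫ f φ for φ = 1_K(t, x) Ψ(v) (ψ(t,
x - h) - ψ(t, x)), uniformly over measurable |ψ| ≤ 1. Let Q be the integral of φ along the flow. It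
is bounded, so by equiintegrability it need only be small in measure, and its L² norm is a double
integral of correlations ∫ φ · φ∘S_{s-s'}. For s ≠ s', the velocity integral sees the difference of
ψ only through the image of a velocity density under the position map. That image is absolutely
continuous by dispersion, and translations are continuous in L¹ (`tendsto_correlation`). -/

namespace KineticAveraging

/-! ### Global flows of bounded Lipschitz fields. -/

section Flow

variable {Y : Type*} [NormedAddCommGroup Y] [NormedSpace ℝ Y]

/-- Bounded, globally Lipschitz, time-continuous fields have global trajectories. -/
theorem exists_global_trajectory [CompleteSpace Y] {B : ℝ → Y → Y} {K M : ℝ≥0}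
    (hlip : ∀ t, LipschitzWith K (B t)) (hcont : ∀ y, Continuous fun t => B t y)
    (hM : ∀ t y, ‖B t y‖ ≤ M) (t₀ : ℝ) (y : Y) :
    ∃ α : ℝ → Y, α t₀ = y ∧ ∀ τ, HasDerivAt α (B τ (α τ)) τ := by
  have loc : ∀ n : ℕ, ∃ α : ℝ → Y, α t₀ = y ∧
      ∀ t ∈ Icc (t₀ - (n + 1)) (t₀ + (n + 1)),
        HasDerivWithinAt α (B t (α t)) (Icc (t₀ - (n + 1)) (t₀ + (n + 1))) t := by
    intro n
    have hn : (0 : ℝ) ≤ n := n.cast_nonneg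
    -- The bound on `B` is global, so a ball of radius `M * (n + 1)` contains the solution on the
    -- whole interval and the existence time never shrinks.
    have hp : IsPicardLindelof B (tmin := t₀ - (n + 1)) (tmax := t₀ + (n + 1))
        ⟨t₀, by constructor <;> linarith⟩ y (M * (n + 1)) 0 M K :=
      { lipschitzOnWith := fun t _ => (hlip t).lipschitzOnWith
        continuousOn := fun x _ => (hcont x).continuousOn
        norm_le := fun t _ x _ => hM t x
        mul_max_le := by simp }
    exact hp.exists_eq_forall_mem_Icc_hasDerivWithinAt₀
  choose α hα0 hα using loc
  have hder : ∀ n : ℕ, ∀ t ∈ Ioo (t₀ - (n + 1)) (t₀ + (n + 1)),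
      HasDerivAt (α n) (B t (α n t)) t := fun n t ht =>
    (hα n t (Ioo_subset_Icc_self ht)).hasDerivAt (Icc_mem_nhds ht.1 ht.2)
  have agree : ∀ m n : ℕ, m ≤ n → ∀ t ∈ Ioo (t₀ - (m + 1)) (t₀ + (m + 1)), α m t = α n t := by
    intro m n hmn t ht
    have hm : (0 : ℝ) ≤ m := m.cast_nonneg
    have hmn' : (m : ℝ) ≤ n := by exact_mod_cast hmn
    have ht₀ : t₀ ∈ Ioo (t₀ - (m + 1 : ℝ)) (t₀ + (m + 1)) := by constructor <;> linarith
    refine ODE_solution_unique_of_mem_Ioo (v := B) (K := K) (s := fun _ => univ)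
      (fun t _ => (hlip t).lipschitzOnWith) ht₀ (fun t ht => ⟨hder m t ht, trivial⟩)
      (fun t ht => ⟨hder n t ⟨?_, ?_⟩, trivial⟩) (by rw [hα0, hα0]) ht
    · linarith [ht.1]
    · linarith [ht.2]
  -- Half-length `n + 1` rather than `n` keeps `t` interior to the interval indexed by the ceiling.
  -- The further `+ 1` in `N` lets one solution serve for all times within distance 1 of `τ`.
  refine ⟨fun t => α ⌈|t - t₀|⌉₊ t, hα0 _, fun τ => ?_⟩
  set N : ℕ := ⌈|τ - t₀|⌉₊ + 1 with hN
  have hτ : |τ - t₀| ≤ ⌈|τ - t₀|⌉₊ := Nat.le_ceil _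
  have hev : (fun t => α ⌈|t - t₀|⌉₊ t) =ᶠ[𝓝 τ] α N := by
    have : ∀ᶠ t in 𝓝 τ, |t - τ| < 1 := by
      have := Metric.ball_mem_nhds τ one_pos
      filter_upwards [this] with t ht
      simpa [Real.dist_eq] using ht
    filter_upwards [this] with t ht
    apply agree
    · rw [hN]
      refine Nat.ceil_le.2 ?_
      push_cast
      have := abs_sub_le t τ t₀
      linarith
    · have h := Nat.le_ceil |t - t₀|
      rw [abs_le] at h
      constructor <;> linarith [h.1, h.2]
  have hmem : τ ∈ Ioo (t₀ - (N + 1)) (t₀ + (N + 1)) := by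
    rw [abs_le] at hτ
    rw [hN]; push_cast
    constructor <;> linarith [hτ.1, hτ.2]
  have h := (hder N τ hmem).congr_of_eventuallyEq hev
  rwa [← hev.self_of_nhds] at h

/-- Two trajectories of a `K`-Lipschitz field separate at most exponentially, forward in time. -/
theorem dist_trajectory_le {B : ℝ → Y → Y} {K : ℝ≥0} (hlip : ∀ t, LipschitzWith K (B t))
    {α β : ℝ → Y} (hα : ∀ τ, HasDerivAt α (B τ (α τ)) τ) (hβ : ∀ τ, HasDerivAt β (B τ (β τ)) τ)
    (t₀ t : ℝ) : dist (α t) (β t) ≤ Real.exp (K * |t - t₀|) * dist (α t₀) (β t₀) := by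
  rcases le_total t₀ t with h | h
  · have := dist_le_of_trajectories_ODE (v := B) hlip
      (fun t _ => (hα t).continuousAt.continuousWithinAt) (fun t _ => (hα t).hasDerivWithinAt)
      (fun t _ => (hβ t).continuousAt.continuousWithinAt) (fun t _ => (hβ t).hasDerivWithinAt)
      (le_refl (dist (α t₀) (β t₀))) t ⟨h, le_rfl⟩
    rwa [abs_of_nonneg (by linarith), mul_comm]
  -- For `t ≤ t₀`, reverse time: `γ (-t)` is a trajectory of `-B (-t)`.
  · have hlip' : ∀ t, LipschitzWith K (fun y => -B (-t) y) := fun t => (hlip (-t)).neg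
    have h1 : ∀ γ : ℝ → Y, (∀ τ, HasDerivAt γ (B τ (γ τ)) τ) → ∀ τ,
        HasDerivAt (fun t => γ (-t)) (-B (-τ) (γ (-τ))) τ := by
      intro γ hγ τ
      have := (hγ (-τ)).scomp τ (hasDerivAt_neg τ)
      simpa [Function.comp_def] using this
    have := dist_le_of_trajectories_ODE (v := fun t y => -B (-t) y) (f := fun t => α (-t))
      (g := fun t => β (-t)) (a := -t₀) (b := -t) hlip'
      (fun t _ => (h1 α hα t).continuousAt.continuousWithinAt)
      (fun t _ => (h1 α hα t).hasDerivWithinAt)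
      (fun t _ => (h1 β hβ t).continuousAt.continuousWithinAt)
      (fun t _ => (h1 β hβ t).hasDerivWithinAt)
      (le_refl _) (-t) ⟨by linarith, le_rfl⟩
    simp only [neg_neg] at this
    rw [abs_of_nonpos (by linarith), mul_comm]
    convert this using 3
    ring

/-- `S` is the flow of the bounded field `b`, Lipschitz in space locally uniformly in time. -/
structure IsLipschitzFlow {X : Type*} [NormedAddCommGroup X] [NormedSpace ℝ X]
    (b : X → X) (S : ℝ → X → X) : Prop where
  map_zero : ∀ z, S 0 z = z
  map_add : ∀ s r z, S (s + r) z = S s (S r z)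
  hasDerivAt : ∀ s z, HasDerivAt (fun s => S s z) (b (S s z)) s
  bounded : ∃ M : ℝ≥0, ∀ z, ‖b z‖ ≤ M
  lipschitz : ∀ T : ℝ, ∃ L : ℝ≥0, ∀ s, |s| ≤ T → LipschitzWith L (S s)

/-- The flow, on time-space, of the autonomous field `(1, B)`. -/
theorem exists_isLipschitzFlow [CompleteSpace Y] {B : ℝ → Y → Y} {K M : ℝ≥0}
    (hlip : ∀ t, LipschitzWith K (B t)) (hcont : ∀ y, Continuous fun t => B t y)
    (hM : ∀ t y, ‖B t y‖ ≤ M) :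
    ∃ S : ℝ → ℝ × Y → ℝ × Y, IsLipschitzFlow (fun z => (1, B z.1 z.2)) S ∧
      ∀ s z, (S s z).1 = z.1 + s := by
  choose Z hZ0 hZ using fun t y => exists_global_trajectory hlip hcont hM t y
  have huniq : ∀ t y t' τ, Z t' (Z t y t') τ = Z t y τ := by
    intro t y t' τ
    have := ODE_solution_unique_univ (v := B) (K := K) (s := fun _ => univ) (t₀ := t')
      (f := Z t' (Z t y t')) (g := Z t y)
      (fun t => (hlip t).lipschitzOnWith) (fun t => ⟨hZ _ _ t, trivial⟩)
      (fun t => ⟨hZ _ _ t, trivial⟩) (hZ0 _ _)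
    rw [this]
  have htime : ∀ t y, LipschitzWith M (Z t y) := fun t y =>
    lipschitzWith_of_nnnorm_deriv_le (fun τ => (hZ t y τ).differentiableAt) fun τ => by
      rw [(hZ t y τ).deriv]; exact hM _ _
  refine ⟨fun s z => (z.1 + s, Z z.1 z.2 (z.1 + s)), ⟨?_, ?_, ?_, ?_, ?_⟩, fun _ _ => rfl⟩
  · rintro ⟨t, y⟩
    simp [hZ0]
  · rintro s r ⟨t, y⟩
    simp only [Prod.mk.injEq]
    refine ⟨by ring, ?_⟩
    rw [huniq]
    congr 1; ring
  · rintro s ⟨t, y⟩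
    have h1 : HasDerivAt (fun s : ℝ => t + s) 1 s := (hasDerivAt_id s).const_add t
    have h2 : HasDerivAt (fun s => Z t y (t + s)) (B (t + s) (Z t y (t + s))) s := by
      simpa [Function.comp_def] using (hZ t y (t + s)).scomp s h1
    exact h1.prodMk h2
  · refine ⟨max 1 M, fun z => ?_⟩
    rw [Prod.norm_mk]
    refine max_le (by simp) ?_
    exact (hM _ _).trans (by simp)
  · intro T
    set e : ℝ≥0 := ⟨Real.exp (K * T), (Real.exp_pos _).le⟩
    -- The two orbits start at different times. Shifting the final time costs `M * D`; at time `t'`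
    -- they are `(1 + M) * D` apart; Grönwall from `t'` contributes the factor `e`.
    refine ⟨max 1 (e * (1 + M) + M), fun s hs => LipschitzWith.of_dist_le_mul ?_⟩
    rintro ⟨t, y⟩ ⟨t', y'⟩
    simp only [Prod.dist_eq]
    set D := max (dist t t') (dist y y')
    have hD1 : dist t t' ≤ D := le_max_left _ _
    have hD2 : dist y y' ≤ D := le_max_right _ _
    have hD0 : 0 ≤ D := dist_nonneg.trans hD1
    refine max_le ?_ ?_
    · rw [dist_add_right]
      refine hD1.trans (le_mul_of_one_le_left hD0 ?_)
      simp
    · have e1 : dist (Z t y (t + s)) (Z t y (t' + s)) ≤ M * D := by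
        refine ((htime t y).dist_le_mul _ _).trans ?_
        rw [dist_add_right]
        gcongr
      have e2 : dist (Z t y t') y' ≤ (1 + M) * D := by
        have h := (htime t y).dist_le_mul t' t
        rw [hZ0, dist_comm t' t] at h
        calc _ ≤ dist (Z t y t') y + dist y y' := dist_triangle _ _ _
          _ ≤ M * D + D := by gcongr; exact h.trans (by gcongr)
          _ = _ := by ring
      have e3 : dist (Z t y (t' + s)) (Z t' y' (t' + s)) ≤ e * ((1 + M) * D) := by
        have h := dist_trajectory_le hlip (hZ t y) (hZ t' y') t' (t' + s)
        rw [hZ0, add_sub_cancel_left] at h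
        refine h.trans ?_
        refine mul_le_mul ?_ e2 dist_nonneg e.2
        change _ ≤ Real.exp _
        gcongr
      calc _ ≤ M * D + e * ((1 + M) * D) := (dist_triangle _ _ _).trans (add_le_add e1 e3)
        _ = ((e * (1 + M) + M : ℝ≥0) : ℝ) * D := by push_cast; ring
        _ ≤ _ := by gcongr; exact le_max_right _ _

namespace IsLipschitzFlow

variable {X : Type*} [NormedAddCommGroup X] [NormedSpace ℝ X] {b : X → X} {S : ℝ → X → X}

theorem map_neg_map (h : IsLipschitzFlow b S) (s : ℝ) (z : X) : S (-s) (S s z) = z := by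
  rw [← h.map_add, neg_add_cancel, h.map_zero]

theorem map_map_neg (h : IsLipschitzFlow b S) (s : ℝ) (z : X) : S s (S (-s) z) = z := by
  rw [← h.map_add, add_neg_cancel, h.map_zero]

theorem dist_le {M : ℝ≥0} (h : IsLipschitzFlow b S) (hM : ∀ z, ‖b z‖ ≤ M) (s r : ℝ) (z : X) :
    dist (S s z) (S r z) ≤ M * |s - r| := by
  have : LipschitzWith M (fun s => S s z) :=
    lipschitzWith_of_nnnorm_deriv_le (fun τ => (h.hasDerivAt τ z).differentiableAt) fun τ => by
      rw [(h.hasDerivAt τ z).deriv]; exact hM _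
  simpa [Real.dist_eq] using this.dist_le_mul s r

theorem continuous (h : IsLipschitzFlow b S) (s : ℝ) : Continuous (S s) := by
  obtain ⟨L, hL⟩ := h.lipschitz |s|
  exact (hL s le_rfl).continuous

theorem continuous_uncurry (h : IsLipschitzFlow b S) : Continuous fun p : ℝ × X => S p.1 p.2 := by
  obtain ⟨M, hM⟩ := h.bounded
  rw [continuous_iff_continuousAt]
  rintro ⟨s, z⟩
  have h1 : Tendsto (fun p : ℝ × X => M * |p.1 - s| + dist (S s p.2) (S s z)) (𝓝 (s, z)) (𝓝 0) := by
    have hc : Continuous fun p : ℝ × X => M * |p.1 - s| + dist (S s p.2) (S s z) := by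
      have := h.continuous s
      fun_prop
    simpa using hc.tendsto (s, z)
  rw [ContinuousAt, tendsto_iff_dist_tendsto_zero]
  refine squeeze_zero (fun _ => dist_nonneg) (fun p => ?_) h1
  exact (dist_triangle _ (S s p.2) _).trans (by gcongr; exact h.dist_le hM _ _ _)

/-- The time-`s` map of the flow as a homeomorphism. -/
def homeomorph (h : IsLipschitzFlow b S) (s : ℝ) : X ≃ₜ X where
  toFun := S s
  invFun := S (-s)
  left_inv := h.map_neg_map s
  right_inv := h.map_map_neg s
  continuous_toFun := h.continuous s
  continuous_invFun := h.continuous (-s)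

end IsLipschitzFlow

end Flow

/-! ### Mollification and Lipschitz test functions. -/

section Mollification

open ContinuousLinearMap Convolution

variable {X : Type*} [NormedAddCommGroup X]

/-- A bump function of outer radius `δ / (n + 1)`. -/
noncomputable def shrinkingBump (X : Type*) [NormedAddCommGroup X] {δ : ℝ} (hδ : 0 < δ) (n : ℕ) :
    ContDiffBump (0 : X) where
  rIn := δ / (2 * (n + 1))
  rOut := δ / (n + 1)
  rIn_pos := by positivity
  rIn_lt_rOut := by
    have : (0 : ℝ) < n + 1 := by positivity
    gcongr
    linarith

theorem shrinkingBump_rOut_le {δ : ℝ} (hδ : 0 < δ) (n : ℕ) : (shrinkingBump X hδ n).rOut ≤ δ := by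
  change δ / (n + 1) ≤ δ
  exact div_le_self hδ.le (by simp)

theorem tendsto_shrinkingBump_rOut {δ : ℝ} (hδ : 0 < δ) :
    Tendsto (fun n => (shrinkingBump X hδ n).rOut) atTop (𝓝 0) := by
  change Tendsto (fun n : ℕ => δ / ((n : ℝ) + 1)) atTop (𝓝 0)
  exact_mod_cast (tendsto_const_div_atTop_nhds_zero_nat δ).comp (tendsto_add_atTop_nat 1)

variable [NormedSpace ℝ X] [FiniteDimensional ℝ X] [MeasurableSpace X] [BorelSpace X]
  (μ : Measure X) [μ.IsAddHaarMeasure]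
  {V : Type*} [NormedAddCommGroup V] [NormedSpace ℝ V]

/-- The mollification of `g` by a bump function of radius `δ / (n + 1)`. -/
noncomputable def mollify {δ : ℝ} (hδ : 0 < δ) (n : ℕ) (g : X → V) : X → V :=
  (shrinkingBump X hδ n).normed μ ⋆[lsmul ℝ ℝ, μ] g

variable {δ : ℝ} (hδ : 0 < δ) (n : ℕ) {g : X → V}

omit [BorelSpace X] [μ.IsAddHaarMeasure] in
theorem mollify_apply (x : X) :
    mollify μ hδ n g x = ∫ y, (shrinkingBump X hδ n).normed μ y • g (x - y) ∂μ := rfl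

theorem ae_tendsto_mollify [CompleteSpace V] (hg : LocallyIntegrable g μ) :
    ∀ᵐ x ∂μ, Tendsto (fun n => mollify μ hδ n g x) atTop (𝓝 (g x)) := by
  refine ContDiffBump.ae_convolution_tendsto_right_of_locallyIntegrable (K := 2)
    (tendsto_shrinkingBump_rOut hδ) (Eventually.of_forall fun n => ?_) hg
  change δ / (n + 1) ≤ 2 * (δ / (2 * (n + 1)))
  have : (0 : ℝ) < n + 1 := by positivity
  apply le_of_eq
  field_simp

theorem contDiff_mollify [CompleteSpace V] (hg : LocallyIntegrable g μ) :
    ContDiff ℝ ∞ (mollify μ hδ n g) :=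
  HasCompactSupport.contDiff_convolution_left _ (ContDiffBump.hasCompactSupport_normed _)
    (ContDiffBump.contDiff_normed _) hg

theorem norm_mollify_le {C : ℝ} (hg : ∀ᵐ x ∂μ, ‖g x‖ ≤ C) (x : X) :
    ‖mollify μ hδ n g x‖ ≤ C := by
  set η := shrinkingBump X hδ n
  rw [mollify_apply]
  have hi : Integrable (fun y => η.normed μ y * C) μ := (η.integrable_normed).mul_const C
  have hq : Tendsto (fun y => x - y) (ae μ) (ae μ) :=
    (quasiMeasurePreserving_sub_left μ x).tendsto_ae
  calc _ ≤ ∫ y, η.normed μ y * C ∂μ := by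
        refine norm_integral_le_of_norm_le hi ?_
        filter_upwards [hq.eventually hg] with y hy
        rw [norm_smul, Real.norm_of_nonneg (η.nonneg_normed y)]
        exact mul_le_mul_of_nonneg_left hy (η.nonneg_normed y)
    _ = C := by rw [integral_mul_const, η.integral_normed, one_mul]

theorem support_mollify_subset {A : Set X} (hg : Function.support g ⊆ A) :
    Function.support (mollify μ hδ n g) ⊆ Metric.cthickening δ A := by
  refine (support_convolution_subset _).trans ?_
  rintro _ ⟨y, hy, z, hz, rfl⟩
  rw [ContDiffBump.support_normed_eq, mem_ball_zero_iff] at hy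
  refine Metric.mem_cthickening_of_dist_le _ z _ _ (hg hz) ?_
  rw [dist_eq_norm, add_sub_cancel_right]
  exact hy.le.trans (shrinkingBump_rOut_le hδ n)

theorem tsupport_mollify_subset {A : Set X} (hg : Function.support g ⊆ A) :
    tsupport (mollify μ hδ n g) ⊆ Metric.cthickening δ A :=
  closure_minimal (support_mollify_subset μ hδ n hg) Metric.isClosed_cthickening

theorem stronglyMeasurable_fderiv_of_finiteDimensional [FiniteDimensional ℝ V] (g : X → V) :
    StronglyMeasurable (fderiv ℝ g) := by
  have : CompleteSpace V := FiniteDimensional.complete ℝ V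
  have : ProperSpace (X →L[ℝ] V) := FiniteDimensional.proper ℝ _
  borelize (X →L[ℝ] V)
  exact (measurable_fderiv ℝ g).stronglyMeasurable

/-- The derivative falls on `g` rather than on the bump: Rademacher's theorem makes `g`
differentiable at `x - y` for almost every `y`, and the Lipschitz constant dominates the difference
quotients. Thus the mollified derivatives converge almost everywhere and keep the bound `L`. -/
theorem hasFDerivAt_mollify [FiniteDimensional ℝ V] {L : ℝ≥0} (hg : LipschitzWith L g) (x : X) :
    HasFDerivAt (mollify μ hδ n g) (mollify μ hδ n (fderiv ℝ g) x) x := by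
  have : CompleteSpace V := FiniteDimensional.complete ℝ V
  set η := shrinkingBump X hδ n
  have hηc : Continuous (η.normed μ) := η.continuous_normed
  have hηs : HasCompactSupport (η.normed μ) := η.hasCompactSupport_normed
  have hq : Tendsto (fun y => x - y) (ae μ) (ae μ) :=
    (quasiMeasurePreserving_sub_left μ x).tendsto_ae
  have hcont : ∀ x, Continuous fun y => η.normed μ y • g (x - y) := fun x =>
    hηc.smul (hg.continuous.comp (continuous_const.sub continuous_id))
  have := hasFDerivAt_integral_of_dominated_loc_of_lip (𝕜 := ℝ) (μ := μ) (x₀ := x) (s := univ)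
    (F := fun x y => η.normed μ y • g (x - y))
    (F' := fun y => η.normed μ y • fderiv ℝ g (x - y)) (bound := fun y => η.normed μ y * L)
    univ_mem (Eventually.of_forall fun x => (hcont x).aestronglyMeasurable)
    ((hcont x).integrable_of_hasCompactSupport hηs.smul_right)
    (hηc.aestronglyMeasurable.smul
      ((stronglyMeasurable_fderiv_of_finiteDimensional g).comp_measurable (by fun_prop)).aestronglyMeasurable)
    (Eventually.of_forall fun y => ?_) ((η.integrable_normed).mul_const _) ?_
  · exact this.2
  · refine LipschitzWith.lipschitzOnWith (LipschitzWith.of_dist_le_mul fun a b => ?_)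
    have h0 : 0 ≤ η.normed μ y * L := mul_nonneg (η.nonneg_normed y) L.2
    rw [Real.coe_nnabs, abs_of_nonneg h0, dist_smul₀, Real.norm_of_nonneg (η.nonneg_normed y),
      mul_assoc]
    refine mul_le_mul_of_nonneg_left ?_ (η.nonneg_normed y)
    simpa using hg.dist_le_mul (a - y) (b - y)
  · filter_upwards [hq.eventually (hg.ae_differentiableAt (μ := μ))] with y hy
    have h1 : HasFDerivAt (fun x => x - y) (ContinuousLinearMap.id ℝ X) x :=
      (hasFDerivAt_id x).sub_const y
    have h2 := (hy.hasFDerivAt.comp x h1).const_smul (η.normed μ y)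
    exact h2

/-- Test functions approximating a bounded measurable function supported in a compact subset
of `Ω`. -/
theorem exists_testFunction_ae_tendsto {Ω : Opens X} {K : Set X} (hK : IsCompact K) (hKΩ : K ⊆ Ω)
    {φ : X → ℝ} (hφ : Measurable φ) (hφK : Function.support φ ⊆ K) {C : ℝ} (hC : ∀ x, |φ x| ≤ C) :
    ∃ K' : Set X, IsCompact K' ∧ K' ⊆ Ω ∧ ∃ u : ℕ → 𝓓(Ω, ℝ),
      (∀ n, tsupport (u n) ⊆ K') ∧ (∀ n x, |u n x| ≤ C) ∧
      (∀ᵐ x ∂μ, Tendsto (fun n => u n x) atTop (𝓝 (φ x))) ∧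
      (Continuous φ → ∀ x, Tendsto (fun n => u n x) atTop (𝓝 (φ x))) := by
  obtain ⟨δ, hδ, hδK⟩ := hK.exists_cthickening_subset_open Ω.isOpen hKΩ
  have hC0 : 0 ≤ C := (abs_nonneg _).trans (hC 0)
  have hint : LocallyIntegrable φ μ :=
    (locallyIntegrable_const C).mono hφ.aestronglyMeasurable
      (Eventually.of_forall fun x => by simpa [abs_of_nonneg hC0] using hC x)
  have hts := fun n => tsupport_mollify_subset μ hδ n hφK
  refine ⟨Metric.cthickening δ K, hK.cthickening, hδK, fun n =>
    ⟨mollify μ hδ n φ, contDiff_mollify μ hδ n hint,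
      hK.cthickening.of_isClosed_subset (isClosed_tsupport _) (hts n), (hts n).trans hδK⟩,
    hts, fun n x => ?_, ae_tendsto_mollify μ hδ hint, fun hc x =>
    ContDiffBump.convolution_tendsto_right_of_continuous (tendsto_shrinkingBump_rOut hδ) hc x⟩
  exact norm_mollify_le (g := φ) μ hδ n
    (Eventually.of_forall fun x => (Real.norm_eq_abs _).trans_le (hC x)) x

/-- Test functions approximating a compactly supported Lipschitz function with its derivative. -/
theorem exists_testFunction_fderiv_tendsto {Ω : Opens X} {L : ℝ≥0} {Φ : X → ℝ}
    (hL : LipschitzWith L Φ) (hc : HasCompactSupport Φ) (hΩ : tsupport Φ ⊆ Ω) :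
    ∃ K' : Set X, IsCompact K' ∧ K' ⊆ Ω ∧ ∃ C : ℝ, ∃ u : ℕ → 𝓓(Ω, ℝ),
      (∀ n, tsupport (u n) ⊆ K') ∧ (∀ n x, |u n x| ≤ C) ∧ (∀ n x, ‖fderiv ℝ (u n) x‖ ≤ L) ∧
      (∀ᵐ x ∂μ, Tendsto (fun n => u n x) atTop (𝓝 (Φ x))) ∧
      ∀ᵐ x ∂μ, Tendsto (fun n => fderiv ℝ (u n) x) atTop (𝓝 (fderiv ℝ Φ x)) := by
  obtain ⟨δ, hδ, hδK⟩ := hc.isCompact.exists_cthickening_subset_open Ω.isOpen hΩ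
  obtain ⟨C, hC⟩ := hL.continuous.bounded_above_of_compact_support hc
  have hint : LocallyIntegrable Φ μ := hL.continuous.locallyIntegrable
  have hfb : ∀ x, ‖fderiv ℝ Φ x‖ ≤ L := fun x => norm_fderiv_le_of_lipschitz ℝ hL
  have hint' : LocallyIntegrable (fderiv ℝ Φ) μ :=
    (locallyIntegrable_const (L : ℝ)).mono (stronglyMeasurable_fderiv_of_finiteDimensional Φ).aestronglyMeasurable
      (Eventually.of_forall fun x => by simpa using hfb x)
  have hts := fun n => tsupport_mollify_subset μ hδ n (subset_tsupport Φ)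
  have hfd : ∀ n x, fderiv ℝ (mollify μ hδ n Φ) x = mollify μ hδ n (fderiv ℝ Φ) x := fun n x =>
    (hasFDerivAt_mollify μ hδ n hL x).fderiv
  refine ⟨Metric.cthickening δ (tsupport Φ), hc.isCompact.cthickening, hδK, C, fun n =>
    ⟨mollify μ hδ n Φ, contDiff_mollify μ hδ n hint,
      hc.isCompact.cthickening.of_isClosed_subset (isClosed_tsupport _) (hts n),
      (hts n).trans hδK⟩,
    hts, fun n x => norm_mollify_le μ hδ n (Eventually.of_forall hC) x, fun n x => ?_,
    ae_tendsto_mollify μ hδ hint, ?_⟩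
  · change ‖fderiv ℝ (mollify μ hδ n Φ) x‖ ≤ L
    rw [hfd]
    exact norm_mollify_le μ hδ n (Eventually.of_forall hfb) x
  · filter_upwards [ae_tendsto_mollify μ hδ hint'] with x hx
    refine hx.congr fun n => ?_
    exact (hfd n x).symm

/-- A first-order equation tested against smooth functions can be tested against Lipschitz ones. -/
theorem integral_fderiv_eq_of_lipschitz {Ω : Opens X} {f g : X → ℝ} {b : X → X}
    (hf : ∀ K ⊆ (Ω : Set X), IsCompact K → IntegrableOn f K μ)
    (hg : ∀ K ⊆ (Ω : Set X), IsCompact K → IntegrableOn g K μ)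
    (hb : ∀ K ⊆ (Ω : Set X), IsCompact K → AEStronglyMeasurable b (μ.restrict K) ∧
      ∃ C : ℝ, ∀ᵐ x ∂(μ.restrict K), ‖b x‖ ≤ C)
    (h : ∀ φ : 𝓓(Ω, ℝ), ∫ x, f x * fderiv ℝ (φ : X → ℝ) x (b x) ∂μ = -∫ x, g x * φ x ∂μ)
    {L : ℝ≥0} {Φ : X → ℝ}
    (hL : LipschitzWith L Φ) (hc : HasCompactSupport Φ) (hΩ : tsupport Φ ⊆ Ω) :
    ∫ x, f x * fderiv ℝ Φ x (b x) ∂μ = -∫ x, g x * Φ x ∂μ := by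
  obtain ⟨K, hK, hKΩ, C, u, hus, huC, hud, hlim, hlim'⟩ :=
    exists_testFunction_fderiv_tendsto μ hL hc hΩ
  obtain ⟨hbm, Cb, hCb⟩ := hb K hKΩ hK
  have hKm : MeasurableSet K := hK.measurableSet
  have hzero : ∀ n, ∀ x ∉ K, u n x = 0 := fun n x hx =>
    image_eq_zero_of_notMem_tsupport fun h => hx (hus n h)
  have hdzero : ∀ n, ∀ x ∉ K, fderiv ℝ (u n) x = 0 := fun n x hx =>
    image_eq_zero_of_notMem_tsupport fun h => hx (hus n (tsupport_fderiv_subset ℝ h))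
  -- The derivatives converge only almost everywhere, but with a uniform bound and supports in one
  -- compact set `K`; this suffices for dominated convergence, `b` being essentially bounded on `K`.
  have l1 : Tendsto (fun n => ∫ x in K, f x * fderiv ℝ (u n) x (b x) ∂μ) atTop
      (𝓝 (∫ x in K, f x * fderiv ℝ Φ x (b x) ∂μ)) := by
    refine tendsto_integral_of_dominated_convergence (fun x => ‖f x‖ * (L * Cb)) (fun n => ?_)
      ((hf K hKΩ hK).norm.mul_const _) (fun n => ?_) ?_
    · exact (hf K hKΩ hK).aestronglyMeasurable.mul
        (isBoundedBilinearMap_apply.continuous.comp_aestronglyMeasurable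
          ((stronglyMeasurable_fderiv_of_finiteDimensional (u n)).aestronglyMeasurable.prodMk hbm))
    · filter_upwards [hCb] with x hx
      rw [norm_mul]
      gcongr
      exact ((fderiv ℝ (u n) x).le_opNorm _).trans
        (mul_le_mul (hud n x) hx (norm_nonneg _) L.2)
    · filter_upwards [ae_restrict_of_ae hlim'] with x hx
      exact ((((ContinuousLinearMap.apply ℝ ℝ (b x)).continuous.tendsto _).comp hx)).const_mul _
  have l2 : Tendsto (fun n => ∫ x in K, g x * u n x ∂μ) atTop (𝓝 (∫ x in K, g x * Φ x ∂μ)) := by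
    refine tendsto_integral_of_dominated_convergence (fun x => ‖g x‖ * C) (fun n => ?_)
      ((hg K hKΩ hK).norm.mul_const _) (fun n => ?_) ?_
    · exact (hg K hKΩ hK).aestronglyMeasurable.mul (u n).continuous.aestronglyMeasurable
    · refine Eventually.of_forall fun x => ?_
      rw [norm_mul]
      gcongr
      exact huC n x
    · filter_upwards [ae_restrict_of_ae hlim] with x hx using hx.const_mul _
  have hΦ0 : ∀ᵐ x ∂μ, x ∉ K → Φ x = 0 := by
    filter_upwards [hlim] with x hx hxK
    exact tendsto_nhds_unique hx (by simp [hzero _ x hxK])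
  have hΦd0 : ∀ᵐ x ∂μ, x ∉ K → fderiv ℝ Φ x = 0 := by
    filter_upwards [hlim'] with x hx hxK
    exact tendsto_nhds_unique hx (by simp [hdzero _ x hxK])
  have e1 : ∫ x in K, f x * fderiv ℝ Φ x (b x) ∂μ = ∫ x, f x * fderiv ℝ Φ x (b x) ∂μ := by
    refine setIntegral_eq_integral_of_ae_compl_eq_zero ?_
    filter_upwards [hΦd0] with x hx hxK
    simp [hx hxK]
  have e2 : ∫ x in K, g x * Φ x ∂μ = ∫ x, g x * Φ x ∂μ := by
    refine setIntegral_eq_integral_of_ae_compl_eq_zero ?_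
    filter_upwards [hΦ0] with x hx hxK
    simp [hx hxK]
  rw [← e1, ← e2]
  refine tendsto_nhds_unique l1 (l2.neg.congr fun n => ?_)
  rw [setIntegral_eq_integral_of_forall_compl_eq_zero (fun x hx => by simp [hzero n x hx]),
    setIntegral_eq_integral_of_forall_compl_eq_zero (fun x hx => by simp [hdzero n x hx]), h]

end Mollification

/-! ### Lipschitz representatives of the force field. -/

section SobolevRepresentative

open ContinuousLinearMap Convolution

variable {d : ℕ}

/-- A field with bounded weak derivative has a Lipschitz representative. -/
theorem HasWeakDeriv.exists_lipschitz_ae_eq {G : E d → E d} {DG : E d → E d →L[ℝ] E d}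
    (h : HasWeakDeriv G DG) (hG : MemLp G ∞ volume) {M : ℝ≥0}
    (hM : eLpNorm DG ∞ volume ≤ M) :
    ∃ H : E d → E d, LipschitzWith (lipschitzExtensionConstant (E d) * M) H ∧
      G =ᵐ[volume] H := by
  have hint : LocallyIntegrable G volume := hG.locallyIntegrable le_top
  have hDGM : ∀ᵐ x, ‖DG x‖ ≤ M := by
    filter_upwards [enorm_ae_le_eLpNormEssSup DG volume] with x hx
    rw [eLpNorm_exponent_top] at hM
    have := hx.trans hM
    rw [enorm_le_coe] at this
    exact_mod_cast this
  -- Testing the weak derivative against `y ↦ η (x - y)` exhibits the gradient of the mollification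
  -- as an average of `DG`, hence a Lipschitz constant independent of `n`.
  have hlip : ∀ n, LipschitzWith M (mollify volume one_pos n G) := by
    intro n
    set η := shrinkingBump (E d) one_pos n with hη
    have hηc : HasCompactSupport (η.normed volume) := η.hasCompactSupport_normed
    have hηd : ContDiff ℝ ∞ (η.normed volume) := η.contDiff_normed
    have hder : ∀ x, HasFDerivAt (mollify volume one_pos n G)
        ((fderiv ℝ (η.normed volume) ⋆[(lsmul ℝ ℝ).precompL (E d), volume] G) x) x := fun x =>
      hηc.hasFDerivAt_convolution_left _ (hηd.of_le (by simp)) hint x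
    refine lipschitzWith_of_nnnorm_fderiv_le (𝕜 := ℝ) (fun x => (hder x).differentiableAt)
      fun x => ?_
    rw [← NNReal.coe_le_coe, coe_nnnorm]
    refine ContinuousLinearMap.opNorm_le_bound _ M.2 fun w => ?_
    rw [(hder x).fderiv]
    have hφ : ContDiff ℝ ∞ fun y => η.normed volume (x - y) := hηd.comp (by fun_prop)
    have hφc : HasCompactSupport fun y => η.normed volume (x - y) :=
      hηc.comp_homeomorph (Homeomorph.subLeft x)
    let φ : 𝓓((⊤ : Opens (E d)), ℝ) := ⟨fun y => η.normed volume (x - y), hφ, hφc, by simp⟩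
    have hφd : ∀ y, fderiv ℝ (φ : E d → ℝ) y w = -fderiv ℝ (η.normed volume) (x - y) w := by
      intro y
      have h1 : HasFDerivAt (fun y : E d => x - y) (-ContinuousLinearMap.id ℝ (E d)) y :=
        (hasFDerivAt_id y).const_sub x
      have h2 := ((hηd.differentiable (by simp)) (x - y)).hasFDerivAt.comp y h1
      have h3 : HasFDerivAt (φ : E d → ℝ) _ y := h2
      rw [h3.fderiv]
      simp
    have hconv : (fderiv ℝ (η.normed volume) ⋆[(lsmul ℝ ℝ).precompL (E d), volume] G) x w
        = ∫ y, (fderiv ℝ (η.normed volume) (x - y) w) • G y := by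
      rw [convolution_eq_swap, ContinuousLinearMap.integral_apply]
      · rfl
      · exact ((hηc.fderiv ℝ).convolutionExists_left _ (hηd.continuous_fderiv (by simp))
          hint x).integrable_swap
    rw [hconv]
    have hw := h φ w
    simp_rw [hφd, neg_smul, integral_neg] at hw
    rw [neg_inj] at hw
    rw [hw]
    have hi : Integrable (fun y => η.normed volume (x - y) * (M * ‖w‖)) volume :=
      (η.integrable_normed.comp_sub_left x).mul_const _
    calc ‖∫ y, φ y • DG y w‖ ≤ ∫ y, η.normed volume (x - y) * (M * ‖w‖) := by
          refine norm_integral_le_of_norm_le hi ?_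
          filter_upwards [hDGM] with y hy
          rw [norm_smul]
          change ‖η.normed volume (x - y)‖ * _ ≤ _
          rw [Real.norm_of_nonneg (η.nonneg_normed _)]
          refine mul_le_mul_of_nonneg_left ?_ (η.nonneg_normed _)
          exact ((DG y).le_opNorm w).trans (by gcongr)
      _ = M * ‖w‖ := by
          rw [integral_mul_const, integral_sub_left_eq_self (fun y => η.normed volume y),
            η.integral_normed, one_mul]
  have hlim := ae_tendsto_mollify volume one_pos hint
  -- The bound survives on the full-measure set of convergence; extending a vector-valued Lipschitz
  -- map from there costs the factor `lipschitzExtensionConstant`.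
  have hon : LipschitzOnWith M G
      {x | Tendsto (fun n => mollify volume one_pos n G x) atTop (𝓝 (G x))} := by
    refine LipschitzOnWith.of_dist_le_mul fun x hx y hy => ?_
    exact le_of_tendsto (hx.dist hy) (Eventually.of_forall fun n => (hlip n).dist_le_mul x y)
  obtain ⟨H, hH, hHe⟩ := hon.extend_finite_dimension
  exact ⟨H, hH, by filter_upwards [hlim] with x hx using hHe hx⟩

/-- A continuous function is bounded by its essential supremum. -/
theorem enorm_le_eLpNorm_top_of_continuous {X V : Type*} [TopologicalSpace X] [MeasurableSpace X]
    [NormedAddCommGroup V] {μ : Measure X} [μ.IsOpenPosMeasure] {H : X → V} (hH : Continuous H)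
    (x : X) : ‖H x‖ₑ ≤ eLpNorm H ∞ μ := by
  rw [eLpNorm_exponent_top]
  have hcl : IsClosed {x | ‖H x‖ₑ ≤ eLpNormEssSup H μ} :=
    isClosed_le hH.enorm continuous_const
  have hd : Dense {x | ‖H x‖ₑ ≤ eLpNormEssSup H μ} :=
    Measure.dense_of_ae (enorm_ae_le_eLpNormEssSup H μ)
  have := hd.closure_eq
  rw [hcl.closure_eq] at this
  exact this.ge (mem_univ x)

/-- On a bounded time interval, a field of class `C⁰(W^{1,∞})` coincides almost everywhere with a
bounded continuous field that is uniformly Lipschitz in space. -/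
theorem ContinuousInW1Infty.exists_lipschitz_representative {F : ℝ → E d → E d}
    (hF : ContinuousInW1Infty F) {T : ℝ} (hT : 0 ≤ T) :
    ∃ (G : ℝ → E d → E d) (K M : ℝ≥0), (∀ t, LipschitzWith K (G t)) ∧
      (∀ x, Continuous fun t => G t x) ∧ (∀ t x, ‖G t x‖ ≤ M) ∧
      ∀ t ∈ Icc 0 T, F t =ᵐ[volume] G t := by
  obtain ⟨-, DF, hmem, hcont⟩ := hF
  obtain ⟨C, hC⟩ : ∃ C : ℝ≥0, ∀ t ∈ Icc 0 T, eW1InftyNorm (F t) (DF t) ≤ C := by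
    refine isCompact_Icc.induction_on (p := fun s => ∃ C : ℝ≥0, ∀ t ∈ s, eW1InftyNorm (F t) (DF t) ≤ C)
      ⟨0, by simp⟩ (fun s t hst ⟨C, hC⟩ => ⟨C, fun r hr => hC r (hst hr)⟩)
      (fun s t ⟨C, hC⟩ ⟨C', hC'⟩ => ⟨max C C', ?_⟩) (fun t ht => ?_)
    · rintro r (hr | hr)
      · exact (hC r hr).trans (by simp)
      · exact (hC' r hr).trans (by simp)
    · have h1 : ∀ᶠ s in 𝓝[Ici 0] t, eW1InftyNorm (F s - F t) (DF s - DF t) < 1 :=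
        (hcont t ht.1).eventually (gt_mem_nhds one_pos)
      have hfin : eW1InftyNorm (F t) (DF t) ≠ (∞ : ℝ≥0∞) :=
        ENNReal.add_ne_top.2 ⟨(hmem t ht.1).1.2.ne, (hmem t ht.1).2.1.2.ne⟩
      have h2 : {s | s ∈ Ici (0 : ℝ) ∧ eW1InftyNorm (F s - F t) (DF s - DF t) < 1} ∈ 𝓝[Icc 0 T] t :=
        nhdsWithin_mono t Icc_subset_Ici_self (inter_mem self_mem_nhdsWithin h1)
      refine ⟨_, h2, (1 + eW1InftyNorm (F t) (DF t)).toNNReal, ?_⟩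
      rintro s ⟨hs0, hs⟩
      rw [ENNReal.coe_toNNReal (by simp [hfin])]
      have e1 : eLpNorm (F s) ∞ volume ≤
          eLpNorm (F s - F t) ∞ volume + eLpNorm (F t) ∞ volume := by
        simpa using eLpNorm_add_le (f := F s - F t) (g := F t) (p := ∞) (μ := volume)
          ((hmem s hs0).1.1.sub (hmem t ht.1).1.1) (hmem t ht.1).1.1 le_top
      have e2 : eLpNorm (DF s) ∞ volume ≤
          eLpNorm (DF s - DF t) ∞ volume + eLpNorm (DF t) ∞ volume := by
        simpa using eLpNorm_add_le (f := DF s - DF t) (g := DF t) (p := ∞) (μ := volume)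
          ((hmem s hs0).2.1.1.sub (hmem t ht.1).2.1.1) (hmem t ht.1).2.1.1 le_top
      calc eW1InftyNorm (F s) (DF s) ≤ _ := add_le_add e1 e2
        _ = eW1InftyNorm (F s - F t) (DF s - DF t) + eW1InftyNorm (F t) (DF t) := by
          simp only [eW1InftyNorm]; ring
        _ ≤ _ := by gcongr
  have hrep : ∀ t : Icc 0 T, ∃ H : E d → E d,
      LipschitzWith (lipschitzExtensionConstant (E d) * C) H ∧ F t =ᵐ[volume] H := fun t =>
    (hmem t t.2.1).2.2.exists_lipschitz_ae_eq (hmem t t.2.1).1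
      (le_add_self.trans (hC t t.2))
  choose H hH hHe using hrep
  -- Outside `[0, T]` the field is frozen at the endpoint values, so that the flow theory applies at
  -- all times.
  refine ⟨fun t => H (projIcc 0 T hT t), _, C, fun t => hH _, fun x => ?_, fun t x => ?_,
    fun t ht => ?_⟩
  · refine Continuous.comp (g := fun t => H t x) ?_ continuous_projIcc
    rw [continuous_iff_continuousAt]
    intro t
    rw [ContinuousAt, tendsto_iff_edist_tendsto_0]
    have h1 : Tendsto (fun s : Icc 0 T => eW1InftyNorm (F s - F t) (DF s - DF t)) (𝓝 t) (𝓝 0) := by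
      refine (hcont t t.2.1).comp ?_
      exact tendsto_nhdsWithin_iff.2 ⟨continuous_subtype_val.tendsto t,
        Eventually.of_forall fun s => s.2.1⟩
    refine tendsto_of_tendsto_of_tendsto_of_le_of_le tendsto_const_nhds h1 (fun _ => zero_le)
      fun s => ?_
    -- Continuity in `t` holds at every `x`, not merely almost every one: the difference of two
    -- representatives is continuous, hence bounded everywhere by its essential supremum.
    rw [edist_eq_enorm_sub]
    refine (enorm_le_eLpNorm_top_of_continuous (μ := volume) (H := H s - H t)
      ((hH s).continuous.sub (hH t).continuous) x).trans ?_
    rw [← eLpNorm_congr_ae ((hHe s).sub (hHe t))]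
    exact le_self_add
  · have := (enorm_le_eLpNorm_top_of_continuous (μ := volume)
      (hH (projIcc 0 T hT t)).continuous x)
    rw [← eLpNorm_congr_ae (hHe _)] at this
    have := (this.trans le_self_add).trans (hC _ (projIcc 0 T hT t).2)
    rw [enorm_le_coe] at this
    exact_mod_cast this
  · have := hHe ⟨t, ht⟩
    beta_reduce
    rwa [projIcc_of_mem hT ht]

/-- Slicewise almost everywhere equality of jointly measurable functions is almost everywhere
equality on the product. -/
theorem ae_eq_of_forall_slice_ae_eq {X V : Type*} [MeasurableSpace X] {μ : Measure X} [SFinite μ]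
    [NormedAddCommGroup V] {s : Set ℝ}
    {F G : ℝ → X → V}
    (hF : AEStronglyMeasurable (fun p : ℝ × X => F p.1 p.2) ((volume.restrict s).prod μ))
    (hG : AEStronglyMeasurable (fun p : ℝ × X => G p.1 p.2) ((volume.restrict s).prod μ))
    (h : ∀ᵐ t ∂(volume.restrict s), F t =ᵐ[μ] G t) :
    ∀ᵐ p ∂((volume.restrict s).prod μ), F p.1 p.2 = G p.1 p.2 := by
  have h1 := Measure.ae_ae_of_ae_prod hF.ae_eq_mk
  have h2 := Measure.ae_ae_of_ae_prod hG.ae_eq_mk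
  -- Fubini needs a measurable equality set, hence the passage through strongly measurable
  -- modifications.
  have h3 : ∀ᵐ p ∂((volume.restrict s).prod μ), hF.mk _ p = hG.mk _ p := by
    rw [Measure.ae_prod_iff_ae_ae]
    · filter_upwards [h, h1, h2] with t ht h1t h2t
      filter_upwards [ht, h1t, h2t] with x hx h1x h2x
      rw [← h1x, ← h2x, hx]
    · exact hF.stronglyMeasurable_mk.measurableSet_eq_fun hG.stronglyMeasurable_mk
  filter_upwards [h3, hF.ae_eq_mk, hG.ae_eq_mk] with p hp h1p h2p
  rw [h1p, h2p, hp]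

end SobolevRepresentative

/-! ### Duality between the transport equation and its flow. -/

section Duality

variable {X : Type*} [NormedAddCommGroup X] [NormedSpace ℝ X] {b : X → X} {S : ℝ → X → X}

/-- The integral of `φ` along the past trajectory of duration `s`. -/
noncomputable def pastIntegral (S : ℝ → X → X) (s : ℝ) (φ : X → ℝ) (z : X) : ℝ :=
  ∫ u in (-s)..0, φ (S u z)

namespace IsLipschitzFlow

theorem continuous_trajectory (h : IsLipschitzFlow b S) (z : X) : Continuous fun u => S u z :=
  h.continuous_uncurry.comp (continuous_id.prodMk continuous_const)

/-- The flow is only Lipschitz, so even for smooth `φ` this function is no better than Lipschitz;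
this is why the equation is first extended to Lipschitz test functions. -/
theorem lipschitzWith_pastIntegral (h : IsLipschitzFlow b S) {s : ℝ} (hs : 0 ≤ s) {φ : X → ℝ}
    {L : ℝ≥0} (hφ : LipschitzWith L φ) :
    ∃ L' : ℝ≥0, LipschitzWith L' (pastIntegral S s φ) := by
  obtain ⟨L₁, hL₁⟩ := h.lipschitz s
  refine ⟨L * L₁ * s.toNNReal, LipschitzWith.of_dist_le_mul fun z w => ?_⟩
  have hc : ∀ z, Continuous fun u => φ (S u z) := fun z =>
    hφ.continuous.comp (h.continuous_trajectory z)
  rw [dist_eq_norm, pastIntegral, pastIntegral,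
    ← intervalIntegral.integral_sub ((hc z).intervalIntegrable _ _)
      ((hc w).intervalIntegrable _ _)]
  have := intervalIntegral.norm_integral_le_of_norm_le_const (a := -s) (b := 0)
    (f := fun u => φ (S u z) - φ (S u w)) (C := L * L₁ * dist z w) fun u hu => ?_
  · refine this.trans (le_of_eq ?_)
    rw [zero_sub, neg_neg, abs_of_nonneg hs]
    push_cast
    rw [Real.coe_toNNReal s hs]
    ring
  · rw [uIoc_of_le (by linarith)] at hu
    rw [← dist_eq_norm, mul_assoc]
    refine (hφ.dist_le_mul _ _).trans ?_
    gcongr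
    exact (hL₁ u (abs_le.2 ⟨hu.1.le, hu.2.trans hs⟩)).dist_le_mul z w

/-- A point where the integral is nonzero is reached, within time `s`, from a point where `φ` is
nonzero. -/
theorem support_pastIntegral_subset (h : IsLipschitzFlow b S) {s : ℝ} (hs : 0 ≤ s) {φ : X → ℝ}
    {P : Set X} (hP : ∀ z ∈ Function.support φ, ∀ u ∈ Icc 0 s, S u z ∈ P) :
    Function.support (pastIntegral S s φ) ⊆ P := by
  intro z hz
  by_contra hzP
  apply hz
  rw [pastIntegral, intervalIntegral.integral_congr (g := fun _ => 0), intervalIntegral.integral_zero]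
  intro u hu
  rw [uIcc_of_le (by linarith)] at hu
  by_contra hne
  apply hzP
  have := hP (S u z) hne (-u) ⟨by linarith [hu.2], by linarith [hu.1]⟩
  rwa [h.map_neg_map] at this

/-- At `S r z` the function is the integral of `u ↦ φ (S u z)` over the sliding window from `r - s`
to `r`. Its derivative at `r = 0` is the difference of the endpoint values, and the chain rule
identifies it with the derivative along `b`. -/
theorem fderiv_pastIntegral (h : IsLipschitzFlow b S) (s : ℝ) {φ : X → ℝ} (hφ : Continuous φ)
    {z : X} (hz : DifferentiableAt ℝ (pastIntegral S s φ) z) :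
    fderiv ℝ (pastIntegral S s φ) z (b z) = φ z - φ (S (-s) z) := by
  have hc : Continuous fun u => φ (S u z) := hφ.comp (h.continuous_trajectory z)
  have h1 : HasDerivAt (fun r => pastIntegral S s φ (S r z))
      (fderiv ℝ (pastIntegral S s φ) z (b z)) 0 := by
    have hd := h.hasDerivAt 0 z
    rw [h.map_zero] at hd
    have hz' : HasFDerivAt (pastIntegral S s φ) (fderiv ℝ (pastIntegral S s φ) z) (S 0 z) := by
      rw [h.map_zero]
      exact hz.hasFDerivAt
    exact hz'.comp_hasDerivAt (0 : ℝ) hd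
  have h2 : (fun r => pastIntegral S s φ (S r z)) =
      fun r => (∫ u in (0 : ℝ)..r, φ (S u z)) - ∫ u in (0 : ℝ)..(r - s), φ (S u z) := by
    funext r
    rw [pastIntegral]
    simp_rw [← h.map_add]
    rw [intervalIntegral.integral_comp_add_right (fun u => φ (S u z)),
      intervalIntegral.integral_interval_sub_left (hc.intervalIntegrable _ _)
        (hc.intervalIntegrable _ _)]
    congr 1 <;> ring
  have hP : ∀ r, HasDerivAt (fun r => ∫ u in (0 : ℝ)..r, φ (S u z)) (φ (S r z)) r := fun r =>
    (hc.integral_hasStrictDerivAt 0 r).hasDerivAt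
  have h3 : HasDerivAt (fun r : ℝ => r - s) 1 0 := (hasDerivAt_id 0).sub_const s
  have h4 : HasDerivAt (fun r => (∫ u in (0 : ℝ)..r, φ (S u z)) -
      ∫ u in (0 : ℝ)..(r - s), φ (S u z)) (φ (S 0 z) - φ (S (0 - s) z)) 0 := by
    refine (hP 0).sub ?_
    simpa [Function.comp_def] using (hP (0 - s)).scomp (0 : ℝ) h3
  rw [h2] at h1
  rw [h1.unique h4, h.map_zero, zero_sub]

variable [FiniteDimensional ℝ X] [MeasurableSpace X] [BorelSpace X] {μ : Measure X}
  [μ.IsAddHaarMeasure] {Ω : Opens X} {f g : X → ℝ} {b' : X → X}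

/-- Duality between the transport equation and its flow, for Lipschitz observables. -/
theorem integral_mul_sub_eq (h : IsLipschitzFlow b S)
    (hf : ∀ K ⊆ (Ω : Set X), IsCompact K → IntegrableOn f K μ)
    (hg : ∀ K ⊆ (Ω : Set X), IsCompact K → IntegrableOn g K μ)
    (hb : ∀ K ⊆ (Ω : Set X), IsCompact K → AEStronglyMeasurable b' (μ.restrict K) ∧
      ∃ C : ℝ, ∀ᵐ x ∂(μ.restrict K), ‖b' x‖ ≤ C)
    (heq : ∀ φ : 𝓓(Ω, ℝ), ∫ x, f x * fderiv ℝ (φ : X → ℝ) x (b' x) ∂μ = -∫ x, g x * φ x ∂μ)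
    {s : ℝ} (hs : 0 ≤ s) {P : Set X} (hP : IsCompact P) (hPΩ : P ⊆ Ω)
    (hbP : ∀ᵐ x ∂(μ.restrict P), b' x = b x)
    {φ : X → ℝ} {L : ℝ≥0} (hφ : LipschitzWith L φ)
    (hφP : ∀ z ∈ Function.support φ, ∀ u ∈ Icc 0 s, S u z ∈ P) :
    ∫ x, f x * (φ x - φ (S (-s) x)) ∂μ = -∫ x, g x * pastIntegral S s φ x ∂μ := by
  obtain ⟨L', hL'⟩ := h.lipschitzWith_pastIntegral hs hφ
  have hsupp := h.support_pastIntegral_subset hs hφP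
  have htsupp : tsupport (pastIntegral S s φ) ⊆ P := closure_minimal hsupp hP.isClosed
  have hcpt : HasCompactSupport (pastIntegral S s φ) :=
    hP.of_isClosed_subset (isClosed_tsupport _) htsupp
  -- Test with `pastIntegral S s φ`. Rademacher's theorem makes `fderiv_pastIntegral` available
  -- almost everywhere; outside `P`, where `b'` may differ from `b`, the derivative vanishes.
  rw [← integral_fderiv_eq_of_lipschitz μ hf hg hb heq hL' hcpt (htsupp.trans hPΩ)]
  refine integral_congr_ae ?_
  rw [ae_restrict_iff' hP.measurableSet] at hbP
  filter_upwards [hL'.ae_differentiableAt (μ := μ), hbP] with x hx hbx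
  rw [← h.fderiv_pastIntegral s hφ.continuous hx]
  by_cases hxP : x ∈ P
  · rw [hbx hxP]
  · have : fderiv ℝ (pastIntegral S s φ) x = 0 :=
      image_eq_zero_of_notMem_tsupport fun hm => hxP (htsupp (tsupport_fderiv_subset ℝ hm))
    simp [this]

/-- The flow of a weakly divergence-free field preserves the Haar measure. -/
theorem measurePreserving (h : IsLipschitzFlow b S) (hbm : AEStronglyMeasurable b μ)
    (hdiv : ∀ φ : 𝓓((⊤ : Opens X), ℝ), ∫ x, fderiv ℝ (φ : X → ℝ) x (b x) ∂μ = 0) (s : ℝ) :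
    MeasurePreserving (S s) μ μ := by
  have key : ∀ s : ℝ, 0 ≤ s → MeasurePreserving (S (-s)) μ μ := by
    intro s hs
    have hlip : ∀ {φ : X → ℝ} {L : ℝ≥0}, LipschitzWith L φ → HasCompactSupport φ →
        ∫ x, φ (S (-s) x) ∂μ = ∫ x, φ x ∂μ := by
      intro φ L hφ hφc
      have hPc : IsCompact ((fun p : ℝ × X => S p.1 p.2) '' (Icc 0 s ×ˢ tsupport φ)) :=
        (isCompact_Icc.prod hφc.isCompact).image h.continuous_uncurry
      obtain ⟨M, hM⟩ := h.bounded
      -- For a divergence-free field the constant 1 solves the transport equation without source;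
      -- duality for this solution is exactly invariance of the measure.
      have := h.integral_mul_sub_eq (μ := μ) (Ω := ⊤) (f := fun _ => 1) (g := fun _ => 0) (b' := b)
        (fun K _ hK => continuousOn_const.integrableOn_compact hK)
        (fun K _ hK => continuousOn_const.integrableOn_compact hK)
        (fun K _ _ => ⟨hbm.restrict, M, Eventually.of_forall hM⟩)
        (fun φ => by simpa using hdiv φ) hs hPc (by simp) (Eventually.of_forall fun _ => rfl) hφ
        (fun z hz u hu => ⟨(u, z), ⟨hu, subset_tsupport _ hz⟩, rfl⟩)
      simp only [one_mul, zero_mul, integral_zero, neg_zero] at this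
      have hi : Integrable φ μ := hφ.continuous.integrable_of_hasCompactSupport hφc
      have hi' : Integrable (fun x => φ (S (-s) x)) μ :=
        (hφ.continuous.comp (h.continuous (-s))).integrable_of_hasCompactSupport
          (hφc.comp_homeomorph (h.homeomorph (-s)))
      rw [integral_sub hi hi'] at this
      linarith
    have hm : Measurable (S (-s)) := (h.continuous _).measurable
    refine ⟨hm, ?_⟩
    have : (μ.map (S (-s))).Regular := Measure.Regular.map (h.homeomorph (-s))
    refine Measure.ext_of_integral_eq_on_compactlySupported fun φ => ?_
    have hφc : Continuous φ := map_continuous φ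
    rw [integral_map hm.aemeasurable hφc.aestronglyMeasurable]
    obtain ⟨C, hC⟩ := hφc.bounded_above_of_compact_support φ.hasCompactSupport
    obtain ⟨K, hK, -, u, hus, huC, -, hu⟩ := exists_testFunction_ae_tendsto μ (Ω := ⊤)
      φ.hasCompactSupport.isCompact (by simp) hφc.measurable (subset_tsupport _) hC
    have hlim := hu hφc
    have hbound : ∀ n x, ‖u n x‖ ≤ K.indicator (fun _ => C) x := by
      intro n x
      by_cases hx : x ∈ K
      · rw [indicator_of_mem hx]; exact huC n x
      · rw [indicator_of_notMem hx, image_eq_zero_of_notMem_tsupport fun hm => hx (hus n hm),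
          norm_zero]
    have l1 : Tendsto (fun n => ∫ x, u n x ∂μ) atTop (𝓝 (∫ x, φ x ∂μ)) := by
      refine tendsto_integral_of_dominated_convergence (K.indicator fun _ => C)
        (fun n => (u n).continuous.aestronglyMeasurable) ?_
        (fun n => Eventually.of_forall (hbound n)) (Eventually.of_forall hlim)
      exact (continuousOn_const.integrableOn_compact hK).integrable_indicator hK.measurableSet
    have l2 : Tendsto (fun n => ∫ x, u n (S (-s) x) ∂μ) atTop (𝓝 (∫ x, φ (S (-s) x) ∂μ)) := by
      have hK' : IsCompact (S (-s) ⁻¹' K) := (h.homeomorph (-s)).isCompact_preimage.2 hK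
      refine tendsto_integral_of_dominated_convergence ((S (-s) ⁻¹' K).indicator fun _ => C)
        (fun n => ((u n).continuous.comp (h.continuous _)).aestronglyMeasurable) ?_
        (fun n => Eventually.of_forall fun x => hbound n _)
        (Eventually.of_forall fun x => hlim _)
      exact (continuousOn_const.integrableOn_compact hK').integrable_indicator hK'.measurableSet
    refine tendsto_nhds_unique l2 (l1.congr fun n => ?_)
    obtain ⟨L, hL⟩ := ContDiff.lipschitzWith_of_hasCompactSupport (n := ∞) (u n).hasCompactSupport
      (u n).contDiff (by simp)
    exact (hlip hL (u n).hasCompactSupport).symm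
  rcases le_total 0 s with hs | hs
  · have h1 : MeasurePreserving (h.homeomorph (-s)).toMeasurableEquiv μ μ := key s hs
    have h2 := h1.symm
    have h3 : ⇑(h.homeomorph (-s)).toMeasurableEquiv.symm = S s := by
      funext z
      change S (- -s) z = _
      rw [neg_neg]
    rwa [h3] at h2
  · simpa using key (-s) (by linarith)

/-- Duality between the transport equation and its flow, for bounded measurable observables. -/
theorem abs_integral_mul_sub_le (h : IsLipschitzFlow b S) (hmp : ∀ s, MeasurePreserving (S s) μ μ)
    (hf : ∀ K ⊆ (Ω : Set X), IsCompact K → IntegrableOn f K μ)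
    (hg : ∀ K ⊆ (Ω : Set X), IsCompact K → IntegrableOn g K μ)
    (hb : ∀ K ⊆ (Ω : Set X), IsCompact K → AEStronglyMeasurable b' (μ.restrict K) ∧
      ∃ C : ℝ, ∀ᵐ x ∂(μ.restrict K), ‖b' x‖ ≤ C)
    (heq : ∀ φ : 𝓓(Ω, ℝ), ∫ x, f x * fderiv ℝ (φ : X → ℝ) x (b' x) ∂μ = -∫ x, g x * φ x ∂μ)
    {s : ℝ} (hs : 0 ≤ s) {P : Set X} (hP : IsCompact P) (hPΩ : P ⊆ Ω)
    (hbP : ∀ᵐ x ∂(μ.restrict P), b' x = b x) {U : Opens X}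
    (hU : ∀ z ∈ U, ∀ u ∈ Icc 0 s, S u z ∈ P) {K : Set X} (hK : IsCompact K) (hKU : K ⊆ U)
    {φ : X → ℝ} (hφ : Measurable φ) (hφK : Function.support φ ⊆ K) {C : ℝ}
    (hC : ∀ x, |φ x| ≤ C) :
    |∫ x, f x * (φ x - φ (S (-s) x)) ∂μ| ≤ s * C * ∫ x in P, |g x| ∂μ := by
  have hC0 : 0 ≤ C := (abs_nonneg _).trans (hC 0)
  obtain ⟨K', hK', hK'U, u, hus, huC, hlim, -⟩ :=
    exists_testFunction_ae_tendsto μ hK hKU hφ hφK hC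
  have hzero : ∀ n, ∀ x ∉ K', u n x = 0 := fun n x hx =>
    image_eq_zero_of_notMem_tsupport fun hm => hx (hus n hm)
  have hsup : ∀ n, Function.support (u n) ⊆ U := fun n x hx =>
    (u n).tsupport_subset (subset_tsupport _ hx)
  have hUP : ∀ x ∉ P, x ∉ U ∧ S (-s) x ∉ U := by
    refine fun x hx => ⟨fun hxU => hx ?_, fun hxU => hx ?_⟩
    · simpa [h.map_zero] using hU x hxU 0 ⟨le_rfl, hs⟩
    · simpa [h.map_map_neg] using hU _ hxU s ⟨hs, le_rfl⟩
  -- Invariance of the measure carries almost everywhere convergence along `S (-s)`; this is what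
  -- admits merely measurable observables.
  have hlim' : ∀ᵐ x ∂μ, Tendsto (fun n => u n (S (-s) x)) atTop (𝓝 (φ (S (-s) x))) :=
    (hmp (-s)).quasiMeasurePreserving.tendsto_ae.eventually hlim
  have l1 : Tendsto (fun n => ∫ x in P, f x * (u n x - u n (S (-s) x)) ∂μ) atTop
      (𝓝 (∫ x in P, f x * (φ x - φ (S (-s) x)) ∂μ)) := by
    refine tendsto_integral_of_dominated_convergence (fun x => ‖f x‖ * (C + C)) (fun n => ?_)
      ((hf P hPΩ hP).norm.mul_const _) (fun n => Eventually.of_forall fun x => ?_) ?_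
    · exact (hf P hPΩ hP).aestronglyMeasurable.mul
        ((u n).continuous.sub ((u n).continuous.comp (h.continuous _))).aestronglyMeasurable
    · rw [norm_mul]
      gcongr
      exact (norm_sub_le _ _).trans (add_le_add (huC n _) (huC n _))
    · filter_upwards [ae_restrict_of_ae hlim, ae_restrict_of_ae hlim'] with x hx hx'
      exact (hx.sub hx').const_mul _
  have e1 : ∫ x in P, f x * (φ x - φ (S (-s) x)) ∂μ = ∫ x, f x * (φ x - φ (S (-s) x)) ∂μ := by
    refine setIntegral_eq_integral_of_forall_compl_eq_zero fun x hx => ?_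
    have hnz : ∀ y ∉ U, φ y = 0 := fun y hy => by
      by_contra hne
      exact hy (hKU (hφK hne))
    simp [hnz _ (hUP x hx).1, hnz _ (hUP x hx).2]
  rw [← e1]
  refine le_of_tendsto l1.abs (Eventually.of_forall fun n => ?_)
  have hnz : ∀ y ∉ U, u n y = 0 := fun y hy => by
    by_contra hne
    exact hy (hsup n hne)
  obtain ⟨L, hL⟩ := ContDiff.lipschitzWith_of_hasCompactSupport (n := ∞) (u n).hasCompactSupport
    (u n).contDiff (by simp)
  have hsP : ∀ z ∈ Function.support (u n), ∀ r ∈ Icc 0 s, S r z ∈ P := fun z hz =>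
    hU z (hsup n hz)
  rw [setIntegral_eq_integral_of_forall_compl_eq_zero (fun x hx => by
      simp [hnz _ (hUP x hx).1, hnz _ (hUP x hx).2]),
    h.integral_mul_sub_eq hf hg hb heq hs hP hPΩ hbP hL hsP, abs_neg]
  have hpast : ∀ x, |pastIntegral S s (u n) x| ≤ s * C := by
    intro x
    have := intervalIntegral.norm_integral_le_of_norm_le_const (a := -s) (b := 0)
      (f := fun r => u n (S r x)) (C := C) fun r _ => huC n _
    rw [zero_sub, neg_neg, abs_of_nonneg hs, mul_comm] at this
    exact this
  have hps := h.support_pastIntegral_subset hs hsP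
  rw [← setIntegral_eq_integral_of_forall_compl_eq_zero (s := P) (fun x hx => by
      have : pastIntegral S s (u n) x = 0 := by
        by_contra hne
        exact hx (hps hne)
      simp [this]), ← integral_const_mul, ← Real.norm_eq_abs]
  refine norm_integral_le_of_norm_le ((hg P hPΩ hP).norm.const_mul _)
    (Eventually.of_forall fun x => ?_)
  rw [norm_mul, mul_comm]
  exact mul_le_mul_of_nonneg_right (hpast x) (norm_nonneg _)

end IsLipschitzFlow

end Duality

/-! ### The truncated kinetic flow and its dispersion. -/

section KineticFlow

/-- The integral of a directional derivative vanishes, even against a weight constant in that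
direction. -/
theorem integral_mul_fderiv_eq_zero {X : Type*} [NormedAddCommGroup X] [NormedSpace ℝ X]
    [FiniteDimensional ℝ X] [MeasurableSpace X] [BorelSpace X] {μ : Measure X} [μ.IsAddHaarMeasure]
    {c φ : X → ℝ} (hc : Continuous c) {w : X} (hcw : ∀ x (r : ℝ), c (x + r • w) = c x)
    (hφ : ContDiff ℝ 1 φ) (hφc : HasCompactSupport φ) :
    ∫ x, c x * fderiv ℝ φ x w ∂μ = 0 := by
  have hd : Continuous fun x => fderiv ℝ φ x w :=
    (hφ.continuous_fderiv (by simp)).clm_apply continuous_const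
  have hdc : HasCompactSupport fun x => fderiv ℝ φ x w :=
    (hφc.fderiv ℝ).comp_left (g := fun A : X →L[ℝ] ℝ => A w) rfl
  have := integral_bilinear_hasLineDerivAt_right_eq_neg_left_of_integrable (μ := μ)
    (B := ContinuousLinearMap.mul ℝ ℝ) (f := c) (f' := fun _ => 0) (g := φ)
    (g' := fun x => fderiv ℝ φ x w) (v := w) (by simp)
    ((hc.mul hd).integrable_of_hasCompactSupport hdc.mul_left)
    ((hc.mul hφ.continuous).integrable_of_hasCompactSupport hφc.mul_left)
    (fun x _ => by
      have : (fun r : ℝ => c (x + r • w)) = fun _ => c x := funext (hcw x)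
      rw [HasLineDerivAt, this]
      exact hasDerivAt_const _ _)
    (fun x _ => (hφ.differentiable (by simp) x).hasFDerivAt.hasLineDerivAt w)
  simpa using this

variable {d : ℕ}

instance : (volume : Measure (E d × E d)).IsAddHaarMeasure :=
  Measure.prod.instIsAddHaarMeasure _ _

instance : (volume : Measure (Phase d)).IsAddHaarMeasure :=
  Measure.prod.instIsAddHaarMeasure _ _

/-- The identity of `E d` can be truncated to a bounded Lipschitz field. -/
theorem exists_velocity_truncation (R : ℝ) :
    ∃ (a : E d → E d) (L M : ℝ≥0), LipschitzWith L a ∧ (∀ v, ‖a v‖ ≤ M) ∧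
      ∀ v, ‖v‖ ≤ R → a v = v := by
  let η : ContDiffBump (0 : E d) := ⟨max R 1, max R 1 + 1, by positivity, by simp⟩
  have hd : ContDiff ℝ ∞ fun v : E d => η v • v := η.contDiff.smul contDiff_id
  have hc : HasCompactSupport fun v : E d => η v • v := η.hasCompactSupport.smul_right
  obtain ⟨L, hL⟩ := ContDiff.lipschitzWith_of_hasCompactSupport hc hd (by simp)
  obtain ⟨M, hM⟩ := hd.continuous.bounded_above_of_compact_support hc
  refine ⟨_, L, M.toNNReal, hL, fun v => (hM v).trans (Real.le_coe_toNNReal M), fun v hv => ?_⟩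
  rw [η.one_of_mem_closedBall, one_smul]
  rw [mem_closedBall_zero_iff]
  exact hv.trans (le_max_left _ _)

/-- The field `(1, a(v), G(t, x))` of the (truncated) kinetic equation. -/
def kineticField (a : E d → E d) (G : ℝ → E d → E d) (z : Phase d) : Phase d :=
  (1, a z.2.2, G z.1 z.2.1)

theorem continuous_kineticField {a : E d → E d} {G : ℝ → E d → E d} (ha : Continuous a)
    (hG : Continuous fun p : ℝ × E d => G p.1 p.2) : Continuous (kineticField a G) :=
  continuous_const.prodMk ((ha.comp continuous_snd.snd).prodMk
    (hG.comp (continuous_fst.prodMk continuous_snd.fst)))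

/-- The kinetic field is divergence free. -/
theorem integral_fderiv_kineticField {a : E d → E d} {G : ℝ → E d → E d} (ha : Continuous a)
    (hG : Continuous fun p : ℝ × E d => G p.1 p.2) {φ : Phase d → ℝ} (hφ : ContDiff ℝ 1 φ)
    (hφc : HasCompactSupport φ) : ∫ z, fderiv ℝ φ z (kineticField a G z) = 0 := by
  let e := EuclideanSpace.basisFun (Fin d) ℝ
  let ca : Fin d → Phase d → ℝ := fun j z => (a z.2.2) j
  let cG : Fin d → Phase d → ℝ := fun j z => (G z.1 z.2.1) j
  have hca : ∀ j, Continuous (ca j) := fun j =>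
    (EuclideanSpace.proj (𝕜 := ℝ) j).continuous.comp (ha.comp continuous_snd.snd)
  have hcG : ∀ j, Continuous (cG j) := fun j =>
    (EuclideanSpace.proj (𝕜 := ℝ) j).continuous.comp
      (hG.comp (continuous_fst.prodMk continuous_snd.fst))
  -- No coefficient depends on the variable in which it differentiates: `a` of the velocity
  -- multiplies position derivatives, `G` of time and position multiplies velocity derivatives.
  have hdec : ∀ z : Phase d, fderiv ℝ φ z (kineticField a G z) = 1 * fderiv ℝ φ z (1, 0, 0) +
      ∑ j, ca j z * fderiv ℝ φ z (0, e j, 0) + ∑ j, cG j z * fderiv ℝ φ z (0, 0, e j) := by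
    intro z
    have h1 : kineticField a G z = ((1, 0, 0) : Phase d) + (∑ j, ca j z • ((0, e j, 0) : Phase d)) +
        ∑ j, cG j z • ((0, 0, e j) : Phase d) := by
      have e1 : ∑ j, ca j z • e j = a z.2.2 := e.sum_repr (a z.2.2)
      have e2 : ∑ j, cG j z • e j = G z.1 z.2.1 := e.sum_repr (G z.1 z.2.1)
      refine Prod.ext ?_ (Prod.ext ?_ ?_) <;>
        simp [kineticField, Prod.fst_sum, Prod.snd_sum, e1, e2]
    rw [h1]
    simp only [map_add, map_sum, map_smul, smul_eq_mul, one_mul]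
  have hcd := hφ.continuous_fderiv (by simp)
  have hint : ∀ {c : Phase d → ℝ} (w : Phase d), Continuous c →
      Integrable fun z => c z * fderiv ℝ φ z w := fun w hc =>
    (hc.mul (hcd.clm_apply continuous_const)).integrable_of_hasCompactSupport
      (((hφc.fderiv ℝ).comp_left (g := fun A : Phase d →L[ℝ] ℝ => A w) rfl).mul_left)
  simp_rw [hdec]
  rw [integral_add, integral_add, integral_finsetSum, integral_finsetSum,
    integral_mul_fderiv_eq_zero continuous_const (by simp) hφ hφc,
    Finset.sum_eq_zero, Finset.sum_eq_zero]
  · simp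
  · intro j _
    exact integral_mul_fderiv_eq_zero (hcG j) (by simp [cG]) hφ hφc
  · intro j _
    exact integral_mul_fderiv_eq_zero (hca j) (by simp [ca]) hφ hφc
  · exact fun j _ => hint _ (hcG j)
  · exact fun j _ => hint _ (hca j)
  · exact hint _ continuous_const
  · exact integrable_finsetSum _ fun j _ => hint _ (hca j)
  · exact (hint _ continuous_const).add (integrable_finsetSum _ fun j _ => hint _ (hca j))
  · exact integrable_finsetSum _ fun j _ => hint _ (hcG j)

/-- A measure-preserving flow `S` of a kinetic field, truncated at velocities larger than `R`,
that disperses positions during times shorter than `σ`. -/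
structure IsKineticFlow (G : ℝ → E d → E d) (R σ : ℝ) (b : Phase d → Phase d)
    (S : ℝ → Phase d → Phase d) : Prop extends IsLipschitzFlow b S where
  pos : 0 < σ
  time : ∀ s z, (S s z).1 = z.1 + s
  measurePreserving : ∀ s, MeasurePreserving (S s)
  field_eq : ∀ z : Phase d, ‖z.2.2‖ ≤ R → b z = (1, z.2.2, G z.1 z.2.1)
  dist_le_one : ∀ s, |s| ≤ σ → ∀ z, dist (S s z) z ≤ 1
  dispersion : ∀ s, |s| ≤ σ → ∀ t x v w, ‖v‖ ≤ R - 1 → ‖w‖ ≤ R - 1 →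
    |s| / 2 * ‖v - w‖ ≤ ‖(S s (t, x, v)).2.1 - (S s (t, x, w)).2.1‖

/-- Dispersion is a perturbation of free transport. Two orbits issued from the same (t, x) with
velocities at distance δ have positions within `L * δ` for unit times, hence accelerations within `K
* L * δ`. So their velocity difference stays within `K * L * δ * |s|` of `v - w`, and their position
difference within `K * L * δ * |s| ^ 2` of `s • (v - w)`, at most half its norm for short times.
Initial velocities below `R - 1` stay below `R`, where the truncation is inactive. -/
theorem exists_isKineticFlow {G : ℝ → E d → E d} {K M : ℝ≥0} (hlip : ∀ t, LipschitzWith K (G t))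
    (hcont : ∀ x, Continuous fun t => G t x) (hM : ∀ t x, ‖G t x‖ ≤ M) (R : ℝ) :
    ∃ σ b S, IsKineticFlow G R σ b S := by
  obtain ⟨a, La, Ma, haL, haM, ha⟩ := exists_velocity_truncation (d := d) R
  let B : ℝ → E d × E d → E d × E d := fun t y => (a y.2, G t y.1)
  have hB : ∀ t, LipschitzWith (max La K) (B t) := fun t => by
    have h1 : LipschitzWith (La * 1) fun y : E d × E d => a y.2 := haL.comp LipschitzWith.prod_snd
    have h2 : LipschitzWith (K * 1) fun y : E d × E d => G t y.1 :=
      (hlip t).comp LipschitzWith.prod_fst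
    simpa using h1.prodMk h2
  obtain ⟨S, hS, htime⟩ := exists_isLipschitzFlow (B := B) (M := max Ma M) hB
    (fun y => continuous_const.prodMk (hcont _)) (fun t y => by
      rw [Prod.norm_mk]
      push_cast
      exact max_le_max (haM _) (hM _ _))
  change IsLipschitzFlow (kineticField a G) S at hS
  have hGc : Continuous fun p : ℝ × E d => G p.1 p.2 :=
    continuous_prod_of_continuous_lipschitzWith' _ K hlip hcont
  obtain ⟨N, hN⟩ := hS.bounded
  obtain ⟨L, hL⟩ := hS.lipschitz 1
  -- The three terms allow the use of the Lipschitz constant `L` for unit times, keep displacements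
  -- below 1, and make `K * L * σ` at most 1/2.
  set σ : ℝ := min 1 (min (1 / (N + 1)) (1 / (2 * (K * L + 1)))) with hσ
  have hσ0 : 0 < σ := by positivity
  have hσ1 : σ ≤ 1 := min_le_left _ _
  have hσN : N * σ ≤ 1 := by
    have : σ ≤ 1 / (N + 1) := (min_le_right _ _).trans (min_le_left _ _)
    rw [le_div_iff₀ (by positivity)] at this
    nlinarith [N.2]
  have hσK : K * L * σ ≤ 1 / 2 := by
    have : σ ≤ 1 / (2 * (K * L + 1)) := (min_le_right _ _).trans (min_le_right _ _)
    rw [le_div_iff₀ (by positivity)] at this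
    nlinarith
  have hdist : ∀ s, |s| ≤ σ → ∀ z, dist (S s z) z ≤ 1 := fun s hs z => by
    have := hS.dist_le hN s 0 z
    rw [hS.map_zero, sub_zero] at this
    exact this.trans ((mul_le_mul_of_nonneg_left hs N.2).trans hσN)
  refine ⟨σ, kineticField a G, S, hS, hσ0, htime, ?_, ?_, hdist, ?_⟩
  · exact hS.measurePreserving (continuous_kineticField haL.continuous hGc).aestronglyMeasurable
      fun φ => integral_fderiv_kineticField haL.continuous hGc (φ.contDiff.of_le (by simp))
        φ.hasCompactSupport
  · intro z hz
    rw [kineticField, ha _ hz]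
  · intro s hs t x v w hv hw
    set δ := ‖v - w‖
    set I := Icc (-|s|) |s|
    have hI0 : (0 : ℝ) ∈ I := by simp [I]
    have hIs : s ∈ I := ⟨neg_abs_le s, le_abs_self s⟩
    have hIσ : ∀ u ∈ I, |u| ≤ σ := fun u hu => (abs_le.2 hu).trans hs
    have hX : ∀ v u, HasDerivAt (fun u => (S u (t, x, v)).2.1) (a (S u (t, x, v)).2.2) u :=
      fun v u => ((ContinuousLinearMap.fst ℝ (E d) (E d)).comp
        (ContinuousLinearMap.snd ℝ ℝ (E d × E d))).hasFDerivAt.comp_hasDerivAt u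
          (hS.hasDerivAt u (t, x, v))
    have hV : ∀ v u, HasDerivAt (fun u => (S u (t, x, v)).2.2)
        (G (S u (t, x, v)).1 (S u (t, x, v)).2.1) u :=
      fun v u => ((ContinuousLinearMap.snd ℝ (E d) (E d)).comp
        (ContinuousLinearMap.snd ℝ ℝ (E d × E d))).hasFDerivAt.comp_hasDerivAt u
          (hS.hasDerivAt u (t, x, v))
    have hVb : ∀ v, ‖v‖ ≤ R - 1 → ∀ u ∈ I, ‖(S u (t, x, v)).2.2‖ ≤ R := by
      intro v hv u hu
      have h1 : dist (S u (t, x, v)).2.2 v ≤ 1 :=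
        ((le_max_right _ _).trans (le_max_right _ _)).trans (hdist u (hIσ u hu) (t, x, v))
      have h2 := norm_le_norm_add_norm_sub' (S u (t, x, v)).2.2 v
      rw [dist_eq_norm] at h1
      linarith
    have hXd : ∀ u ∈ I, ‖(S u (t, x, v)).2.1 - (S u (t, x, w)).2.1‖ ≤ L * δ := by
      intro u hu
      have h1 := (hL u ((hIσ u hu).trans hσ1)).dist_le_mul (t, x, v) (t, x, w)
      have h2 : dist ((t, x, v) : Phase d) (t, x, w) = δ := by
        simp [dist_eq_norm, δ]
      rw [h2] at h1
      rw [← dist_eq_norm]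
      exact ((le_max_left _ _).trans (le_max_right _ _)).trans h1
    have hVd : ∀ u ∈ I, ‖((S u (t, x, v)).2.2 - (S u (t, x, w)).2.2) - (v - w)‖ ≤
        K * L * δ * |s| := by
      intro u hu
      have := (convex_Icc (-|s|) |s|).norm_image_sub_le_of_norm_hasDerivWithin_le
        (f := fun u => (S u (t, x, v)).2.2 - (S u (t, x, w)).2.2) (C := K * L * δ)
        (fun r hr => ((hV v r).sub (hV w r)).hasDerivWithinAt) (fun r hr => ?_) hI0 hu
      · simp only [hS.map_zero, sub_zero, Real.norm_eq_abs] at this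
        exact this.trans (mul_le_mul_of_nonneg_left (abs_le.2 hu) (by positivity))
      · rw [htime, htime, ← dist_eq_norm, mul_assoc]
        refine ((hlip _).dist_le_mul _ _).trans ?_
        rw [dist_eq_norm]
        gcongr
        exact hXd r hr
    have hD := (convex_Icc (-|s|) |s|).norm_image_sub_le_of_norm_hasDerivWithin_le
      (f := fun u => ((S u (t, x, v)).2.1 - (S u (t, x, w)).2.1) - u • (v - w))
      (C := K * L * δ * |s|)
      (fun r hr => (((hX v r).sub (hX w r)).sub
        ((hasDerivAt_id r).smul_const (v - w))).hasDerivWithinAt) (fun r hr => ?_) hI0 hIs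
    · simp only [hS.map_zero, sub_zero, zero_smul, sub_self, Real.norm_eq_abs] at hD
      have h1 : ‖s • (v - w)‖ = |s| * δ := by rw [norm_smul, Real.norm_eq_abs]
      have h2 := norm_sub_norm_le (s • (v - w)) ((S s (t, x, v)).2.1 - (S s (t, x, w)).2.1)
      rw [norm_sub_rev (s • (v - w)), h1] at h2
      have h3 : K * L * δ * |s| * |s| ≤ 1 / 2 * (|s| * δ) := by
        have : K * L * |s| ≤ 1 / 2 := (mul_le_mul_of_nonneg_left hs (by positivity)).trans hσK
        calc K * L * δ * |s| * |s| = K * L * |s| * (|s| * δ) := by ring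
          _ ≤ _ := by gcongr
      linarith
    · rw [ha _ (hVb v hv r hr), ha _ (hVb w hw r hr), one_smul]
      exact hVd r hr

end KineticFlow

/-! ### Duality for the kinetic equation, up to the initial time. -/

section Transport

variable {d : ℕ}

/-- The representative of a field of class `C⁰(W^{1,∞})`, on phase space. -/
theorem ContinuousInW1Infty.exists_representative_phase {F : ℝ → E d → E d}
    (hF : ContinuousInW1Infty F) {T : ℝ} (hT : 0 ≤ T) :
    ∃ (G : ℝ → E d → E d) (K M : ℝ≥0), (∀ t, LipschitzWith K (G t)) ∧
      (∀ x, Continuous fun t => G t x) ∧ (∀ t x, ‖G t x‖ ≤ M) ∧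
      ∀ᵐ z ∂((volume : Measure (Phase d)).restrict {z | z.1 ∈ Icc 0 T}),
        F z.1 z.2.1 = G z.1 z.2.1 := by
  obtain ⟨G, K, M, hlip, hcont, hM, hFG⟩ := hF.exists_lipschitz_representative hT
  refine ⟨G, K, M, hlip, hcont, hM, ?_⟩
  have hGc : Continuous fun p : ℝ × E d => G p.1 p.2 :=
    continuous_prod_of_continuous_lipschitzWith' _ K hlip hcont
  have hm : (volume.restrict (Icc 0 T)).prod (volume : Measure (E d)) =
      (volume : Measure (ℝ × E d)).restrict (Icc 0 T ×ˢ univ) := by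
    rw [Measure.volume_eq_prod, ← Measure.prod_restrict, Measure.restrict_univ]
  have hm' : (volume : Measure (Phase d)).restrict {z | z.1 ∈ Icc 0 T} =
      (volume.restrict (Icc 0 T)).prod (volume : Measure (E d × E d)) := by
    have : {z : Phase d | z.1 ∈ Icc 0 T} = Icc 0 T ×ˢ univ := by ext; simp
    rw [this, Measure.volume_eq_prod, ← Measure.prod_restrict, Measure.restrict_univ]
  have h1 : ∀ᵐ p ∂((volume.restrict (Icc 0 T)).prod (volume : Measure (E d))),
      F p.1 p.2 = G p.1 p.2 := by
    refine ae_eq_of_forall_slice_ae_eq ?_ hGc.aestronglyMeasurable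
      ((ae_restrict_iff' measurableSet_Icc).2 (Eventually.of_forall hFG))
    rw [hm]
    exact hF.1.mono_measure (Measure.restrict_mono (fun p hp => hp.1.1) le_rfl)
  have hq : Measure.QuasiMeasurePreserving (Prod.map id Prod.fst : Phase d → ℝ × E d)
      ((volume.restrict (Icc 0 T)).prod (volume : Measure (E d × E d)))
      ((volume.restrict (Icc 0 T)).prod (volume : Measure (E d))) :=
    QuasiMeasurePreserving.prodMap (Measure.QuasiMeasurePreserving.id _)
      Measure.quasiMeasurePreserving_fst
  rw [hm']
  exact hq.tendsto_ae.eventually h1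

/-- The bounded part of phase space at nonnegative times. -/
def phaseBox (d : ℕ) (r : ℝ) : Set (Phase d) := Metric.closedBall 0 r ∩ nonnegTime d

theorem isCompact_phaseBox (r : ℝ) : IsCompact (phaseBox d r) :=
  (isCompact_closedBall _ _).inter_right (isClosed_le continuous_const continuous_fst)

theorem phaseBox_subset_nonnegTime (r : ℝ) : phaseBox d r ⊆ nonnegTime d := inter_subset_right

theorem exists_subset_phaseBox {K : Set (Phase d)} (hK : IsCompact K) (hKn : K ⊆ nonnegTime d) :
    ∃ r, 0 ≤ r ∧ K ⊆ phaseBox d r := by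
  obtain ⟨r, hr0, hr⟩ := hK.isBounded.subset_closedBall_lt 0 0
  exact ⟨r, hr0.le, subset_inter hr hKn⟩

theorem IsKineticFlow.mem_phaseBox {G : ℝ → E d → E d} {R σ : ℝ} {b : Phase d → Phase d}
    {S : ℝ → Phase d → Phase d} (h : IsKineticFlow G R σ b S) {r s : ℝ} {z : Phase d}
    (hz : z ∈ phaseBox d r) (hs : s ∈ Icc 0 σ) : S s z ∈ phaseBox d (r + 1) := by
  refine ⟨?_, ?_⟩
  · rw [Metric.mem_closedBall]
    calc dist (S s z) 0 ≤ dist (S s z) z + dist z 0 := dist_triangle _ _ _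
      _ ≤ 1 + r := add_le_add (h.dist_le_one s (by rw [abs_of_nonneg hs.1]; exact hs.2) z) hz.1
      _ = _ := add_comm _ _
  · change 0 ≤ (S s z).1
    rw [h.time]
    exact add_nonneg hz.2 hs.1

theorem IsTransport.aestronglyMeasurable_field {F : ℝ → E d → E d} (hF : ContinuousInW1Infty F)
    {K : Set (Phase d)} (hKn : K ⊆ nonnegTime d) (hK : IsCompact K) :
    AEStronglyMeasurable (fun z : Phase d => ((1, z.2.2, F z.1 z.2.1) : Phase d))
      (volume.restrict K) ∧
    ∃ C : ℝ, ∀ᵐ z ∂(volume.restrict K), ‖((1, z.2.2, F z.1 z.2.1) : Phase d)‖ ≤ C := by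
  obtain ⟨r, hr, hKr⟩ := exists_subset_phaseBox hK hKn
  obtain ⟨G, L, M, hlip, hcont, hM, hFG⟩ := hF.exists_representative_phase hr
  have hGc : Continuous fun p : ℝ × E d => G p.1 p.2 :=
    continuous_prod_of_continuous_lipschitzWith' _ L hlip hcont
  have hsub : K ⊆ {z : Phase d | z.1 ∈ Icc 0 r} := fun z hz => by
    refine ⟨hKn hz, ?_⟩
    have h1 := (hKr hz).1
    rw [mem_closedBall_zero_iff] at h1
    exact (le_abs_self z.1).trans ((norm_fst_le z).trans h1)
  have hFK : ∀ᵐ z ∂(volume.restrict K), F z.1 z.2.1 = G z.1 z.2.1 :=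
    ae_restrict_of_ae_restrict_of_subset hsub hFG
  have hc : Continuous (kineticField (d := d) id G) := continuous_kineticField continuous_id hGc
  refine ⟨hc.aestronglyMeasurable.congr ?_, max 1 (max r M), ?_⟩
  · filter_upwards [hFK] with z hz
    rw [kineticField, hz, id]
  · filter_upwards [hFK, ae_restrict_mem hK.measurableSet] with z hz hzK
    have h1 := (hKr hzK).1
    rw [mem_closedBall_zero_iff] at h1
    rw [hz, Prod.norm_mk, Prod.norm_mk, norm_one]
    exact max_le_max le_rfl (max_le_max
      ((norm_snd_le z.2).trans ((norm_snd_le z).trans h1)) (hM _ _))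

/-- A flow that transports all solutions, up to their source terms. -/
theorem exists_flow_duality {F : ℝ → E d → E d} (hF : ContinuousInW1Infty F) {r : ℝ}
    (hr : 0 ≤ r) :
    ∃ G σ b S, IsKineticFlow (d := d) G (r + 3) σ b S ∧
      ∀ f g : Phase d → ℝ, (∀ K ⊆ nonnegTime d, IsCompact K → IntegrableOn f K) →
        (∀ K ⊆ nonnegTime d, IsCompact K → IntegrableOn g K) → IsTransport F f g →
        ∀ s ∈ Icc 0 σ, ∀ φ : Phase d → ℝ, Measurable φ → Function.support φ ⊆ phaseBox d r →
          ∀ C, (∀ z, |φ z| ≤ C) →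
          |∫ z, f z * (φ z - φ (S (-s) z))| ≤ s * C * ∫ z in phaseBox d (r + 2), |g z| := by
  obtain ⟨G, L, M, hlip, hcont, hM, hFG⟩ := hF.exists_representative_phase (T := r + 2)
    (by linarith)
  -- Orbits from the ball of radius `r + 1` stay in that of radius `r + 2`. The truncation level `r
  -- + 3` keeps the field exact there, and makes dispersion available for velocities up to `r + 2`.
  obtain ⟨σ, b, S, hS⟩ := exists_isKineticFlow hlip hcont hM (r + 3)
  refine ⟨G, σ, b, S, hS, fun f g hf hg heq s hs φ hφ hφr C hC => ?_⟩
  have hC0 : 0 ≤ C := (abs_nonneg _).trans (hC 0)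
  have hpos : (posTime d : Set (Phase d)) ⊆ nonnegTime d := fun z hz =>
    le_of_lt (show (0 : ℝ) < z.1 from hz)
  -- The equation is tested only at positive times, whereas `φ` may reach `t = 0`. Cutting off early
  -- times gives a bound independent of `n`, since the flow moves forward in time and keeps the
  -- supports away from `t = 0`; the cutoff is then removed by dominated convergence, `{t = 0}` and
  -- its preimage being null.
  let φn : ℕ → Phase d → ℝ := fun n => {z : Phase d | 1 / ((n : ℝ) + 1) ≤ z.1}.indicator φ
  have hcl : ∀ c : ℝ, IsClosed {z : Phase d | c ≤ z.1} := fun c =>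
    isClosed_le continuous_const continuous_fst
  have hφn : ∀ n z, |φn n z| ≤ C := fun n z => by
    by_cases hz : z ∈ {z : Phase d | 1 / ((n : ℝ) + 1) ≤ z.1}
    · simp only [φn, indicator_of_mem hz, hC z]
    · simp only [φn, indicator_of_notMem hz, abs_zero, hC0]
  have hest : ∀ n, |∫ z, f z * (φn n z - φn n (S (-s) z))| ≤
      s * C * ∫ z in phaseBox d (r + 2), |g z| := by
    intro n
    set c : ℝ := 1 / ((n : ℝ) + 1)
    have hc : 0 < c := by positivity
    let P : Set (Phase d) := Metric.closedBall 0 (r + 2) ∩ {z | c / 2 ≤ z.1}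
    have hP : IsCompact P := (isCompact_closedBall _ _).inter_right (hcl _)
    have hPpos : P ⊆ posTime d := fun z hz => lt_of_lt_of_le (half_pos hc) hz.2
    have hPbox : P ⊆ phaseBox d (r + 2) := fun z hz => ⟨hz.1, hpos (hPpos hz)⟩
    let U : Opens (Phase d) := ⟨Metric.ball 0 (r + 1) ∩ {z | c / 2 < z.1},
      Metric.isOpen_ball.inter (isOpen_lt continuous_const continuous_fst)⟩
    have key := hS.toIsLipschitzFlow.abs_integral_mul_sub_le hS.measurePreserving
      (Ω := posTime d) (f := f) (g := g) (b' := fun z => (1, z.2.2, F z.1 z.2.1))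
      (fun K hK => hf K (hK.trans hpos)) (fun K hK => hg K (hK.trans hpos))
      (fun K hK hKc => IsTransport.aestronglyMeasurable_field hF (hK.trans hpos) hKc) heq hs.1
      hP hPpos ?_ (U := U) ?_ (K := phaseBox d r ∩ {z | c ≤ z.1})
      ((isCompact_phaseBox r).inter_right (hcl c)) ?_
      (hφ.indicator (hcl c).measurableSet) ?_ (hφn n)
    · refine key.trans ?_
      refine mul_le_mul_of_nonneg_left ?_ (mul_nonneg hs.1 hC0)
      exact setIntegral_mono_set (hg _ (phaseBox_subset_nonnegTime _) (isCompact_phaseBox _)).norm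
        (Eventually.of_forall fun z => abs_nonneg _) hPbox.eventuallyLE
    · have hsub : P ⊆ {z : Phase d | z.1 ∈ Icc 0 (r + 2)} := fun z hz => by
        refine ⟨hpos (hPpos hz), ?_⟩
        have h1 := hz.1
        rw [mem_closedBall_zero_iff] at h1
        exact (le_abs_self z.1).trans ((norm_fst_le z).trans h1)
      filter_upwards [ae_restrict_of_ae_restrict_of_subset hsub hFG,
        ae_restrict_mem hP.measurableSet] with z hz hzP
      have h1 := hzP.1
      rw [mem_closedBall_zero_iff] at h1
      rw [hz, hS.field_eq z ((norm_snd_le z.2).trans ((norm_snd_le z).trans (by linarith)))]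
    · intro z hz u hu
      refine ⟨?_, ?_⟩
      · rw [Metric.mem_closedBall]
        calc dist (S u z) 0 ≤ dist (S u z) z + dist z 0 := dist_triangle _ _ _
          _ ≤ 1 + (r + 1) := add_le_add (hS.dist_le_one u
              (by rw [abs_of_nonneg hu.1]; exact hu.2.trans hs.2) z) (Metric.mem_ball.1 hz.1).le
          _ = r + 2 := by ring
      · change c / 2 ≤ (S u z).1
        rw [hS.time]
        have h2 : c / 2 < z.1 := hz.2
        linarith [hu.1]
    · intro z hz
      refine ⟨Metric.mem_ball.2 (lt_of_le_of_lt hz.1.1 (by linarith)), ?_⟩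
      have h2 : c ≤ z.1 := hz.2
      change c / 2 < z.1
      linarith
    · intro z hz
      rw [support_indicator] at hz
      exact ⟨hφr hz.2, hz.1⟩
  have hne : ∀ᵐ z : Phase d, z.1 ≠ 0 :=
    (Measure.quasiMeasurePreserving_fst (μ := (volume : Measure ℝ))
      (ν := (volume : Measure (E d × E d)))).tendsto_ae.eventually
      (Measure.ae_ne volume 0)
  have hlim : ∀ z : Phase d, z.1 ≠ 0 → Tendsto (fun n => φn n z) atTop (𝓝 (φ z)) := by
    intro z hz
    rcases lt_or_gt_of_ne hz with h | h
    · have h0 : φ z = 0 := by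
        by_contra hn
        exact absurd (hφr hn).2 (not_le.2 h)
      have : ∀ n, φn n z = 0 := fun n => by simp [φn, indicator, h0]
      simp [this, h0]
    · refine tendsto_const_nhds.congr' ?_
      have h1 : ∀ᶠ n : ℕ in atTop, 1 / ((n : ℝ) + 1) < z.1 :=
        tendsto_one_div_add_atTop_nhds_zero_nat.eventually (gt_mem_nhds h)
      filter_upwards [h1] with n hn
      exact (indicator_of_mem (show z ∈ {z : Phase d | 1 / ((n : ℝ) + 1) ≤ z.1} from hn.le) φ).symm
  have hne' : ∀ᵐ z : Phase d, (S (-s) z).1 ≠ 0 :=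
    (hS.measurePreserving (-s)).quasiMeasurePreserving.tendsto_ae.eventually hne
  have hzero : ∀ z ∉ phaseBox d (r + 2), φ z = 0 ∧ φ (S (-s) z) = 0 := by
    intro z hz
    constructor
    · by_contra hn
      have := hφr hn
      exact hz ⟨Metric.closedBall_subset_closedBall (by linarith) this.1, this.2⟩
    · by_contra hn
      have := hS.mem_phaseBox (hφr hn) hs
      rw [hS.map_map_neg] at this
      exact hz ⟨Metric.closedBall_subset_closedBall (by linarith) this.1, this.2⟩
  have hfi := hf _ (phaseBox_subset_nonnegTime (r + 2)) (isCompact_phaseBox _)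
  have e : ∀ ψ : Phase d → ℝ, (∀ z, φ z = 0 → ψ z = 0) →
      ∫ z in phaseBox d (r + 2), f z * (ψ z - ψ (S (-s) z)) =
        ∫ z, f z * (ψ z - ψ (S (-s) z)) := fun ψ hψ =>
    setIntegral_eq_integral_of_forall_compl_eq_zero fun z hz => by
      simp [hψ _ (hzero z hz).1, hψ _ (hzero z hz).2]
  rw [← e φ fun _ h => h]
  have l1 : Tendsto (fun n => ∫ z in phaseBox d (r + 2), f z * (φn n z - φn n (S (-s) z))) atTop
      (𝓝 (∫ z in phaseBox d (r + 2), f z * (φ z - φ (S (-s) z)))) := by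
    refine tendsto_integral_of_dominated_convergence (fun z => ‖f z‖ * (C + C)) (fun n => ?_)
      (hfi.norm.mul_const _) (fun n => Eventually.of_forall fun z => ?_) ?_
    · have hm : Measurable (φn n) := hφ.indicator (hcl _).measurableSet
      exact hfi.aestronglyMeasurable.mul
        (hm.sub (hm.comp (hS.continuous _).measurable)).aestronglyMeasurable
    · rw [norm_mul]
      gcongr
      exact (norm_sub_le _ _).trans (add_le_add (hφn n _) (hφn n _))
    · filter_upwards [ae_restrict_of_ae hne, ae_restrict_of_ae hne'] with z hz hz'
      exact ((hlim _ hz).sub (hlim _ hz')).const_mul _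
  refine le_of_tendsto l1.abs (Eventually.of_forall fun n => ?_)
  rw [e (φn n) fun z hz => by simp [φn, indicator, hz]]
  exact hest n

end Transport

/-! ### Dispersion estimates and transport of mass. -/

section Dispersion

variable {d : ℕ}

theorem measurePreserving_phaseAssoc :
    MeasurePreserving (MeasurableEquiv.prodAssoc : (ℝ × E d) × E d ≃ᵐ Phase d)
      ((volume : Measure (ℝ × E d)).prod volume) volume :=
  ⟨MeasurableEquiv.prodAssoc.measurable, Measure.prodAssoc_prod⟩

theorem measurable_volume_slice {A : Set (Phase d)} (hA : MeasurableSet A) :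
    Measurable fun p : ℝ × E d => volume {v | (p.1, p.2, v) ∈ A} :=
  measurable_measure_prodMk_left (MeasurableEquiv.prodAssoc.measurable hA)

theorem volume_phase {A : Set (Phase d)} (hA : MeasurableSet A) :
    volume A = ∫⁻ p : ℝ × E d, volume {v | (p.1, p.2, v) ∈ A} := by
  rw [← measurePreserving_phaseAssoc.measure_preimage hA.nullMeasurableSet,
    Measure.prod_apply (MeasurableEquiv.prodAssoc.measurable hA)]
  rfl

/-- Antilipschitz maps do not contract Lebesgue measure too much. -/
theorem volume_inter_preimage_le {D : Set (E d)} {Y : E d → E d} {K : ℝ≥0}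
    (hY : AntilipschitzWith K (D.domRestrict Y)) (B : Set (E d)) :
    volume (D ∩ Y ⁻¹' B) ≤ (K : ℝ≥0∞) ^ (d : ℝ) * volume B := by
  -- Lebesgue measure is a multiple of `d`-dimensional Hausdorff measure, for which antilipschitz
  -- bounds are purely metric; the factor `c` occurs on both sides.
  obtain ⟨c, hc⟩ : ∃ c : ℝ≥0, (volume : Measure (E d)) = c • μH[(d : ℝ)] :=
    ⟨_, Measure.isAddLeftInvariant_eq_smul _ _⟩
  have h1 : μH[(d : ℝ)] (D ∩ Y ⁻¹' B) ≤ (K : ℝ≥0∞) ^ (d : ℝ) * μH[(d : ℝ)] B := by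
    have := hY.hausdorffMeasure_preimage_le (d := d) d.cast_nonneg B
    rwa [← (isometry_subtype_coe (s := D)).hausdorffMeasure_image (Or.inl d.cast_nonneg),
      domRestrict_eq, preimage_comp, Subtype.image_preimage_coe] at this
  rw [hc]
  simp only [Measure.smul_apply]
  rw [ENNReal.smul_def, ENNReal.smul_def, smul_eq_mul, smul_eq_mul, mul_left_comm]
  gcongr

namespace IsKineticFlow

variable {G : ℝ → E d → E d} {R σ : ℝ} {b : Phase d → Phase d} {S : ℝ → Phase d → Phase d}

theorem antilipschitz_position (h : IsKineticFlow G R σ b S) {s : ℝ} (hs : s ≠ 0) (hsσ : |s| ≤ σ)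
    (t : ℝ) (x : E d) :
    AntilipschitzWith (2 / |s|).toNNReal
      ((Metric.closedBall 0 (R - 1)).domRestrict fun v => (S s (t, x, v)).2.1) := by
  refine AntilipschitzWith.of_le_mul_dist fun v w => ?_
  have h0 : 0 < |s| := abs_pos.2 hs
  have := h.dispersion s hsσ t x v w (mem_closedBall_zero_iff.1 v.2) (mem_closedBall_zero_iff.1 w.2)
  rw [Real.coe_toNNReal _ (by positivity), Subtype.dist_eq, domRestrict_apply, domRestrict_apply,
    dist_eq_norm, dist_eq_norm, div_mul_eq_mul_div, le_div_iff₀ h0]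
  linarith

/-- At fixed (t, x) the position map stretches velocity distances by at least `|s| / 2`. The
constant blows up as `s → 0`, so very short times must be treated separately. -/
theorem volume_position_preimage_le (h : IsKineticFlow G R σ b S) {s : ℝ} (hs : s ≠ 0)
    (hsσ : |s| ≤ σ) (t : ℝ) (x : E d) (B : Set (E d)) :
    volume (Metric.closedBall 0 (R - 1) ∩ {v | (S s (t, x, v)).2.1 ∈ B}) ≤
      ENNReal.ofReal (2 / |s|) ^ (d : ℝ) * volume B :=
  volume_inter_preimage_le (h.antilipschitz_position hs hsσ t x) B

/-- The time-integrated dispersion estimate. -/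
theorem lintegral_volume_position_le (h : IsKineticFlow G R σ b S) {τ s₁ : ℝ} (hτ : 0 < τ)
    (hs₁ : s₁ ≤ σ) (t : ℝ) (x : E d) {B : Set (ℝ × E d)} (hB : MeasurableSet B) :
    ∫⁻ s in Ioc 0 s₁, volume (Metric.closedBall 0 (R - 1) ∩
        {v | ((S (-s) (t, x, v)).1, (S (-s) (t, x, v)).2.1) ∈ B}) ≤
      ENNReal.ofReal τ * volume (Metric.closedBall (0 : E d) (R - 1)) +
        ENNReal.ofReal (2 / τ) ^ (d : ℝ) * volume B := by
  -- Times below `τ` are estimated trivially. Later ones see only the slice of `B` at time `t - s`,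
  -- and integrating these slices over `s` recovers at most the volume of `B` in (t, x); no bound on
  -- individual slices is needed.
  have hsub : Ioc 0 s₁ ⊆ Ioc 0 τ ∪ Ioc τ s₁ := fun s hs => by
    rcases le_or_gt s τ with hh | hh
    · exact Or.inl ⟨hs.1, hh⟩
    · exact Or.inr ⟨hh, hs.2⟩
  refine (lintegral_mono_set hsub).trans ((lintegral_union_le _ _ _).trans (add_le_add ?_ ?_))
  · calc _ ≤ ∫⁻ _ in Ioc 0 τ, volume (Metric.closedBall (0 : E d) (R - 1)) :=
          lintegral_mono fun s => measure_mono inter_subset_left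
      _ = _ := by simp [mul_comm]
  · have hmeas : Measurable fun s : ℝ => volume (Prod.mk s ⁻¹' B) :=
      measurable_measure_prodMk_left hB
    calc _ ≤ ∫⁻ s in Ioc τ s₁, ENNReal.ofReal (2 / τ) ^ (d : ℝ) * volume (Prod.mk (t - s) ⁻¹' B) := by
          refine setLIntegral_mono' measurableSet_Ioc fun s hs => ?_
          have hs0 : 0 < s := hτ.trans hs.1
          have h1 := h.volume_position_preimage_le (s := -s) (neg_ne_zero.2 hs0.ne')
            (by rw [abs_neg, abs_of_pos hs0]; exact hs.2.trans hs₁) t x (Prod.mk (t - s) ⁻¹' B)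
          rw [abs_neg, abs_of_pos hs0] at h1
          simp only [h.time]
          refine h1.trans ?_
          gcongr
          exact hs.1.le
      _ ≤ ∫⁻ s, ENNReal.ofReal (2 / τ) ^ (d : ℝ) * volume (Prod.mk (t - s) ⁻¹' B) :=
          setLIntegral_le_lintegral _ _
      _ = ENNReal.ofReal (2 / τ) ^ (d : ℝ) * ∫⁻ s, volume (Prod.mk (t - s) ⁻¹' B) :=
          lintegral_const_mul _ (hmeas.comp (measurable_const.sub measurable_id))
      _ = _ := by
          rw [lintegral_sub_left_eq_self (fun s => volume (Prod.mk s ⁻¹' B)) t,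
            Measure.volume_eq_prod, Measure.prod_apply hB]

/-- Transport of the mass of a set along the flow. -/
theorem lintegral_enorm_le (h : IsKineticFlow G R σ b S) {r : ℝ} {f : Phase d → ℝ}
    (hf : IntegrableOn f (phaseBox d (r + 1))) {s c : ℝ} (hs : s ∈ Icc 0 σ)
    (hdual : ∀ φ : Phase d → ℝ, Measurable φ → Function.support φ ⊆ phaseBox d r →
      (∀ z, |φ z| ≤ 1) → |∫ z, f z * (φ z - φ (S (-s) z))| ≤ c)
    {A : Set (Phase d)} (hA : MeasurableSet A) (hAr : A ⊆ phaseBox d r) :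
    ∫⁻ z in A, ‖f z‖ₑ ≤
      (∫⁻ z in phaseBox d (r + 1) ∩ S (-s) ⁻¹' A, ‖f z‖ₑ) + ENNReal.ofReal c := by
  have hSm : Measurable (S (-s)) := (h.continuous _).measurable
  have hA' : A ⊆ phaseBox d (r + 1) := fun z hz =>
    ⟨Metric.closedBall_subset_closedBall (by linarith) (hAr hz).1, (hAr hz).2⟩
  have hSA : S (-s) ⁻¹' A ⊆ phaseBox d (r + 1) := fun z hz => by
    have := h.mem_phaseBox (hAr hz) hs
    rwa [h.map_map_neg] at this
  rw [inter_eq_right.2 hSA]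
  have hfA := hf.mono_set hA'
  have hfSA := hf.mono_set hSA
  set f₀ := hfA.aestronglyMeasurable.mk f
  have hf₀ : f =ᵐ[volume.restrict A] f₀ := hfA.aestronglyMeasurable.ae_eq_mk
  have hf₀m : Measurable f₀ := hfA.aestronglyMeasurable.stronglyMeasurable_mk.measurable
  -- The observable is the sign of `f` on `A`, the sign being taken from a measurable modification.
  let sgn : Phase d → ℝ := fun z => if 0 ≤ f₀ z then 1 else -1
  have hsgn : ∀ z, |sgn z| = 1 := fun z => by
    by_cases hz : 0 ≤ f₀ z <;> simp [sgn, hz]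
  have hsgnm : Measurable sgn :=
    Measurable.ite (measurableSet_le measurable_const hf₀m) measurable_const measurable_const
  let φ : Phase d → ℝ := A.indicator sgn
  have hφm : Measurable φ := hsgnm.indicator hA
  have key := hdual φ hφm ((support_indicator_subset).trans hAr) fun z => by
    by_cases hz : z ∈ A
    · simp only [φ, indicator_of_mem hz, hsgn, le_refl]
    · simp only [φ, indicator_of_notMem hz, abs_zero, zero_le_one]
  have e1 : (fun z => f z * φ z) = A.indicator fun z => f z * sgn z := by
    funext z
    by_cases hz : z ∈ A <;> simp [φ, hz]
  have e2 : (fun z => f z * φ (S (-s) z)) =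
      (S (-s) ⁻¹' A).indicator fun z => f z * sgn (S (-s) z) := by
    funext z
    by_cases hz : S (-s) z ∈ A <;> simp [φ, hz]
  have i1' : IntegrableOn (fun z => f z * sgn z) A :=
    hfA.mul_bdd (c := 1) hsgnm.aestronglyMeasurable
      (Eventually.of_forall fun z => (hsgn z).le)
  have i2' : IntegrableOn (fun z => f z * sgn (S (-s) z)) (S (-s) ⁻¹' A) :=
    hfSA.mul_bdd (c := 1) (hsgnm.comp hSm).aestronglyMeasurable
      (Eventually.of_forall fun z => (hsgn _).le)
  have i1 : Integrable fun z => f z * φ z := by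
    rw [e1]; exact i1'.integrable_indicator hA
  have i2 : Integrable fun z => f z * φ (S (-s) z) := by
    rw [e2]; exact i2'.integrable_indicator (hSm hA)
  simp_rw [mul_sub] at key
  rw [integral_sub i1 i2, e1, e2, integral_indicator hA, integral_indicator (hSm hA)] at key
  have e3 : ∫ z in A, f z * sgn z = ∫ z in A, ‖f z‖ := by
    refine integral_congr_ae ?_
    filter_upwards [hf₀] with z hz
    rw [hz, Real.norm_eq_abs]
    by_cases h0 : 0 ≤ f₀ z
    · simp [sgn, h0, abs_of_nonneg h0]
    · simp [sgn, h0, abs_of_neg (not_le.1 h0)]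
  have e4 : |∫ z in S (-s) ⁻¹' A, f z * sgn (S (-s) z)| ≤ ∫ z in S (-s) ⁻¹' A, ‖f z‖ := by
    rw [← Real.norm_eq_abs]
    refine (norm_integral_le_of_norm_le hfSA.norm (Eventually.of_forall fun z => ?_))
    rw [norm_mul, Real.norm_eq_abs (sgn _), hsgn, mul_one]
  rw [e3] at key
  have e5 : ∫ z in A, ‖f z‖ ≤ (∫ z in S (-s) ⁻¹' A, ‖f z‖) + c := by
    have h1 := (abs_le.1 key).2
    have h2 := (abs_le.1 e4).2
    linarith
  rw [← ofReal_integral_norm_eq_lintegral_enorm hfA,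
    ← ofReal_integral_norm_eq_lintegral_enorm hfSA]
  exact (ENNReal.ofReal_le_ofReal e5).trans ENNReal.ofReal_add_le

end IsKineticFlow

end Dispersion

/-! ### Equiintegrability in all variables. -/

section Equiintegrability

variable {d : ℕ}

/-- The time spent in `A` by the past trajectory of duration `s₁`. -/
noncomputable def occupation (S : ℝ → Phase d → Phase d) (s₁ : ℝ) (A : Set (Phase d))
    (z : Phase d) : ℝ≥0∞ :=
  ∫⁻ s in Ioc 0 s₁, A.indicator 1 (S (-s) z)

namespace IsKineticFlow

variable {G : ℝ → E d → E d} {R σ : ℝ} {b : Phase d → Phase d} {S : ℝ → Phase d → Phase d}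

theorem measurable_uncurry_neg (h : IsKineticFlow G R σ b S) :
    Measurable fun p : ℝ × Phase d => S (-p.1) p.2 :=
  (h.continuous_uncurry.comp (continuous_fst.neg.prodMk continuous_snd)).measurable

theorem measurable_indicator_uncurry (h : IsKineticFlow G R σ b S) {A : Set (Phase d)}
    (hA : MeasurableSet A) :
    Measurable fun p : ℝ × Phase d => A.indicator (1 : Phase d → ℝ≥0∞) (S (-p.1) p.2) :=
  (measurable_one.indicator hA).comp h.measurable_uncurry_neg

theorem measurable_occupation (h : IsKineticFlow G R σ b S) (s₁ : ℝ) {A : Set (Phase d)}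
    (hA : MeasurableSet A) : Measurable (occupation S s₁ A) :=
  Measurable.lintegral_prod_left' (h.measurable_indicator_uncurry hA)

/-- The mass of a set is controlled by the mass of the set of points whose past trajectory spends
a substantial time in it. -/
theorem lintegral_enorm_le_occupation (h : IsKineticFlow G R σ b S) {r : ℝ} {f : Phase d → ℝ}
    (hf : IntegrableOn f (phaseBox d (r + 1))) {s₁ c : ℝ} (hs₁ : 0 < s₁) (hs₁σ : s₁ ≤ σ)
    (hdual : ∀ s ∈ Ioc 0 s₁, ∀ φ : Phase d → ℝ, Measurable φ →
      Function.support φ ⊆ phaseBox d r → (∀ z, |φ z| ≤ 1) →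
      |∫ z, f z * (φ z - φ (S (-s) z))| ≤ c)
    {A : Set (Phase d)} (hA : MeasurableSet A) (hAr : A ⊆ phaseBox d r) (κ : ℝ≥0∞) :
    ∫⁻ z in A, ‖f z‖ₑ ≤
      (∫⁻ z in {z | ENNReal.ofReal s₁ * κ ≤ occupation S s₁ A z} ∩ phaseBox d (r + 1), ‖f z‖ₑ) +
        κ * (∫⁻ z in phaseBox d (r + 1), ‖f z‖ₑ) + ENNReal.ofReal c := by
  set box := phaseBox d (r + 1)
  set T := ENNReal.ofReal s₁ with hT
  have hT0 : T ≠ 0 := by simpa [hT] using hs₁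
  have hvol : volume (Ioc 0 s₁) = T := by simp [hT]
  set N := {z | T * κ ≤ occupation S s₁ A z}
  have hN : MeasurableSet N := measurableSet_le measurable_const (h.measurable_occupation s₁ hA)
  have hQT : ∀ z, occupation S s₁ A z ≤ T := fun z => by
    calc occupation S s₁ A z ≤ ∫⁻ _ in Ioc 0 s₁, 1 :=
          lintegral_mono fun s => indicator_le_self' (fun _ _ => zero_le) _
      _ = T := by rw [setLIntegral_one, hvol]
  have hfm : AEMeasurable (fun z => ‖f z‖ₑ) (volume.restrict box) := hf.aestronglyMeasurable.enorm
  have step : ∀ s ∈ Ioc 0 s₁, ∫⁻ z in A, ‖f z‖ₑ ≤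
      (∫⁻ z in box, A.indicator 1 (S (-s) z) * ‖f z‖ₑ) + ENNReal.ofReal c := by
    intro s hs
    have hSA : MeasurableSet (S (-s) ⁻¹' A) := (h.continuous _).measurable hA
    refine (h.lintegral_enorm_le hf ⟨hs.1.le, hs.2.trans hs₁σ⟩ (hdual s hs) hA hAr).trans
      (le_of_eq ?_)
    congr 1
    rw [inter_comm, ← Measure.restrict_restrict hSA, ← lintegral_indicator hSA]
    refine lintegral_congr fun z => ?_
    by_cases hz : S (-s) z ∈ A <;> simp [hz, indicator]
  -- Average over `s` and exchange integrals: the preimages of `A` at the various times merge into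
  -- the occupation time as a weight.
  have hmain : T * ∫⁻ z in A, ‖f z‖ₑ ≤
      (∫⁻ z in box, occupation S s₁ A z * ‖f z‖ₑ) + T * ENNReal.ofReal c := by
    calc T * ∫⁻ z in A, ‖f z‖ₑ = ∫⁻ _ in Ioc 0 s₁, ∫⁻ z in A, ‖f z‖ₑ := by
          rw [setLIntegral_const, hvol, mul_comm]
      _ ≤ ∫⁻ s in Ioc 0 s₁,
          ((∫⁻ z in box, A.indicator 1 (S (-s) z) * ‖f z‖ₑ) + ENNReal.ofReal c) :=
        setLIntegral_mono' measurableSet_Ioc step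
      _ = (∫⁻ s in Ioc 0 s₁, ∫⁻ z in box, A.indicator 1 (S (-s) z) * ‖f z‖ₑ) +
          T * ENNReal.ofReal c := by
        rw [lintegral_add_right _ measurable_const, setLIntegral_const, hvol, mul_comm]
      _ = _ := by
        rw [lintegral_lintegral_swap
          ((h.measurable_indicator_uncurry hA).aemeasurable.mul hfm.comp_snd)]
        congr 1
        refine lintegral_congr fun z => ?_
        rw [occupation, lintegral_mul_const' _ _ enorm_ne_top]
  -- The weight is at most `T` on `N` and at most `T * κ` off it.
  have hsplit : (∫⁻ z in box, occupation S s₁ A z * ‖f z‖ₑ) ≤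
      T * (∫⁻ z in N ∩ box, ‖f z‖ₑ) + T * (κ * ∫⁻ z in box, ‖f z‖ₑ) := by
    rw [← lintegral_add_compl _ hN, Measure.restrict_restrict hN]
    refine add_le_add ?_ ?_
    · rw [← lintegral_const_mul' _ _ (by simp [hT])]
      exact lintegral_mono fun z => mul_le_mul_left (hQT z) _
    · rw [← mul_assoc, Measure.restrict_restrict hN.compl]
      calc ∫⁻ z in Nᶜ ∩ box, occupation S s₁ A z * ‖f z‖ₑ
          ≤ ∫⁻ z in Nᶜ ∩ box, T * κ * ‖f z‖ₑ := by
            refine setLIntegral_mono' (hN.compl.inter (isCompact_phaseBox _).measurableSet)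
              fun z hz => ?_
            exact mul_le_mul_left (not_le.1 (show ¬T * κ ≤ occupation S s₁ A z from hz.1)).le _
        _ ≤ ∫⁻ z in box, T * κ * ‖f z‖ₑ := lintegral_mono_set inter_subset_right
        _ = _ := lintegral_const_mul'' _ hfm
  have hfin := hmain.trans (add_le_add_left hsplit _)
  rw [← mul_add, ← mul_add] at hfin
  exact (ENNReal.mul_le_mul_iff_right hT0 (by simp [hT])).1 hfin

/-- Dispersion makes the occupation time of a set with small spatial projection small. -/
theorem lintegral_occupation_le (h : IsKineticFlow G R σ b S) {τ s₁ : ℝ} (hτ : 0 < τ)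
    (hs₁ : s₁ ≤ σ) {B : Set (ℝ × E d)} (hB : MeasurableSet B) {A : Set (Phase d)}
    (hA : MeasurableSet A) (hAB : ∀ z ∈ A, (z.1, z.2.1) ∈ B) (t : ℝ) (x : E d) :
    ∫⁻ v in Metric.closedBall 0 (R - 1), occupation S s₁ A (t, x, v) ≤
      ENNReal.ofReal τ * volume (Metric.closedBall (0 : E d) (R - 1)) +
        ENNReal.ofReal (2 / τ) ^ (d : ℝ) * volume B := by
  refine le_trans ?_ (h.lintegral_volume_position_le hτ hs₁ t x hB)
  have hm : Measurable fun p : E d × ℝ =>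
      A.indicator (1 : Phase d → ℝ≥0∞) (S (-p.2) (t, x, p.1)) :=
    (h.measurable_indicator_uncurry hA).comp (measurable_snd.prodMk
      (measurable_const.prodMk (measurable_const.prodMk measurable_fst)))
  simp only [occupation]
  rw [lintegral_lintegral_swap (f := fun v s => A.indicator 1 (S (-s) (t, x, v))) hm.aemeasurable]
  refine lintegral_mono fun s => ?_
  have hAs : MeasurableSet {v | S (-s) (t, x, v) ∈ A} :=
    ((h.continuous _).comp (by fun_prop : Continuous fun v : E d => (t, x, v))).measurable hA
  calc ∫⁻ v in Metric.closedBall 0 (R - 1), A.indicator 1 (S (-s) (t, x, v))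
      = ∫⁻ v in Metric.closedBall 0 (R - 1), {v | S (-s) (t, x, v) ∈ A}.indicator 1 v := rfl
    _ = volume ({v | S (-s) (t, x, v) ∈ A} ∩ Metric.closedBall 0 (R - 1)) := by
        rw [lintegral_indicator_one hAs, Measure.restrict_apply hAs]
    _ ≤ volume (Metric.closedBall 0 (R - 1) ∩
          {v | ((S (-s) (t, x, v)).1, (S (-s) (t, x, v)).2.1) ∈ B}) :=
        measure_mono fun v hv => ⟨hv.2, hAB _ hv.1⟩

end IsKineticFlow

theorem BoundedL1loc.integrableOn {ι : Type*} {f : ι → Phase d → ℝ} (hf : BoundedL1loc f) (i : ι)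
    (K : Set (Phase d)) (hKn : K ⊆ nonnegTime d) (hK : IsCompact K) : IntegrableOn (f i) K := by
  obtain ⟨hm, C, hC⟩ := hf K hK hKn
  exact ⟨hm i, (hC i).trans_lt ENNReal.coe_lt_top⟩

theorem setIntegral_abs_le_of_lintegral_le {f : Phase d → ℝ} {K : Set (Phase d)}
    (hf : IntegrableOn f K) {C : ℝ≥0} (hC : ∫⁻ z in K, ‖f z‖ₑ ≤ C) : ∫ z in K, |f z| ≤ C := by
  have h1 := ofReal_integral_norm_eq_lintegral_enorm hf
  rw [← h1] at hC
  have := (ENNReal.ofReal_le_iff_le_toReal ENNReal.coe_ne_top).1 hC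
  simpa using this

/-- Families of solutions that are equiintegrable in `v` are equiintegrable in `(t, x, v)`. -/
theorem equiintegrable_of_transport {F : ℝ → E d → E d} (hF : ContinuousInW1Infty F) {ι : Type*}
    {f g : ι → Phase d → ℝ} (hf : BoundedL1loc f) (hfv : LocEquiintegrableV f)
    (hg : BoundedL1loc g) (hfg : ∀ i, IsTransport F (f i) (g i)) {η : ℝ} (hη : 0 < η)
    {K : Set (Phase d)} (hK : IsCompact K) (hKn : K ⊆ nonnegTime d) :
    ∃ α : ℝ, 0 < α ∧ ∀ A : Set (Phase d), MeasurableSet A → volume A ≤ ENNReal.ofReal α →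
      ∀ i, ∫⁻ z in A ∩ K, ‖f i z‖ₑ ≤ ENNReal.ofReal η := by
  obtain ⟨r, hr, hKr⟩ := exists_subset_phaseBox hK hKn
  obtain ⟨G, σ, b, S, hS, hdual⟩ := exists_flow_duality hF hr
  have hbox := fun r => isCompact_phaseBox (d := d) r
  have hboxn := fun r => phaseBox_subset_nonnegTime (d := d) r
  obtain ⟨-, Cf, hCf⟩ := hf _ (hbox (r + 1)) (hboxn _)
  obtain ⟨-, Cg, hCg⟩ := hg _ (hbox (r + 2)) (hboxn _)
  obtain ⟨αv, hαv, hv⟩ := hfv.2 (η / 4) (by positivity) _ (hbox (r + 1)) (hboxn _)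
  -- Four errors of size `η / 4`: the source (through `s₁`), the points of low occupation (through
  -- `κ`), and two uses of equiintegrability in `v`. With `τ` and `β`, each of the two terms
  -- bounding the integrated occupation time is at most `s₁ * κ * αv / 4`, so Markov's inequality at
  -- level `s₁ * κ` bounds velocity slices by `αv / 2`.
  set s₁ : ℝ := min σ (η / 4 / (Cg + 1))
  have hs₁ : 0 < s₁ := lt_min hS.pos (by positivity)
  have hs₁σ : s₁ ≤ σ := min_le_left _ _
  have hs₁g : s₁ * Cg ≤ η / 4 := by
    have h1 : s₁ * (Cg + 1) ≤ η / 4 := (le_div_iff₀ (by positivity)).1 (min_le_right _ _)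
    nlinarith
  set κ : ℝ := η / 4 / (Cf + 1)
  have hκ : 0 < κ := by positivity
  have hκf : κ * Cf ≤ η / 4 := by
    have h1 : κ * (Cf + 1) = η / 4 := by simp only [κ]; field_simp
    nlinarith
  set V : ℝ := (volume (Metric.closedBall (0 : E d) (r + 3 - 1))).toReal
  have hV : volume (Metric.closedBall (0 : E d) (r + 3 - 1)) = ENNReal.ofReal V :=
    (ENNReal.ofReal_toReal measure_closedBall_lt_top.ne).symm
  have hV0 : 0 ≤ V := ENNReal.toReal_nonneg
  set τ : ℝ := s₁ * κ * αv / (4 * (V + 1))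
  have hτ : 0 < τ := by positivity
  have hτV : τ * V ≤ s₁ * κ * αv / 4 := by
    have h1 : τ * (V + 1) = s₁ * κ * αv / 4 := by simp only [τ]; field_simp
    nlinarith
  set D : ℝ := (2 / τ) ^ (d : ℝ)
  have hD0 : 0 < D := by positivity
  set β : ℝ := s₁ * κ * αv / (4 * D)
  have hβ : 0 < β := by positivity
  have hDβ : D * β = s₁ * κ * αv / 4 := by simp only [β]; field_simp
  refine ⟨β * (αv / 2), by positivity, fun A hA hAα i => ?_⟩
  -- `B` collects the points (t, x) over which the slice of `A` is not small; Markov's inequality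
  -- bounds its volume by `β`. Over the complement, equiintegrability in `v` applies at once.
  let B : Set (ℝ × E d) := {p | ENNReal.ofReal (αv / 2) ≤ volume {v | (p.1, p.2, v) ∈ A}}
  have hB : MeasurableSet B := measurableSet_le measurable_const (measurable_volume_slice hA)
  have hvolB : volume B ≤ ENNReal.ofReal β := by
    have h1 := mul_meas_ge_le_lintegral (μ := volume) (measurable_volume_slice hA)
      (ENNReal.ofReal (αv / 2))
    rw [← volume_phase hA] at h1
    have h2 := h1.trans hAα
    rw [mul_comm β, ENNReal.ofReal_mul (by positivity)] at h2
    exact (ENNReal.mul_le_mul_iff_right (by simpa using hαv) ENNReal.ofReal_ne_top).1 h2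
  let BX : Set (Phase d) := {z | (z.1, z.2.1) ∈ B}
  have hBX : MeasurableSet BX :=
    (measurable_fst.prodMk (measurable_fst.comp measurable_snd)) hB
  have hsub : A ∩ K ⊆ ((A \ BX) ∩ phaseBox d (r + 1)) ∪ (BX ∩ phaseBox d r) := by
    intro z hz
    have hzr := hKr hz.2
    by_cases hzB : z ∈ BX
    · exact Or.inr ⟨hzB, hzr⟩
    · exact Or.inl ⟨⟨hz.1, hzB⟩, Metric.closedBall_subset_closedBall (by linarith) hzr.1, hzr.2⟩
  have hlt : ENNReal.ofReal (αv / 2) < ENNReal.ofReal αv :=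
    (ENNReal.ofReal_lt_ofReal_iff hαv).2 (half_lt_self hαv)
  have part1 : ∫⁻ z in (A \ BX) ∩ phaseBox d (r + 1), ‖f i z‖ₑ ≤ ENNReal.ofReal (η / 4) := by
    refine hv _ (hA.diff hBX) (lt_of_le_of_lt (iSup₂_le fun t x => ?_) hlt) i
    by_cases htx : (t, x) ∈ B
    · have : {v | (t, x, v) ∈ A \ BX} = ∅ := by
        ext v
        simp only [mem_ofPred_eq, mem_empty_iff_false, iff_false]
        exact fun hh => hh.2 htx
      rw [this, measure_empty]
      exact zero_le
    · exact (measure_mono fun v hvA => hvA.1).trans (not_le.1 htx).le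
  have part2 : ∫⁻ z in BX ∩ phaseBox d r, ‖f i z‖ₑ ≤
      ENNReal.ofReal (η / 4) + ENNReal.ofReal (η / 4) + ENNReal.ofReal (η / 4) := by
    have hA2 : MeasurableSet (BX ∩ phaseBox d r) := hBX.inter (hbox r).measurableSet
    refine (hS.lintegral_enorm_le_occupation (r := r) (c := s₁ * Cg) (hf.integrableOn i _
      (hboxn _) (hbox _)) hs₁ hs₁σ (fun s hs φ hφ hφr hφ1 => ?_) hA2 inter_subset_right
      (ENNReal.ofReal κ)).trans (add_le_add (add_le_add ?_ ?_) (ENNReal.ofReal_le_ofReal hs₁g))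
    · refine (hdual (f i) (g i) (hf.integrableOn i) (hg.integrableOn i) (hfg i) s
        ⟨hs.1.le, hs.2.trans hs₁σ⟩ φ hφ hφr 1 hφ1).trans ?_
      rw [mul_one]
      exact mul_le_mul hs.2 (setIntegral_abs_le_of_lintegral_le
        (hg.integrableOn i _ (hboxn _) (hbox _)) (hCg i))
        (integral_nonneg fun _ => abs_nonneg _) hs₁.le
    · set N := {z | ENNReal.ofReal s₁ * ENNReal.ofReal κ ≤ occupation S s₁ (BX ∩ phaseBox d r) z}
      have hN : MeasurableSet N := measurableSet_le measurable_const
        (hS.measurable_occupation s₁ hA2)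
      -- Intersecting with the box confines the slices to velocities below `r + 1`, within the range
      -- `r + 2` of the dispersion estimate.
      have hNN : N ∩ phaseBox d (r + 1) = (N ∩ phaseBox d (r + 1)) ∩ phaseBox d (r + 1) := by
        rw [inter_assoc, inter_self]
      rw [hNN]
      refine hv _ (hN.inter (hbox (r + 1)).measurableSet)
        (lt_of_le_of_lt (iSup₂_le fun t x => ?_) hlt) i
      have hocc := hS.lintegral_occupation_le hτ hs₁σ hB hA2 (fun z hz => hz.1) t x
      have hm : Measurable fun v : E d => occupation S s₁ (BX ∩ phaseBox d r) (t, x, v) :=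
        (hS.measurable_occupation s₁ hA2).comp
          (measurable_const.prodMk (measurable_const.prodMk measurable_id))
      have hmark := mul_meas_ge_le_lintegral
        (μ := volume.restrict (Metric.closedBall (0 : E d) (r + 3 - 1))) hm
        (ENNReal.ofReal s₁ * ENNReal.ofReal κ)
      have hbd : ENNReal.ofReal τ * volume (Metric.closedBall (0 : E d) (r + 3 - 1)) +
          ENNReal.ofReal (2 / τ) ^ (d : ℝ) * volume B ≤
          ENNReal.ofReal s₁ * ENNReal.ofReal κ * ENNReal.ofReal (αv / 2) := by
        rw [hV, ENNReal.ofReal_rpow_of_pos (by positivity)]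
        refine (add_le_add_right (mul_le_mul_right hvolB _) _).trans ?_
        rw [← ENNReal.ofReal_mul hτ.le, ← ENNReal.ofReal_mul hD0.le,
          ← ENNReal.ofReal_add (by positivity) (by positivity), ← ENNReal.ofReal_mul hs₁.le,
          ← ENNReal.ofReal_mul (by positivity)]
        refine ENNReal.ofReal_le_ofReal ?_
        linarith
      have hfin := (hmark.trans hocc).trans hbd
      have hcancel := (ENNReal.mul_le_mul_iff_right (by simp [hs₁, hκ])
        (ENNReal.mul_ne_top ENNReal.ofReal_ne_top ENNReal.ofReal_ne_top)).1 hfin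
      rw [Measure.restrict_apply (measurableSet_le measurable_const hm)] at hcancel
      refine (measure_mono ?_).trans hcancel
      intro v hvN
      refine ⟨hvN.1, ?_⟩
      have h1 := hvN.2.1
      rw [mem_closedBall_zero_iff] at h1 ⊢
      exact (norm_snd_le (x, v)).trans ((norm_snd_le (t, x, v)).trans (by linarith))
    · refine (mul_le_mul_right (hCf i) _).trans ?_
      rw [← ENNReal.ofReal_coe_nnreal, ← ENNReal.ofReal_mul hκ.le]
      exact ENNReal.ofReal_le_ofReal hκf
  calc ∫⁻ z in A ∩ K, ‖f i z‖ₑ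
      ≤ ∫⁻ z in ((A \ BX) ∩ phaseBox d (r + 1)) ∪ (BX ∩ phaseBox d r), ‖f i z‖ₑ :=
        lintegral_mono_set hsub
    _ ≤ _ := lintegral_union_le _ _ _
    _ ≤ _ := add_le_add part1 part2
    _ = ENNReal.ofReal η := by
        rw [← ENNReal.ofReal_add (by positivity) (by positivity),
          ← ENNReal.ofReal_add (by positivity) (by positivity),
          ← ENNReal.ofReal_add (by positivity) (by positivity)]
        congr 1
        ring

/-- A compact set lies in a time slab `[0, r]`, where a uniform bound on the slices `A_t` integrates
to a bound on the volume of `A`. -/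
theorem locEquiintegrableXV_of_transport {F : ℝ → E d → E d} (hF : ContinuousInW1Infty F)
    {ι : Type*} {f g : ι → Phase d → ℝ} (hf : BoundedL1loc f) (hfv : LocEquiintegrableV f)
    (hg : BoundedL1loc g) (hfg : ∀ i, IsTransport F (f i) (g i)) : LocEquiintegrableXV f := by
  refine ⟨hf, fun η hη K hK hKn => ?_⟩
  obtain ⟨α, hα, hE⟩ := equiintegrable_of_transport hF hf hfv hg hfg hη hK hKn
  obtain ⟨r, hr, hKr⟩ := exists_subset_phaseBox hK hKn
  refine ⟨α / (r + 1), by positivity, fun A hA hAα i => ?_⟩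
  let T : Set (Phase d) := {z | z.1 ∈ Icc 0 r}
  have hT : MeasurableSet T := measurable_fst measurableSet_Icc
  have hKT : K ⊆ T := fun z hz => by
    refine ⟨hKn hz, ?_⟩
    have h1 := (hKr hz).1
    rw [mem_closedBall_zero_iff] at h1
    exact (le_abs_self z.1).trans ((norm_fst_le z).trans h1)
  have heq : A ∩ K = (A ∩ T) ∩ K := by
    rw [inter_assoc, inter_eq_right.2 hKT]
  rw [heq]
  refine hE _ (hA.inter hT) ?_ i
  rw [Measure.volume_eq_prod, Measure.prod_apply (hA.inter hT)]
  calc ∫⁻ t, volume (Prod.mk t ⁻¹' (A ∩ T))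
      ≤ ∫⁻ t, (Icc 0 r).indicator (fun _ => ENNReal.ofReal (α / (r + 1))) t := by
        refine lintegral_mono fun t => ?_
        by_cases ht : t ∈ Icc 0 r
        · rw [indicator_of_mem ht]
          exact (measure_mono fun p hp => hp.1).trans
            ((le_iSup (fun t => volume {p : E d × E d | (t, p) ∈ A}) t).trans hAα.le)
        · have : Prod.mk t ⁻¹' (A ∩ T) = ∅ := by
            ext p
            simp only [mem_preimage, mem_empty_iff_false, iff_false]
            exact fun hh => ht hh.2
          rw [this, measure_empty]
          exact zero_le
    _ = ENNReal.ofReal (α / (r + 1)) * ENNReal.ofReal r := by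
        rw [lintegral_indicator measurableSet_Icc, setLIntegral_const, Real.volume_Icc, sub_zero]
    _ ≤ ENNReal.ofReal α := by
        rw [← ENNReal.ofReal_mul (by positivity)]
        refine ENNReal.ofReal_le_ofReal ?_
        rw [div_mul_eq_mul_div, div_le_iff₀ (by positivity)]
        nlinarith

end Equiintegrability

/-! ### Continuity of translations, tested on bounded observables. -/

section Translation

variable {X : Type*} [NormedAddCommGroup X] [NormedSpace ℝ X] [FiniteDimensional ℝ X]
  [MeasurableSpace X] [BorelSpace X] {μ : Measure X} [μ.IsAddHaarMeasure]

/-- Translations are continuous in `L¹`. -/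
theorem tendsto_integral_norm_translate_sub {k : X → ℝ} (hk : Integrable k μ) {h : ℕ → X}
    (hh : Tendsto h atTop (𝓝 0)) :
    Tendsto (fun n => ∫ y, ‖k (y + h n) - k y‖ ∂μ) atTop (𝓝 0) := by
  have hkm : MemLp k 1 μ := memLp_one_iff_integrable.2 hk
  let τ : X → C(X, X) := fun a => ⟨fun y => y + a, by fun_prop⟩
  have hτ : Continuous τ := ContinuousMap.continuous_of_continuous_uncurry _ (by
    change Continuous fun p : X × X => p.2 + p.1
    fun_prop)
  have hmp : ∀ a, MeasurePreserving (τ a) μ μ := fun a => measurePreserving_add_right μ a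
  have h1 := Filter.Tendsto.compMeasurePreservingLp (p := 1) (E := ℝ)
    (tendsto_const_nhds (x := hkm.toLp k) (f := atTop)) ((hτ.tendsto 0).comp hh)
    (fun n => hmp (h n)) (hmp 0) (by simp)
  rw [tendsto_iff_norm_sub_tendsto_zero] at h1
  refine h1.congr fun n => ?_
  rw [Lp.toLp_compMeasurePreserving, Lp.toLp_compMeasurePreserving, ← MemLp.toLp_sub,
    Lp.norm_toLp, eLpNorm_one_eq_lintegral_enorm, integral_norm_eq_lintegral_enorm]
  · simp [τ]
  · exact ((hk.comp_add_right (h n)).sub hk).aestronglyMeasurable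

/-- Averages against an absolutely continuous finite measure do not see small translations,
uniformly over bounded observables. -/
theorem tendsto_integral_translate_sub {ν : Measure X} [IsFiniteMeasure ν] (hν : ν ≪ μ)
    {h : ℕ → X} (hh : Tendsto h atTop (𝓝 0)) {ψ : ℕ → X → ℝ} (hψ : ∀ n, Measurable (ψ n))
    (hψ1 : ∀ n y, |ψ n y| ≤ 1) :
    Tendsto (fun n => ∫ y, (ψ n (y - h n) - ψ n y) ∂ν) atTop (𝓝 0) := by
  set k : X → ℝ := fun y => (ν.rnDeriv μ y).toReal
  have hk : Integrable k μ := Measure.integrable_toReal_rnDeriv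
  refine squeeze_zero_norm (fun n => ?_) (tendsto_integral_norm_translate_sub hk hh)
  have i1 : Integrable (fun y => k (y + h n) * ψ n y) μ :=
    (hk.comp_add_right (h n)).mul_bdd (c := 1) (hψ n).aestronglyMeasurable
      (Eventually.of_forall (hψ1 n))
  have i2 : Integrable (fun y => k y * ψ n y) μ :=
    hk.mul_bdd (c := 1) (hψ n).aestronglyMeasurable (Eventually.of_forall (hψ1 n))
  have i3 : Integrable (fun y => k y * ψ n (y - h n)) μ :=
    hk.mul_bdd (c := 1) ((hψ n).comp (measurable_id.sub_const _)).aestronglyMeasurable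
      (Eventually.of_forall fun y => hψ1 n _)
  -- A change of variables moves the translation from `ψ n`, which has no regularity, to the density
  -- of `ν`.
  have e : ∫ y, (ψ n (y - h n) - ψ n y) ∂ν = ∫ y, (k (y + h n) - k y) * ψ n y ∂μ := by
    rw [← integral_rnDeriv_smul hν]
    simp_rw [smul_eq_mul, mul_sub, sub_mul]
    rw [integral_sub i3 i2, integral_sub i1 i2]
    congr 1
    rw [← integral_add_right_eq_self _ (h n)]
    simp [k]
  rw [e]
  refine norm_integral_le_of_norm_le ((hk.comp_add_right (h n)).sub hk).norm
    (Eventually.of_forall fun y => ?_)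
  rw [norm_mul]
  exact mul_le_of_le_one_right (norm_nonneg _) (hψ1 n y)

/-- The positive and negative parts of `θ` are densities of finite measures whose images under `Y`
are absolutely continuous, by `hYD`. Only null sets matter here, so `Y` need not be invertible or
differentiable. -/
theorem tendsto_integral_comp_translate_sub {V : Type*} [MeasurableSpace V] {m : Measure V}
    {Y : V → X} (hY : Measurable Y) {D : Set V}
    (hYD : ∀ N : Set X, MeasurableSet N → μ N = 0 → m (D ∩ Y ⁻¹' N) = 0)
    {θ : V → ℝ} (hθm : Measurable θ) (hθ : Integrable θ m) (hθD : Function.support θ ⊆ D)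
    {h : ℕ → X} (hh : Tendsto h atTop (𝓝 0)) {ψ : ℕ → X → ℝ} (hψ : ∀ n, Measurable (ψ n))
    (hψ1 : ∀ n y, |ψ n y| ≤ 1) :
    Tendsto (fun n => ∫ v, θ v * (ψ n (Y v - h n) - ψ n (Y v)) ∂m) atTop (𝓝 0) := by
  have hW : ∀ n, Measurable fun y => ψ n (y - h n) - ψ n y := fun n =>
    ((hψ n).comp (measurable_id.sub_const _)).sub (hψ n)
  have hpos : ∀ ϑ : V → ℝ, Measurable ϑ → Integrable ϑ m → Function.support ϑ ⊆ D → (∀ v, 0 ≤ ϑ v) →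
      Tendsto (fun n => ∫ v, ϑ v * (ψ n (Y v - h n) - ψ n (Y v)) ∂m) atTop (𝓝 0) := by
    intro ϑ hϑm hϑ hϑD hϑ0
    set m' := m.withDensity fun v => ENNReal.ofReal (ϑ v)
    have : IsFiniteMeasure m' := isFiniteMeasure_withDensity_ofReal hϑ.2
    have hac : m'.map Y ≪ μ := by
      refine Measure.AbsolutelyContinuous.mk fun N hN hN0 => ?_
      rw [Measure.map_apply hY hN, withDensity_apply _ (hY hN)]
      have h0 := hYD N hN hN0
      rw [lintegral_eq_zero_iff hϑm.ennreal_ofReal, EventuallyEq, ae_restrict_iff' (hY hN)]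
      have h1 : ∀ᵐ v ∂m, v ∉ D ∩ Y ⁻¹' N := measure_eq_zero_iff_ae_notMem.1 h0
      filter_upwards [h1] with v hv hvN
      by_contra hne
      refine hv ⟨hϑD fun h0 => hne ?_, hvN⟩
      simp [h0]
    refine (tendsto_integral_translate_sub (μ := μ) hac hh hψ hψ1).congr fun n => ?_
    rw [integral_map hY.aemeasurable (hW n).aestronglyMeasurable,
      integral_withDensity_eq_integral_toReal_smul hϑm.ennreal_ofReal
        (Eventually.of_forall fun v => ENNReal.ofReal_lt_top)]
    refine integral_congr_ae (Eventually.of_forall fun v => ?_)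
    simp [ENNReal.toReal_ofReal (hϑ0 v)]
  have hp := hpos (fun v => max (θ v) 0) (hθm.max measurable_const) hθ.pos_part
    (fun v hv => hθD fun h0 => hv (by simp [h0])) fun v => le_max_right _ _
  have hn := hpos (fun v => max (-θ v) 0) (hθm.neg.max measurable_const) hθ.neg_part
    (fun v hv => hθD fun h0 => hv (by simp [h0])) fun v => le_max_right _ _
  have hsub := hp.sub hn
  rw [sub_zero] at hsub
  refine hsub.congr fun n => ?_
  have hb : ∀ v, ‖ψ n (Y v - h n) - ψ n (Y v)‖ ≤ 2 := fun v =>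
    (norm_sub_le _ _).trans ((add_le_add (hψ1 n _) (hψ1 n _)).trans (by norm_num))
  have hWY : AEStronglyMeasurable (fun v => ψ n (Y v - h n) - ψ n (Y v)) m :=
    ((hW n).comp hY).aestronglyMeasurable
  rw [← integral_sub (hθ.pos_part.mul_bdd hWY (Eventually.of_forall hb))
    (hθ.neg_part.mul_bdd hWY (Eventually.of_forall hb))]
  refine integral_congr_ae (Eventually.of_forall fun v => ?_)
  beta_reduce
  rw [← sub_mul]
  congr 1
  rcases le_total 0 (θ v) with h0 | h0
  · rw [max_eq_left h0, max_eq_right (by linarith), sub_zero]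
  · rw [max_eq_right h0, max_eq_left (by linarith), zero_sub, neg_neg]

end Translation

/-! ### Decay of correlations along the flow. -/

section Averaging

variable {d : ℕ}

theorem integral_phase {H : Phase d → ℝ} (hH : Integrable H) :
    ∫ z, H z = ∫ p : ℝ × E d, ∫ v, H (p.1, p.2, v) := by
  rw [← measurePreserving_phaseAssoc.integral_comp' H]
  exact integral_prod (fun q : (ℝ × E d) × E d => H (MeasurableEquiv.prodAssoc q))
    ((measurePreserving_phaseAssoc.integrable_comp_emb
      MeasurableEquiv.prodAssoc.measurableEmbedding).2 hH)

/-- The observable `1_K(t,x) Ψ(v) (ψ(t,x-h) - ψ(t,x))`. -/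
noncomputable def translationObservable (K : Set (ℝ × E d)) (Ψ : E d → ℝ) (ψ : ℝ × E d → ℝ)
    (h : E d) (z : Phase d) : ℝ :=
  K.indicator (fun p => ψ (p.1, p.2 - h) - ψ p) (z.1, z.2.1) * Ψ z.2.2

section Observable

variable {K : Set (ℝ × E d)} {Ψ : E d → ℝ} {ψ : ℝ × E d → ℝ}

theorem measurable_translation (hψ : Measurable ψ) (h : E d) :
    Measurable fun p : ℝ × E d => ψ (p.1, p.2 - h) - ψ p :=
  (hψ.comp (measurable_fst.prodMk (measurable_snd.sub_const h))).sub hψ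

theorem measurable_translationObservable (hK : MeasurableSet K) (hΨ : Measurable Ψ)
    (hψ : Measurable ψ) (h : E d) : Measurable (translationObservable K Ψ ψ h) :=
  (((measurable_translation hψ h).indicator hK).comp
    (measurable_fst.prodMk measurable_snd.fst)).mul (hΨ.comp measurable_snd.snd)

theorem abs_indicator_translation_le (hψ1 : ∀ p, |ψ p| ≤ 1) (h : E d) (p : ℝ × E d) :
    |K.indicator (fun p => ψ (p.1, p.2 - h) - ψ p) p| ≤ 2 := by
  by_cases hp : p ∈ K
  · rw [indicator_of_mem hp]
    exact (abs_sub _ _).trans ((add_le_add (hψ1 _) (hψ1 _)).trans (by norm_num))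
  · rw [indicator_of_notMem hp, abs_zero]
    norm_num

theorem abs_translationObservable_le (hψ1 : ∀ p, |ψ p| ≤ 1) {C : ℝ} (hC : ∀ v, |Ψ v| ≤ C)
    (h : E d) (z : Phase d) : |translationObservable K Ψ ψ h z| ≤ 2 * C := by
  rw [translationObservable, abs_mul]
  exact mul_le_mul (abs_indicator_translation_le hψ1 h _) (hC _) (abs_nonneg _) (by norm_num)

theorem support_translationObservable_subset (h : E d) :
    Function.support (translationObservable K Ψ ψ h) ⊆
      {z | (z.1, z.2.1) ∈ K ∧ z.2.2 ∈ Function.support Ψ} := by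
  intro z hz
  rw [Function.mem_support, translationObservable] at hz
  exact ⟨by_contra fun hn => left_ne_zero_of_mul hz (indicator_of_notMem hn _),
    right_ne_zero_of_mul hz⟩

end Observable

namespace IsKineticFlow

variable {G : ℝ → E d → E d} {R σ : ℝ} {b : Phase d → Phase d} {S : ℝ → Phase d → Phase d}

/-- Correlations along the flow of oscillating observables vanish, by dispersion. -/
theorem tendsto_correlation (hS : IsKineticFlow G R σ b S) {r : ℝ} (hr : r ≤ R - 1)
    {K : Set (ℝ × E d)} (hKm : MeasurableSet K) {Ψ : E d → ℝ} (hΨ : Measurable Ψ) {C : ℝ}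
    (hC : ∀ v, |Ψ v| ≤ C) (hKΨ : {z : Phase d | (z.1, z.2.1) ∈ K ∧ z.2.2 ∈ Function.support Ψ} ⊆
      phaseBox d r) (hΨr : Function.support Ψ ⊆ Metric.closedBall 0 r) (hKfin : volume K ≠ ⊤)
    {h : ℕ → E d} (hh : Tendsto h atTop (𝓝 0)) {ψ : ℕ → ℝ × E d → ℝ} (hψ : ∀ n, Measurable (ψ n))
    (hψ1 : ∀ n p, |ψ n p| ≤ 1) {s : ℝ} (hs : s ≠ 0) (hsσ : |s| ≤ σ) :
    Tendsto (fun n => ∫ z, translationObservable K Ψ (ψ n) (h n) z *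
      translationObservable K Ψ (ψ n) (h n) (S s z)) atTop (𝓝 0) := by
  set φ : ℕ → Phase d → ℝ := fun n => translationObservable K Ψ (ψ n) (h n)
  have hC0 : 0 ≤ C := (abs_nonneg _).trans (hC 0)
  have hφm : ∀ n, Measurable (φ n) := fun n => measurable_translationObservable hKm hΨ (hψ n) _
  have hφC : ∀ n z, |φ n z| ≤ 2 * C := fun n z => abs_translationObservable_le (hψ1 n) hC _ z
  have hφs : ∀ n, Function.support (φ n) ⊆ phaseBox d r := fun n =>
    (support_translationObservable_subset _).trans hKΨ
  have hSm : Measurable (S s) := (hS.continuous s).measurable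
  have hHm : ∀ n, Measurable fun z => φ n z * φ n (S s z) := fun n =>
    (hφm n).mul ((hφm n).comp hSm)
  have hHint : ∀ n, Integrable fun z => φ n z * φ n (S s z) := fun n => by
    have h1 : IntegrableOn (fun z => φ n z * φ n (S s z)) (phaseBox d r) := by
      refine IntegrableOn.of_bound (isCompact_phaseBox r).measure_lt_top
        (hHm n).aestronglyMeasurable (2 * C * (2 * C)) (Eventually.of_forall fun z => ?_)
      rw [norm_mul]
      exact mul_le_mul (hφC n z) (hφC n _) (norm_nonneg _) (by positivity)
    refine (integrableOn_iff_integrable_of_support_subset fun z hz => hφs n ?_).1 h1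
    exact left_ne_zero_of_mul hz
  have hball : volume (Metric.closedBall (0 : E d) r) ≠ ⊤ := measure_closedBall_lt_top.ne
  set V : ℝ := (volume (Metric.closedBall (0 : E d) r)).toReal
  refine Tendsto.congr (fun n => (integral_phase (hHint n)).symm) ?_
  rw [← integral_zero (ℝ × E d) ℝ (μ := volume)]
  refine tendsto_integral_of_dominated_convergence
    (K.indicator fun _ => 2 * C * (2 * C) * V) (fun n => ?_) ?_ (fun n => ?_) ?_
  · have hm : Measurable fun q : (ℝ × E d) × E d => φ n (q.1.1, q.1.2, q.2) *
        φ n (S s (q.1.1, q.1.2, q.2)) :=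
      (hHm n).comp MeasurableEquiv.prodAssoc.measurable
    exact (hm.stronglyMeasurable.integral_prod_right').aestronglyMeasurable
  · exact (integrable_indicator_iff hKm).2 (integrableOn_const hKfin)
  · refine Eventually.of_forall fun p => ?_
    by_cases hp : p ∈ K
    · rw [indicator_of_mem hp]
      rw [← setIntegral_eq_integral_of_forall_compl_eq_zero (s := Metric.closedBall 0 r)]
      · refine norm_setIntegral_le_of_norm_le_const hball.lt_top fun v _ => ?_
        rw [norm_mul]
        exact mul_le_mul (hφC n _) (hφC n _) (norm_nonneg _) (by positivity)
      · intro v hv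
        have : Ψ v = 0 := by
          by_contra hne
          exact hv (hΨr hne)
        simp [φ, translationObservable, this]
    · rw [indicator_of_notMem hp]
      have : ∀ v, φ n (p.1, p.2, v) = 0 := fun v => by
        simp [φ, translationObservable, indicator_of_notMem hp]
      simp [this]
  · refine Eventually.of_forall fun p => ?_
    let Y : E d → E d := fun v => (S s (p.1, p.2, v)).2.1
    have hcur : Continuous fun v : E d => S s (p.1, p.2, v) :=
      (hS.continuous s).comp (by fun_prop)
    have hY : Measurable Y := (hcur.snd.fst).measurable
    -- At fixed (t, x), the translation difference in the first factor does not involve `v` and is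
    -- bounded by 2. In the second it is evaluated at the position `Y v`. All remaining factors,
    -- gathered in `θ`, are independent of `n`.
    let θ : E d → ℝ := fun v =>
      Ψ v * (K.indicator 1 (p.1 + s, Y v) * Ψ (S s (p.1, p.2, v)).2.2)
    have hθm : Measurable θ :=
      hΨ.mul (((measurable_one.indicator hKm).comp (measurable_const.prodMk hY)).mul
        (hΨ.comp hcur.snd.snd.measurable))
    have hθs : Function.support θ ⊆ Metric.closedBall 0 r := fun v hv =>
      hΨr (left_ne_zero_of_mul hv)
    have hθ : Integrable θ := by
      have h1 : IntegrableOn θ (Metric.closedBall 0 r) := by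
        refine IntegrableOn.of_bound hball.lt_top hθm.aestronglyMeasurable (C * (1 * C))
          (Eventually.of_forall fun v => ?_)
        rw [norm_mul, norm_mul]
        refine mul_le_mul (hC _) (mul_le_mul ?_ (hC _) (norm_nonneg _) zero_le_one)
          (by positivity) hC0
        by_cases hv : (p.1 + s, Y v) ∈ K <;> simp [hv]
      exact (integrableOn_iff_integrable_of_support_subset hθs).1 h1
    have hnull : ∀ N : Set (E d), MeasurableSet N → volume N = 0 →
        volume (Metric.closedBall 0 (R - 1) ∩ Y ⁻¹' N) = 0 := by
      intro N _ hN
      have := hS.volume_position_preimage_le hs hsσ p.1 p.2 N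
      rw [hN, mul_zero] at this
      exact le_antisymm this zero_le
    have key := tendsto_integral_comp_translate_sub (μ := volume) (m := volume) hY hnull hθm hθ
      (hθs.trans (Metric.closedBall_subset_closedBall hr)) hh
      (ψ := fun n y => ψ n (p.1 + s, y)) (fun n => (hψ n).comp measurable_prodMk_left)
      (fun n y => hψ1 n _)
    have hw := bdd_le_mul_tendsto_zero' 2 (Eventually.of_forall fun n =>
      abs_indicator_translation_le (K := K) (hψ1 n) (h n) p) key
    refine hw.congr fun n => ?_
    rw [← integral_const_mul]
    refine integral_congr_ae (Eventually.of_forall fun v => ?_)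
    simp only [φ, translationObservable, hS.time, θ, Y]
    by_cases hv : (p.1 + s, (S s (p.1, p.2, v)).2.1) ∈ K
    · simp only [indicator_of_mem hv, Pi.one_apply]
      ring
    · simp only [indicator_of_notMem hv]
      ring

theorem measurable_uncurry_comp_neg (hS : IsKineticFlow G R σ b S) {φ : Phase d → ℝ}
    (hφ : Measurable φ) : Measurable fun p : ℝ × Phase d => φ (S (-p.1) p.2) :=
  hφ.comp hS.measurable_uncurry_neg

theorem eq_zero_of_notMem_phaseBox (hS : IsKineticFlow G R σ b S) {φ : Phase d → ℝ} {r : ℝ}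
    (hφ : Function.support φ ⊆ phaseBox d r) {s : ℝ} (hs : s ∈ Icc 0 σ) {z : Phase d}
    (hz : z ∉ phaseBox d (r + 1)) : φ (S (-s) z) = 0 := by
  by_contra hne
  have := hS.mem_phaseBox (hφ hne) hs
  rw [hS.map_map_neg] at this
  exact hz this

/-- The square norm of an average along the flow, in terms of correlations. -/
theorem setIntegral_average_sq (hS : IsKineticFlow G R σ b S) {r s₁ C : ℝ} (hs₁ : s₁ ≤ σ)
    {φ : Phase d → ℝ} (hφ : Measurable φ) (hφr : Function.support φ ⊆ phaseBox d r)
    (hC : ∀ z, |φ z| ≤ C) :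
    ∫ z in phaseBox d (r + 1), (∫ s in Ioc 0 s₁, φ (S (-s) z)) ^ 2 =
      ∫ q, (∫ z, φ z * φ (S (q.1 - q.2) z))
        ∂((volume.restrict (Ioc 0 s₁)).prod (volume.restrict (Ioc 0 s₁))) := by
  have hC0 : 0 ≤ C := (abs_nonneg _).trans (hC 0)
  set I := (volume : Measure ℝ).restrict (Ioc 0 s₁)
  set box := (volume : Measure (Phase d)).restrict (phaseBox d (r + 1))
  have hfin : IsFiniteMeasure box := ⟨by
    rw [Measure.restrict_apply_univ]; exact (isCompact_phaseBox _).measure_lt_top⟩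
  have hm := hS.measurable_uncurry_comp_neg hφ
  have e1 : ∀ z, (∫ s, φ (S (-s) z) ∂I) ^ 2 =
      ∫ q : ℝ × ℝ, φ (S (-q.1) z) * φ (S (-q.2) z) ∂(I.prod I) := fun z => by
    rw [sq, ← integral_prod_mul]
  simp_rw [e1]
  rw [integral_integral_swap]
  · refine integral_congr_ae ?_
    have hIm : ∀ᵐ q ∂(I.prod I), q.1 ∈ Ioc 0 s₁ := by
      rw [Measure.prod_restrict]
      filter_upwards [ae_restrict_mem (measurableSet_Ioc.prod measurableSet_Ioc)] with q hq
      exact hq.1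
    filter_upwards [hIm] with q hq
    have h1 : ∫ z, φ (S (-q.1) z) * φ (S (-q.2) z) ∂box =
        ∫ z, φ (S (-q.1) z) * φ (S (-q.2) z) :=
      setIntegral_eq_integral_of_forall_compl_eq_zero fun z hz => by
        rw [hS.eq_zero_of_notMem_phaseBox hφr ⟨hq.1.le, hq.2.trans hs₁⟩ hz, zero_mul]
    -- The measure-preserving substitution `S q.1` leaves only the time lag `q.1 - q.2`.
    rw [h1, ← (hS.measurePreserving q.1).integral_comp
      (hS.homeomorph q.1).measurableEmbedding]
    refine integral_congr_ae (Eventually.of_forall fun z => ?_)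
    beta_reduce
    rw [hS.map_neg_map, ← hS.map_add, neg_add_eq_sub]
  · have hmm : Measurable fun p : Phase d × (ℝ × ℝ) =>
        φ (S (-p.2.1) p.1) * φ (S (-p.2.2) p.1) :=
      (hm.comp (measurable_snd.fst.prodMk measurable_fst)).mul
        (hm.comp (measurable_snd.snd.prodMk measurable_fst))
    refine Integrable.of_bound hmm.aestronglyMeasurable (C * C) (Eventually.of_forall fun p => ?_)
    simp only [Function.uncurry]
    rw [norm_mul]
    exact mul_le_mul (hC _) (hC _) (norm_nonneg _) hC0

/-- Averages along the flow of oscillating observables vanish in `L²`. -/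
theorem tendsto_setIntegral_average_sq (hS : IsKineticFlow G R σ b S) {r : ℝ} (hr : r ≤ R - 1)
    {K : Set (ℝ × E d)} (hKm : MeasurableSet K) {Ψ : E d → ℝ} (hΨ : Measurable Ψ) {C : ℝ}
    (hC : ∀ v, |Ψ v| ≤ C) (hKΨ : {z : Phase d | (z.1, z.2.1) ∈ K ∧ z.2.2 ∈ Function.support Ψ} ⊆
      phaseBox d r) (hΨr : Function.support Ψ ⊆ Metric.closedBall 0 r) (hKfin : volume K ≠ ⊤)
    {h : ℕ → E d} (hh : Tendsto h atTop (𝓝 0)) {ψ : ℕ → ℝ × E d → ℝ} (hψ : ∀ n, Measurable (ψ n))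
    (hψ1 : ∀ n p, |ψ n p| ≤ 1) {s₁ : ℝ} (hs₁ : s₁ ≤ σ) :
    Tendsto (fun n => ∫ z in phaseBox d (r + 1),
      (∫ s in Ioc 0 s₁, translationObservable K Ψ (ψ n) (h n) (S (-s) z)) ^ 2) atTop (𝓝 0) := by
  set φ : ℕ → Phase d → ℝ := fun n => translationObservable K Ψ (ψ n) (h n)
  have hC0 : 0 ≤ C := (abs_nonneg _).trans (hC 0)
  have hφm : ∀ n, Measurable (φ n) := fun n => measurable_translationObservable hKm hΨ (hψ n) _
  have hφC : ∀ n z, |φ n z| ≤ 2 * C := fun n z => abs_translationObservable_le (hψ1 n) hC _ z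
  have hφs : ∀ n, Function.support (φ n) ⊆ phaseBox d r := fun n =>
    (support_translationObservable_subset _).trans hKΨ
  refine Tendsto.congr (fun n =>
    (hS.setIntegral_average_sq hs₁ (hφm n) (hφs n) (hφC n)).symm) ?_
  set I := (volume : Measure ℝ).restrict (Ioc 0 s₁)
  rw [← integral_zero (ℝ × ℝ) ℝ (μ := I.prod I)]
  set V : ℝ := volume.real (phaseBox d r)
  refine tendsto_integral_of_dominated_convergence (fun _ => 2 * C * (2 * C) * V) (fun n => ?_)
    (integrable_const _) (fun n => Eventually.of_forall fun q => ?_) ?_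
  · have hm : Measurable fun p : (ℝ × ℝ) × Phase d => φ n p.2 * φ n (S (p.1.1 - p.1.2) p.2) :=
      ((hφm n).comp measurable_snd).mul ((hφm n).comp (hS.continuous_uncurry.comp
        ((continuous_fst.fst.sub continuous_fst.snd).prodMk continuous_snd)).measurable)
    exact (hm.stronglyMeasurable.integral_prod_right').aestronglyMeasurable
  · rw [← setIntegral_eq_integral_of_forall_compl_eq_zero (s := phaseBox d r)]
    · refine norm_setIntegral_le_of_norm_le_const (isCompact_phaseBox r).measure_lt_top
        fun z _ => ?_
      rw [norm_mul]
      exact mul_le_mul (hφC n _) (hφC n _) (norm_nonneg _) (by positivity)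
    · intro z hz
      have : φ n z = 0 := by
        by_contra hne
        exact hz (hφs n hne)
      rw [this, zero_mul]
  -- Without time lag there is no dispersion, but the diagonal is null.
  · have hne : ∀ᵐ q ∂(I.prod I), q.1 ≠ q.2 := by
      refine (Measure.ae_prod_iff_ae_ae (p := fun q : ℝ × ℝ => q.1 ≠ q.2)
        (measurableSet_eq_fun measurable_fst measurable_snd).compl).2
        (Eventually.of_forall fun s => ?_)
      filter_upwards [ae_restrict_of_ae (Measure.ae_ne volume s)] with u hu using hu.symm
    have hIm : ∀ᵐ q ∂(I.prod I), q ∈ Ioc 0 s₁ ×ˢ Ioc 0 s₁ := by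
      rw [Measure.prod_restrict]
      exact ae_restrict_mem (measurableSet_Ioc.prod measurableSet_Ioc)
    filter_upwards [hne, hIm] with q hq hqI
    refine hS.tendsto_correlation hr hKm hΨ hC hKΨ hΨr hKfin hh hψ hψ1 (sub_ne_zero.2 hq) ?_
    rw [abs_le]
    constructor <;> linarith [hqI.1.1, hqI.1.2, hqI.2.1, hqI.2.2]

end IsKineticFlow

end Averaging

/-! ### Uniform smallness of weak translations. -/

section Compactness

variable {d : ℕ}

namespace IsKineticFlow

variable {G : ℝ → E d → E d} {R σ : ℝ} {b : Phase d → Phase d} {S : ℝ → Phase d → Phase d}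

theorem stronglyMeasurable_average (hS : IsKineticFlow G R σ b S) {φ : Phase d → ℝ}
    (hφ : Measurable φ) (s₁ : ℝ) : StronglyMeasurable fun z => ∫ s in Ioc 0 s₁, φ (S (-s) z) :=
  ((hS.measurable_uncurry_comp_neg hφ).comp measurable_swap).stronglyMeasurable.integral_prod_right'

theorem abs_average_le {φ : Phase d → ℝ} {C : ℝ} (hC : ∀ z, |φ z| ≤ C) {s₁ : ℝ} (hs₁ : 0 ≤ s₁)
    (z : Phase d) : |∫ s in Ioc 0 s₁, φ (S (-s) z)| ≤ C * s₁ := by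
  have := norm_setIntegral_le_of_norm_le_const (μ := volume) (s := Ioc 0 s₁) (by simp)
    (fun s _ => (Real.norm_eq_abs _).trans_le (hC (S (-s) z)))
  simpa [measureReal_def, hs₁] using this

/-- Approximate duality along the flow reduces an observable to its average along the flow. -/
theorem mul_abs_integral_le (hS : IsKineticFlow G R σ b S) {r : ℝ} {f : Phase d → ℝ}
    (hf : IntegrableOn f (phaseBox d (r + 1))) {s₁ c C : ℝ} (hs₁ : 0 < s₁) (hs₁σ : s₁ ≤ σ)
    {φ : Phase d → ℝ} (hφ : Measurable φ) (hφr : Function.support φ ⊆ phaseBox d r)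
    (hC : ∀ z, |φ z| ≤ C)
    (hdual : ∀ s ∈ Ioc 0 s₁, |∫ z, f z * (φ z - φ (S (-s) z))| ≤ c) {κ : ℝ} (hκ : 0 ≤ κ) :
    s₁ * |∫ z, f z * φ z| ≤ s₁ * c + (κ * ∫ z in phaseBox d (r + 1), |f z|) +
      C * s₁ * ∫ z in {z | κ ≤ |∫ s in Ioc 0 s₁, φ (S (-s) z)|} ∩ phaseBox d (r + 1), |f z| := by
  have hC0 : 0 ≤ C := (abs_nonneg _).trans (hC 0)
  set I := (volume : Measure ℝ).restrict (Ioc 0 s₁) with hI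
  set B := phaseBox d (r + 1)
  set Q : Phase d → ℝ := fun z => ∫ s, φ (S (-s) z) ∂I
  have hQm : StronglyMeasurable Q := hS.stronglyMeasurable_average hφ s₁
  have hQC : ∀ z, |Q z| ≤ C * s₁ := abs_average_le hC hs₁.le
  have hmS : ∀ s, Measurable fun z => φ (S (-s) z) := fun s =>
    hφ.comp (hS.continuous (-s)).measurable
  have hi1 : IntegrableOn (fun z => f z * φ z) B :=
    Integrable.mul_bdd (c := C) hf hφ.aestronglyMeasurable (Eventually.of_forall hC)
  have hi2 : ∀ s, IntegrableOn (fun z => f z * φ (S (-s) z)) B := fun s =>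
    Integrable.mul_bdd (c := C) hf (hmS s).aestronglyMeasurable (Eventually.of_forall fun z => hC _)
  have hφ0 : ∀ z, z ∉ B → φ z = 0 := fun z hz => by
    have := hS.eq_zero_of_notMem_phaseBox hφr (s := 0) ⟨le_rfl, hS.pos.le⟩ hz
    rwa [neg_zero, hS.map_zero] at this
  have e0 : ∫ z, f z * φ z = ∫ z in B, f z * φ z :=
    (setIntegral_eq_integral_of_forall_compl_eq_zero fun z hz => by
      rw [hφ0 z hz, mul_zero]).symm
  have hdual' : ∀ s ∈ Ioc 0 s₁,
      ‖(∫ z in B, f z * φ z) - ∫ z in B, f z * φ (S (-s) z)‖ ≤ c := fun s hs => by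
    rw [← integral_sub hi1 (hi2 s)]
    have : ∫ z in B, (f z * φ z - f z * φ (S (-s) z)) =
        ∫ z, (f z * φ z - f z * φ (S (-s) z)) :=
      setIntegral_eq_integral_of_forall_compl_eq_zero fun z hz => by
        rw [hφ0 z hz, hS.eq_zero_of_notMem_phaseBox hφr ⟨hs.1.le, hs.2.trans hs₁σ⟩ hz, sub_self]
    rw [this]
    simpa only [mul_sub, Real.norm_eq_abs] using hdual s hs
  have hprod : Integrable (Function.uncurry fun s z => f z * φ (S (-s) z))
      (I.prod (volume.restrict B)) := by
    have h1 : Integrable (fun p : ℝ × Phase d => f p.2) (I.prod (volume.restrict B)) :=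
      Integrable.comp_snd hf I
    exact h1.mul_bdd (c := C) (hS.measurable_uncurry_comp_neg hφ).aestronglyMeasurable
      (Eventually.of_forall fun p => hC _)
  have hswap : ∫ s, (∫ z in B, f z * φ (S (-s) z)) ∂I = ∫ z in B, f z * Q z := by
    rw [integral_integral_swap hprod]
    simp only [integral_const_mul, Q]
  have hvol : I.real univ = s₁ := by simp [hI, measureReal_def, hs₁.le]
  -- Integrating the duality estimate over `s` and exchanging integrals replaces `φ` by `Q`.
  have h1 : |s₁ * (∫ z, f z * φ z) - ∫ z in B, f z * Q z| ≤ s₁ * c := by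
    have hb := norm_setIntegral_le_of_norm_le_const (μ := volume) (s := Ioc 0 s₁) (by simp) hdual'
    have hint : Integrable (fun s => ∫ z in B, f z * φ (S (-s) z)) I := hprod.integral_prod_left
    rw [← hI, integral_sub (integrable_const _) hint, integral_const, hswap, ← e0, hvol] at hb
    simpa [measureReal_def, hs₁.le, mul_comm c] using hb
  set N : Set (Phase d) := {z | κ ≤ |Q z|}
  have hN : MeasurableSet N := measurableSet_le measurable_const hQm.measurable.norm
  have habs : IntegrableOn (fun z => |f z|) B := hf.abs
  -- Off `N` the average is below `κ`; on `N` only the crude bound `C * s₁` is available.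
  have h2 : |∫ z in B, f z * Q z| ≤
      (κ * ∫ z in B, |f z|) + C * s₁ * ∫ z in N ∩ B, |f z| := by
    have e1 : ∫ z in N ∩ B, |f z| = ∫ z in B, N.indicator (fun z => |f z|) z := by
      rw [integral_indicator hN, Measure.restrict_restrict hN]
    rw [e1, ← integral_const_mul, ← integral_const_mul,
      ← integral_add (habs.const_mul κ) ((habs.indicator hN).const_mul _)]
    rw [← Real.norm_eq_abs]
    refine norm_integral_le_of_norm_le ((habs.const_mul κ).add ((habs.indicator hN).const_mul _))
      (Eventually.of_forall fun z => ?_)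
    rw [norm_mul, Real.norm_eq_abs, Real.norm_eq_abs]
    by_cases hz : z ∈ N
    · rw [indicator_of_mem hz]
      nlinarith [abs_nonneg (f z), hQC z, mul_le_mul_of_nonneg_left (hQC z) (abs_nonneg (f z)),
        mul_nonneg hκ (abs_nonneg (f z))]
    · rw [indicator_of_notMem hz]
      have : |Q z| ≤ κ := (not_le.1 hz).le
      nlinarith [mul_le_mul_of_nonneg_left this (abs_nonneg (f z))]
  have h3 : s₁ * |∫ z, f z * φ z| = |s₁ * ∫ z, f z * φ z| := by rw [abs_mul, abs_of_pos hs₁]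
  rw [h3]
  have h4 := abs_sub_abs_le_abs_sub (s₁ * ∫ z, f z * φ z) (∫ z in B, f z * Q z)
  linarith

/-- The averages along the flow of slightly translated observables are small in measure. -/
theorem exists_volume_average_le (hS : IsKineticFlow G R σ b S) {r : ℝ} (hr : r ≤ R - 1)
    {K : Set (ℝ × E d)} (hKm : MeasurableSet K) {Ψ : E d → ℝ} (hΨ : Measurable Ψ) {C : ℝ}
    (hC : ∀ v, |Ψ v| ≤ C) (hKΨ : {z : Phase d | (z.1, z.2.1) ∈ K ∧ z.2.2 ∈ Function.support Ψ} ⊆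
      phaseBox d r) (hΨr : Function.support Ψ ⊆ Metric.closedBall 0 r) (hKfin : volume K ≠ ⊤)
    {s₁ : ℝ} (hs₁0 : 0 ≤ s₁) (hs₁ : s₁ ≤ σ) {κ α : ℝ} (hκ : 0 < κ) (hα : 0 < α) :
    ∃ δ, 0 < δ ∧ ∀ h : E d, ‖h‖ ≤ δ → ∀ ψ : ℝ × E d → ℝ, Measurable ψ → (∀ p, |ψ p| ≤ 1) →
      volume ({z | κ ≤ |∫ s in Ioc 0 s₁, translationObservable K Ψ ψ h (S (-s) z)|} ∩
        phaseBox d (r + 1)) ≤ ENNReal.ofReal α := by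
  -- Uniformity in `ψ` comes from contradiction: failures along `δ = 1 / (n + 1)` give sequences `h
  -- n → 0` and `ψ n`, for which the averages vanish in L², against Chebyshev's inequality.
  by_contra! hcon
  choose h hh ψ hψ hψ1 hbig using fun n : ℕ => hcon (1 / ((n : ℝ) + 1)) (by positivity)
  have hh0 : Tendsto h atTop (𝓝 0) :=
    squeeze_zero_norm hh tendsto_one_div_add_atTop_nhds_zero_nat
  have hlim := hS.tendsto_setIntegral_average_sq hr hKm hΨ hC hKΨ hΨr hKfin hh0 hψ hψ1 hs₁
  obtain ⟨n, hn⟩ := (hlim.eventually (gt_mem_nhds (show 0 < κ ^ 2 * α by positivity))).exists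
  set φ := translationObservable K Ψ (ψ n) (h n)
  have hφm : Measurable φ := measurable_translationObservable hKm hΨ (hψ n) _
  have hφC : ∀ z, |φ z| ≤ 2 * C := abs_translationObservable_le (hψ1 n) hC _
  set Q : Phase d → ℝ := fun z => ∫ s in Ioc 0 s₁, φ (S (-s) z)
  have hQm : StronglyMeasurable Q := hS.stronglyMeasurable_average hφm s₁
  have hQi : IntegrableOn (fun z => Q z ^ 2) (phaseBox d (r + 1)) := by
    refine IntegrableOn.of_bound (isCompact_phaseBox _).measure_lt_top
      (hQm.measurable.pow_const 2).aestronglyMeasurable ((2 * C * s₁) ^ 2)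
      (Eventually.of_forall fun z => ?_)
    rw [norm_pow]
    exact pow_le_pow_left₀ (norm_nonneg _) (abs_average_le hφC hs₁0 z) 2
  have hcheb := mul_meas_ge_le_integral_of_nonneg (μ := volume.restrict (phaseBox d (r + 1)))
    (Eventually.of_forall fun z => sq_nonneg (Q z)) hQi (κ ^ 2)
  have hset : {z | κ ^ 2 ≤ Q z ^ 2} = {z | κ ≤ |Q z|} := by
    ext z
    simp only [mem_ofPred_eq]
    rw [← sq_abs (Q z)]
    exact pow_le_pow_iff_left₀ hκ.le (abs_nonneg _) two_ne_zero
  have hN : MeasurableSet {z | κ ≤ |Q z|} := measurableSet_le measurable_const hQm.measurable.norm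
  rw [hset, measureReal_def, Measure.restrict_apply hN] at hcheb
  have hfin : volume ({z | κ ≤ |Q z|} ∩ phaseBox d (r + 1)) ≠ ⊤ :=
    ((measure_mono inter_subset_right).trans_lt (isCompact_phaseBox _).measure_lt_top).ne
  have h1 : α < (volume ({z | κ ≤ |Q z|} ∩ phaseBox d (r + 1))).toReal :=
    (ENNReal.ofReal_lt_iff_lt_toReal hα.le hfin).1 (hbig n)
  have h2 := mul_lt_mul_of_pos_left h1 (show 0 < κ ^ 2 by positivity)
  linarith

end IsKineticFlow

theorem exists_support_subset_phaseBox {K : Set (ℝ × E d)} (hK : IsCompact K)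
    (hKn : K ⊆ {p | 0 ≤ p.1}) {Ψ : E d → ℝ} (hΨc : HasCompactSupport Ψ) :
    ∃ r, 0 ≤ r ∧ {z : Phase d | (z.1, z.2.1) ∈ K ∧ z.2.2 ∈ Function.support Ψ} ⊆ phaseBox d r ∧
      Function.support Ψ ⊆ Metric.closedBall 0 r := by
  have hKK : IsCompact (MeasurableEquiv.prodAssoc '' (K ×ˢ tsupport Ψ) : Set (Phase d)) :=
    (hK.prod hΨc).image (by
      change Continuous fun q : (ℝ × E d) × E d => (q.1.1, q.1.2, q.2)
      fun_prop)
  obtain ⟨r₀, hr₀, hKr₀⟩ := exists_subset_phaseBox hKK (by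
    rintro - ⟨q, hq, rfl⟩
    exact hKn hq.1)
  obtain ⟨r₁, hr₁0, hr₁⟩ := hΨc.isBounded.subset_closedBall_lt 0 0
  refine ⟨max r₀ r₁, hr₀.trans (le_max_left _ _), fun z hz => ?_, ?_⟩
  · have := hKr₀ ⟨((z.1, z.2.1), z.2.2), ⟨hz.1, subset_tsupport _ hz.2⟩, rfl⟩
    exact ⟨Metric.closedBall_subset_closedBall (le_max_left _ _) this.1, this.2⟩
  · exact (subset_tsupport _).trans
      (hr₁.trans (Metric.closedBall_subset_closedBall (le_max_right _ _)))

/-- Uniform smallness of the weak translations in `x` of velocity averages. -/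
theorem exists_abs_integral_translationObservable_le {F : ℝ → E d → E d}
    (hF : ContinuousInW1Infty F) {ι : Type*} {f g : ι → Phase d → ℝ} (hf : BoundedL1loc f)
    (hfv : LocEquiintegrableV f) (hg : BoundedL1loc g) (hfg : ∀ i, IsTransport F (f i) (g i))
    {K : Set (ℝ × E d)} (hK : IsCompact K) (hKn : K ⊆ {p | 0 ≤ p.1}) {Ψ : E d → ℝ}
    (hΨ : Continuous Ψ) (hΨc : HasCompactSupport Ψ) {η : ℝ} (hη : 0 < η) :
    ∃ δ, 0 < δ ∧ ∀ h : E d, ‖h‖ ≤ δ → ∀ ψ : ℝ × E d → ℝ, Measurable ψ → (∀ p, |ψ p| ≤ 1) →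
      ∀ i, |∫ z, f i z * translationObservable K Ψ ψ h z| ≤ η := by
  obtain ⟨C₀, hC₀⟩ := hΨc.exists_bound_of_continuous hΨ
  obtain ⟨C, hCpos, hC⟩ : ∃ C, 0 < C ∧ ∀ v, |Ψ v| ≤ C :=
    ⟨max C₀ 1, by positivity, fun v => (hC₀ v).trans (le_max_left _ _)⟩
  obtain ⟨r, hr, hKΨ, hΨr⟩ := exists_support_subset_phaseBox hK hKn hΨc
  obtain ⟨G, σ, b, S, hS, hdual⟩ := exists_flow_duality hF hr
  have hbox := fun r => isCompact_phaseBox (d := d) r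
  have hboxn := fun r => phaseBox_subset_nonnegTime (d := d) r
  obtain ⟨-, Cf, hCf⟩ := hf _ (hbox (r + 1)) (hboxn _)
  obtain ⟨-, Cg, hCg⟩ := hg _ (hbox (r + 2)) (hboxn _)
  -- The observable is bounded by `2 * C`. The choices of `s₁`, `κ` and the threshold `η / (6 * C)`
  -- make each of the three terms in `mul_abs_integral_le` at most `s₁ * (η / 3)`.
  set s₁ : ℝ := min σ (η / (6 * C * (Cg + 1)))
  have hs₁ : 0 < s₁ := lt_min hS.pos (by positivity)
  have hs₁σ : s₁ ≤ σ := min_le_left _ _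
  have hs₁g : s₁ * (2 * C) * Cg ≤ η / 3 := by
    have h1 : s₁ ≤ η / (6 * C * (Cg + 1)) := min_le_right _ _
    rw [le_div_iff₀ (by positivity)] at h1
    nlinarith [mul_pos hs₁ hCpos]
  set κ : ℝ := s₁ * η / (3 * (Cf + 1))
  have hκ : 0 < κ := by positivity
  have hκf : κ * Cf ≤ s₁ * (η / 3) := by
    have h1 : κ * (3 * (Cf + 1)) = s₁ * η := div_mul_cancel₀ _ (by positivity)
    nlinarith
  -- The exceptional set will be small in total volume only, with no control of its slices, so
  -- equiintegrability in (t, x, v) is required.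
  obtain ⟨α, hα, hequi⟩ := equiintegrable_of_transport hF hf hfv hg hfg
    (show 0 < η / (6 * C) by positivity) (hbox (r + 1)) (hboxn _)
  obtain ⟨δ, hδ, hsmall⟩ := hS.exists_volume_average_le (r := r) (by linarith) hK.measurableSet
    hΨ.measurable hC hKΨ hΨr hK.measure_lt_top.ne hs₁.le hs₁σ hκ hα
  refine ⟨δ, hδ, fun h hh ψ hψ hψ1 i => ?_⟩
  have hfi := hf.integrableOn i _ (hboxn (r + 1)) (hbox _)
  have hgi := hg.integrableOn i _ (hboxn (r + 2)) (hbox _)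
  set φ := translationObservable K Ψ ψ h
  have hφ : Measurable φ := measurable_translationObservable hK.measurableSet hΨ.measurable hψ h
  have hφr : Function.support φ ⊆ phaseBox d r :=
    (support_translationObservable_subset h).trans hKΨ
  have hφC : ∀ z, |φ z| ≤ 2 * C := abs_translationObservable_le hψ1 hC h
  have hIg : ∫ z in phaseBox d (r + 2), |g i z| ≤ Cg :=
    setIntegral_abs_le_of_lintegral_le hgi (hCg i)
  have hIf : ∫ z in phaseBox d (r + 1), |f i z| ≤ Cf :=
    setIntegral_abs_le_of_lintegral_le hfi (hCf i)
  have hmain := hS.mul_abs_integral_le hfi hs₁ hs₁σ hφ hφr hφC (c := η / 3) (fun s hs => by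
    refine (hdual _ _ (hf.integrableOn i) (hg.integrableOn i) (hfg i) s
      ⟨hs.1.le, hs.2.trans hs₁σ⟩ φ hφ hφr _ hφC).trans (le_trans ?_ hs₁g)
    have h1 := hs.1
    gcongr
    exact hs.2) hκ.le
  set N : Set (Phase d) := {z | κ ≤ |∫ s in Ioc 0 s₁, φ (S (-s) z)|}
  have hN : MeasurableSet N :=
    measurableSet_le measurable_const (hS.stronglyMeasurable_average hφ s₁).measurable.norm
  have hNf : ∫ z in N ∩ phaseBox d (r + 1), |f i z| ≤ η / (6 * C) := by
    have h1 := hequi _ (hN.inter (hbox (r + 1)).measurableSet) (hsmall h hh ψ hψ hψ1) i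
    rw [inter_assoc, inter_self] at h1
    have h2 := setIntegral_abs_le_of_lintegral_le (C := (η / (6 * C)).toNNReal)
      (hfi.mono_set inter_subset_right) h1
    rwa [Real.coe_toNNReal _ (by positivity)] at h2
  have h1 : 2 * C * s₁ * ∫ z in N ∩ phaseBox d (r + 1), |f i z| ≤ s₁ * (η / 3) := by
    refine (mul_le_mul_of_nonneg_left hNf (by positivity)).trans (le_of_eq ?_)
    field_simp
    norm_num
  have h2 := mul_le_mul_of_nonneg_left hIf hκ.le
  refine le_of_mul_le_mul_left ?_ hs₁
  linarith

end Compactness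

/-! ### Velocity averages and duality for the L¹ norm of translations. -/

section Moments

variable {d : ℕ} {K : Set (ℝ × E d)} {Ψ : E d → ℝ} {f : Phase d → ℝ}

/-- The localized velocity weight of a solution is integrable on the whole phase space. -/
theorem integrable_mul_indicator (hf : ∀ B ⊆ nonnegTime d, IsCompact B → IntegrableOn f B)
    (hK : IsCompact K) (hKn : K ⊆ {p | 0 ≤ p.1}) (hΨ : Continuous Ψ) (hΨc : HasCompactSupport Ψ)
    {w : ℝ × E d → ℝ} (hw : Measurable w) {C : ℝ} (hC : ∀ p, |w p| ≤ C) :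
    Integrable fun z : Phase d => f z * (K.indicator w (z.1, z.2.1) * Ψ z.2.2) := by
  obtain ⟨r, -, hr, -⟩ := exists_support_subset_phaseBox hK hKn hΨc
  obtain ⟨C', hC'⟩ := hΨc.exists_bound_of_continuous hΨ
  have hC0 : 0 ≤ C := (abs_nonneg _).trans (hC (0, 0))
  have hm : Measurable fun z : Phase d => K.indicator w (z.1, z.2.1) * Ψ z.2.2 :=
    ((hw.indicator hK.measurableSet).comp (measurable_fst.prodMk measurable_snd.fst)).mul
      (hΨ.measurable.comp measurable_snd.snd)
  have h1 := (hf _ (phaseBox_subset_nonnegTime r) (isCompact_phaseBox r)).mul_bdd (c := C * C')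
    hm.aestronglyMeasurable (Eventually.of_forall fun z => by
      rw [norm_mul]
      refine mul_le_mul ?_ (hC' _) (norm_nonneg _) hC0
      by_cases hz : (z.1, z.2.1) ∈ K
      · rw [indicator_of_mem hz]
        exact hC _
      · rw [indicator_of_notMem hz, norm_zero]
        exact hC0)
  refine (integrableOn_iff_integrable_of_support_subset fun z hz => hr ?_).1 h1
  have hz' := right_ne_zero_of_mul hz
  exact ⟨by_contra fun hn => left_ne_zero_of_mul hz' (indicator_of_notMem hn _),
    right_ne_zero_of_mul hz'⟩

theorem integral_mul_indicator_eq (w : ℝ × E d → ℝ) (p : ℝ × E d) :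
    ∫ v, f (p.1, p.2, v) * (K.indicator w (p.1, p.2) * Ψ v) =
      K.indicator (moment Ψ f) p * w p := by
  by_cases hp : p ∈ K
  · simp only [indicator_of_mem hp, moment, Prod.mk.eta]
    rw [← integral_mul_const]
    exact integral_congr_ae (Eventually.of_forall fun v => by ring)
  · simp [indicator_of_notMem hp]

theorem ae_integrable_moment (hf : ∀ B ⊆ nonnegTime d, IsCompact B → IntegrableOn f B)
    (hK : IsCompact K) (hKn : K ⊆ {p | 0 ≤ p.1}) (hΨ : Continuous Ψ)
    (hΨc : HasCompactSupport Ψ) :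
    (∀ᵐ p ∂(volume.restrict K), Integrable (fun v => f (p.1, p.2, v) * Ψ v)) ∧
      Integrable (K.indicator (moment Ψ f)) := by
  have hH := (measurePreserving_phaseAssoc.integrable_comp_emb
    MeasurableEquiv.prodAssoc.measurableEmbedding).2
      (integrable_mul_indicator hf hK hKn hΨ hΨc (measurable_const (a := (1 : ℝ))) (C := 1)
        (by simp))
  constructor
  · filter_upwards [ae_restrict_of_ae hH.prod_right_ae, ae_restrict_mem hK.measurableSet]
      with p hp hpK
    refine hp.congr (Eventually.of_forall fun v => ?_)
    change f (p.1, p.2, v) * (K.indicator (fun _ => 1) (p.1, p.2) * Ψ v) = _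
    rw [indicator_of_mem (show (p.1, p.2) ∈ K from hpK), one_mul]
  · refine hH.integral_prod_left.congr (Eventually.of_forall fun p => ?_)
    exact (integral_mul_indicator_eq (fun _ => 1) p).trans (mul_one _)

theorem integral_translationObservable
    (hf : ∀ B ⊆ nonnegTime d, IsCompact B → IntegrableOn f B)
    (hK : IsCompact K) (hKn : K ⊆ {p | 0 ≤ p.1}) (hΨ : Continuous Ψ) (hΨc : HasCompactSupport Ψ)
    {ψ : ℝ × E d → ℝ} (hψ : Measurable ψ) (hψ1 : ∀ p, |ψ p| ≤ 1) (h : E d) :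
    ∫ z, f z * translationObservable K Ψ ψ h z =
      ∫ p, K.indicator (moment Ψ f) p * (ψ (p.1, p.2 - h) - ψ p) := by
  refine (integral_phase (integrable_mul_indicator hf hK hKn hΨ hΨc (measurable_translation hψ h)
    (C := 2) fun p => ?_)).trans (integral_congr_ae (Eventually.of_forall fun p =>
      integral_mul_indicator_eq _ p))
  exact (abs_sub _ _).trans ((add_le_add (hψ1 _) (hψ1 _)).trans (by norm_num))

/-- The `L¹` norm of a translation difference, by duality. -/
theorem eLpNorm_translate_sub_le {u : ℝ × E d → ℝ} (hu : Integrable u) {h : E d} {η : ℝ}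
    (hη : ∀ ψ : ℝ × E d → ℝ, Measurable ψ → (∀ p, |ψ p| ≤ 1) →
      ∫ p, u p * (ψ (p.1, p.2 - h) - ψ p) ≤ η) :
    eLpNorm (fun p : ℝ × E d => u (p.1, p.2 + h) - u p) 1 volume ≤ ENNReal.ofReal η := by
  let T : ℝ × E d ≃ᵐ ℝ × E d := (MeasurableEquiv.refl ℝ).prodCongr (MeasurableEquiv.addRight h)
  have hT : MeasurePreserving T :=
    (MeasurePreserving.id volume).prod (measurePreserving_add_right volume h)
  have huT : Integrable fun p : ℝ × E d => u (p.1, p.2 + h) :=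
    (hT.integrable_comp_emb T.measurableEmbedding).2 hu
  have hD := huT.sub hu
  set D : ℝ × E d → ℝ := fun p => u (p.1, p.2 + h) - u p
  replace hD : Integrable D := hD
  rw [eLpNorm_one_eq_lintegral_enorm, ← ofReal_integral_norm_eq_lintegral_enorm hD]
  -- The extremal `ψ` is the sign of the translation difference; a translation in `x` then moves the
  -- shift from `u` to `ψ`.
  refine ENNReal.ofReal_le_ofReal (le_trans (le_of_eq ?_)
    (hη (fun p => if 0 ≤ hD.1.mk D p then 1 else -1) ?_ ?_))
  · set ψ : ℝ × E d → ℝ := fun p => if 0 ≤ hD.1.mk D p then 1 else -1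
    have hψm : Measurable ψ := Measurable.ite
      (measurableSet_le measurable_const hD.1.measurable_mk) measurable_const measurable_const
    have hψ1 : ∀ p, ‖ψ p‖ ≤ 1 := fun p => by
      simp only [ψ]
      split_ifs <;> simp
    have hψT : Measurable fun p : ℝ × E d => ψ (p.1, p.2 - h) :=
      hψm.comp (measurable_fst.prodMk (measurable_snd.sub_const h))
    have e1 : ∫ p, ‖D p‖ = ∫ p, D p * ψ p := by
      refine integral_congr_ae ?_
      filter_upwards [hD.1.ae_eq_mk] with p hp
      simp only [ψ, ← hp]
      split_ifs with h0
      · rw [mul_one, Real.norm_of_nonneg h0]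
      · rw [mul_neg_one, Real.norm_of_nonpos (not_le.1 h0).le]
    have e2 : ∫ p, u p * ψ (p.1, p.2 - h) = ∫ p : ℝ × E d, u (p.1, p.2 + h) * ψ p := by
      rw [← hT.integral_comp']
      refine integral_congr_ae (Eventually.of_forall fun p => ?_)
      change u (p.1, p.2 + h) * ψ (p.1, p.2 + h - h) = _
      rw [add_sub_cancel_right]
    have i1 : Integrable fun p => u p * ψ p :=
      hu.mul_bdd (c := 1) hψm.aestronglyMeasurable (Eventually.of_forall hψ1)
    have i2 : Integrable fun p : ℝ × E d => u p * ψ (p.1, p.2 - h) :=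
      hu.mul_bdd (c := 1) hψT.aestronglyMeasurable (Eventually.of_forall fun p => hψ1 _)
    have i3 : Integrable fun p : ℝ × E d => u (p.1, p.2 + h) * ψ p :=
      huT.mul_bdd (c := 1) hψm.aestronglyMeasurable (Eventually.of_forall hψ1)
    simp only [mul_sub]
    rw [integral_sub i2 i1, e2, ← integral_sub i3 i1, e1]
    exact integral_congr_ae (Eventually.of_forall fun p => sub_mul _ _ _)
  · exact Measurable.ite
      (measurableSet_le measurable_const hD.1.measurable_mk) measurable_const measurable_const
  · intro p
    beta_reduce
    split_ifs <;> simp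

end Moments

end KineticAveraging

/-! ### The two conclusions together. -/

open KineticAveraging in
theorem mainTheorem4 (d : ℕ) (hd : 1 ≤ d) (F : ℝ → E d → E d) (hF : ContinuousInW1Infty F)
    {ι : Type*} (f : ι → Phase d → ℝ) (hf : BoundedL1loc f) (hfv : LocEquiintegrableV f)
    (htransport : ∃ g : ι → Phase d → ℝ, BoundedL1loc g ∧ ∀ i, IsTransport F (f i) (g i)) :
    LocEquiintegrableXV f ∧
    ∀ Ψ : E d → ℝ, ContDiff ℝ 1 Ψ → HasCompactSupport Ψ →
      ∀ K : Set (ℝ × E d), IsCompact K → K ⊆ {p | 0 ≤ p.1} →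
        (∀ i, (∀ᵐ p ∂(volume.restrict K), Integrable (fun v => f i (p.1, p.2, v) * Ψ v)) ∧
          IntegrableOn (moment Ψ (f i)) K) ∧
        Tendsto (fun δ : ℝ => ⨆ (i : ι) (x' : E d) (_ : ‖x'‖ ≤ δ),
            eLpNorm (fun p : ℝ × E d =>
              K.indicator (moment Ψ (f i)) (p.1, p.2 + x') - K.indicator (moment Ψ (f i)) p)
              1 volume)
          (𝓝[>] 0) (𝓝 0) := by
  obtain ⟨g, hg, hfg⟩ := htransport
  refine ⟨locEquiintegrableXV_of_transport hF hf hfv hg hfg, fun Ψ hΨ hΨc K hK hKn => ?_⟩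
  have hint := fun i => ae_integrable_moment (hf.integrableOn i) hK hKn hΨ.continuous hΨc
  refine ⟨fun i => ⟨(hint i).1, (integrable_indicator_iff hK.measurableSet).1 (hint i).2⟩, ?_⟩
  refine ENNReal.tendsto_nhds_zero.2 fun ε hε => ?_
  obtain ⟨η, hη0, hηε⟩ := ENNReal.lt_iff_exists_nnreal_btwn.1 hε
  obtain ⟨δ₀, hδ₀, hδ⟩ := exists_abs_integral_translationObservable_le hF hf hfv hg hfg hK hKn
    hΨ.continuous hΨc (η := η) (by exact_mod_cast hη0)
  filter_upwards [Ioc_mem_nhdsGT hδ₀] with δ hδδ₀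
  refine iSup_le fun i => iSup_le fun x' => iSup_le fun hx' => ?_
  refine (eLpNorm_translate_sub_le (η := η) (hint i).2 fun ψ hψ hψ1 => ?_).trans ?_
  · rw [← integral_translationObservable (hf.integrableOn i) hK hKn hΨ.continuous hΨc hψ hψ1]
    exact (le_abs_self _).trans (hδ x' (hx'.trans hδδ₀.2) ψ hψ hψ1 i)
  · rw [ENNReal.ofReal_coe_nnreal]
    exact hηε.le
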